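/- **Relative homotopy invariance.** Conventions. A *stack* is a functor from topological spaces (contravariantly) to groupoids satisfying descent for open covers. A *(separated) orbispace* is a stack $X$ which admits a representable étale surjection $U\to X$ from a topological space $U$ and whose diagonal $X\to X\times X$ is (representable,) separated and proper. Its *coarse space* $|X|$ is the initial topological space receiving a map from $X$, and $X$ is *paracompact* if $|X|$ is. A *pair* $(X,A)$ is a stack $X$ together with a closed substack $A\subseteq X$, and a *map of pairs* $(X,A)\to(X',A')$ is a map $X\to X'$ sending $A$ inside $A'$. Two maps of stacks $X\to Y$ are *homotopic* if there is a map $X\times[0,1]\to Y$ whose restrictions to $X\times\{0\}$ and $X\times\{1\}$ are (isomorphic to) the two given maps, and a map $X\to Y$ is a *homotopy equivalence* if there is a map $Y\to X$ such that both compositions are homotopic to the respective identity maps. A *vector bundle* on a stack is a complex vector bundle of finite bounded rank. The set of isomorphism classes of triples $(E_0,E_1,i)$, where $E_0,E_1$ are vector bundles on $X$ and $i:E_0|_A\to E_1|_A$ is an isomorphism, is an abelian monoid under direct sum, and $K^0(X,A)$ is its quotient by the submonoid of classes of triples of the form $(E,E,\mathrm{id}_{E|_A})$; here the quotient of an abelian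 monoid $M$ by a submonoid $M'$ is $M/{\sim}$, where $x\sim y$ iff $x+a=y+b$ for some $a,b\in M'$. Pullback of triples makes $K^0$ contravariantly functorial under maps of pairs. Statement. Let $(X,A)$ and $(X',A')$ be pairs for which $X$ and $X'$ are paracompact orbispaces (then so are $A$ and $A'$), and let $(X,A)\to(X',A')$ be a map of pairs whose constituent maps $X\to X'$ and $A\to A'$ are individually homotopy equivalences. Then the induced map $K^0(X',A')\to K^0(X,A)$ is an isomorphism. -/

import Mathlib

open CategoryTheory

universe u v w v' w' v'' w''

noncomputable section

namespace Orbispace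

/-! ## Stacks on the category of topological spaces

A stack `X` is given as a category fibered in groupoids: a category `X.obj` (its objects over a
space `T` are the maps `T → X`) with a functor `X.p` to `TopCat`, satisfying descent for open
covers.  Maps of stacks are functors over `TopCat` (`BasedFunctor`), and 2-isomorphisms are natural
isomorphisms over `TopCat`. -/

/-- A family of maps `U i ⟶ T` is (isomorphic to) an open cover of `T`. -/
def IsOpenCover {ι : Type u} {U : ι → TopCat.{u}} {T : TopCat.{u}} (j : ∀ i, U i ⟶ T) : Prop :=
  (∀ i, Topology.IsOpenEmbedding (j i)) ∧ ∀ t : T, ∃ i, ∃ s : U i, j i s = t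

/-- `X` is a stack (in groupoids) on topological spaces. -/
structure IsStack (X : BasedCategory.{v, w} TopCat.{u}) : Prop where
  /-- Pullbacks exist. -/
  exists_lift : ∀ (y : X.obj) {S : TopCat.{u}} (f : S ⟶ X.p.obj y),
    ∃ (x : X.obj) (φ : x ⟶ y), X.p.IsHomLift f φ
  /-- Every morphism is cartesian, so that the fibers are groupoids. -/
  isStronglyCartesian : ∀ {x y : X.obj} (φ : x ⟶ y), X.p.IsStronglyCartesian (X.p.map φ) φ
  /-- Morphisms glue uniquely along open covers. -/
  glue_hom : ∀ {ι : Type u} {x y : X.obj} (c : ι → X.obj) (a : ∀ i, c i ⟶ x),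
    IsOpenCover (fun i => X.p.map (a i)) → ∀ φ : ∀ i, c i ⟶ y,
    (∀ (i k : ι) (z : X.obj) (l : z ⟶ c i) (r : z ⟶ c k),
      l ≫ a i = r ≫ a k → l ≫ φ i = r ≫ φ k) →
    ∃! ψ : x ⟶ y, ∀ i, a i ≫ ψ = φ i
  /-- Objects glue along open covers: given objects `c i` over the members of an open cover of `T`
  and isomorphisms `c i ← o i k → c k` over the pairwise intersections, satisfying the cocycle
  condition, there is an object over `T` which restricts to the given descent datum. -/
  glue_obj : ∀ {ι : Type u} {T : TopCat.{u}} (c : ι → X.obj) (j : ∀ i, X.p.obj (c i) ⟶ T),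
    IsOpenCover j → ∀ (o : ι → ι → X.obj) (l : ∀ i k, o i k ⟶ c i) (r : ∀ i k, o i k ⟶ c k),
    (∀ i k, IsPullback (X.p.map (l i k)) (X.p.map (r i k)) (j i) (j k)) →
    (∀ (i k m : ι) (z : X.obj) (α : z ⟶ c i) (β : z ⟶ c k) (γ : z ⟶ c m),
      (∃ s : z ⟶ o i k, s ≫ l i k = α ∧ s ≫ r i k = β) →
      (∃ s : z ⟶ o k m, s ≫ l k m = β ∧ s ≫ r k m = γ) →
      ∃ s : z ⟶ o i m, s ≫ l i m = α ∧ s ≫ r i m = γ) →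
    ∃ y : X.obj, X.p.obj y = T ∧ ∃ a : ∀ i, c i ⟶ y,
      (∀ i, X.p.IsHomLift (j i) (a i)) ∧ ∀ i k, l i k ≫ a i = r i k ≫ a k

/-! ## Orbispaces -/

/-- The object `x`, viewed as a map `U → X` from the space `U = X.p.obj x`, is representable, étale
and surjective.  A map from `T` to the fiber product of `x : U → X` and `y : W → X` is a span
`x ⟵ z ⟶ y` with `z` over `T`, so the fiber product is a space iff there is a universal span, and
its projection to `W` is then the image of the right leg. -/
def IsEtaleAtlas (X : BasedCategory.{v, w} TopCat.{u}) (x : X.obj) : Prop :=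
  ∀ y : X.obj, ∃ (z : X.obj) (a : z ⟶ x) (b : z ⟶ y),
    (∀ (t : X.obj) (a₁ : t ⟶ x) (b₁ : t ⟶ y), ∃! m : t ⟶ z, m ≫ a = a₁ ∧ m ≫ b = b₁) ∧
    IsLocalHomeomorph (X.p.map b) ∧ Function.Surjective (X.p.map b)

/-- The diagonal `X → X × X` is representable, separated and proper.  Two objects `x`, `y` over the
same space `T` are a map `T → X × X`; the fiber product of the diagonal with this map is
represented by a universal span `x ⟵ z ⟶ y` whose legs lie over the same map to `T`. -/
def HasSeparatedProperDiagonal (X : BasedCategory.{v, w} TopCat.{u}) : Prop :=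
  ∀ (x y : X.obj) (e : X.p.obj x ≅ X.p.obj y), ∃ (z : X.obj) (a : z ⟶ x) (b : z ⟶ y),
    X.p.map a ≫ e.hom = X.p.map b ∧
    (∀ (t : X.obj) (a₁ : t ⟶ x) (b₁ : t ⟶ y), X.p.map a₁ ≫ e.hom = X.p.map b₁ →
      ∃! m : t ⟶ z, m ≫ a = a₁ ∧ m ≫ b = b₁) ∧
    IsSeparatedMap (X.p.map a) ∧ IsProperMap (X.p.map a)

/-- `X` is a (separated) orbispace. -/
structure IsOrbispace (X : BasedCategory.{v, w} TopCat.{u}) : Prop where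
  isStack : IsStack X
  exists_etaleAtlas : ∃ x : X.obj, IsEtaleAtlas X x
  diagonal : HasSeparatedProperDiagonal X

/-- The coarse space of `X`, the initial topological space under `X` (the colimit of `X.p`): all
points of all `X.p.obj x`, identified along the morphisms of `X.obj`.  A subset is open iff its
inverse image in every `X.p.obj x` is open. -/
def Coarse (X : BasedCategory.{v, w} TopCat.{u}) : Type (max u w) :=
  Quot fun a b : Σ x : X.obj, X.p.obj x => ∃ f : a.1 ⟶ b.1, X.p.map f a.2 = b.2

instance (X : BasedCategory.{v, w} TopCat.{u}) : TopologicalSpace (Coarse X) :=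
  inferInstanceAs (TopologicalSpace (Quot _))

/-- `X` is a paracompact orbispace: an orbispace whose coarse space is paracompact. -/
structure IsParacompactOrbispace (X : BasedCategory.{v, w} TopCat.{u}) : Prop
    extends IsOrbispace X where
  paracompact : ParacompactSpace (Coarse X)

/-! ## Homotopies -/

/-- The product of a stack with a topological space `K`: objects over `T` are pairs of an object
`x` of `X` over `T` and a continuous map `T → K`. -/
def prodSpace (X : BasedCategory.{v, w} TopCat.{u}) (K : TopCat.{u}) :
    BasedCategory.{v, max u w} TopCat.{u} :=
  BasedCategory.ofFunctor (CostructuredArrow.proj X.p K ⋙ X.p)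

/-- The inclusion `X = X × {k} → X × K`. -/
def prodIncl (X : BasedCategory.{v, w} TopCat.{u}) (K : TopCat.{u}) (k : K) :
    X ⥤ᵇ prodSpace X K where
  obj x := CostructuredArrow.mk (Y := x) (TopCat.ofHom (ContinuousMap.const (X.p.obj x) k))
  map f := CostructuredArrow.homMk f (by ext; rfl)
  w := rfl

/-- The unit interval `[0,1]`. -/
def interval : TopCat.{u} := TopCat.of (ULift.{u} unitInterval)

/-- Two maps `X → Y` are homotopic: there is a map `X × [0,1] → Y` which restricts to them over
`X × {0}` and `X × {1}` (up to 2-isomorphism). -/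
def Homotopic {X : BasedCategory.{v, w} TopCat.{u}} {Y : BasedCategory.{v', w'} TopCat.{u}}
    (F G : X ⥤ᵇ Y) : Prop :=
  ∃ H : prodSpace X interval ⥤ᵇ Y,
    Nonempty ((prodIncl X interval (ULift.up 0)).comp H ≅ F) ∧
    Nonempty ((prodIncl X interval (ULift.up 1)).comp H ≅ G)

/-- `F` is a homotopy equivalence. -/
def IsHomotopyEquiv {X : BasedCategory.{v, w} TopCat.{u}} {Y : BasedCategory.{v', w'} TopCat.{u}}
    (F : X ⥤ᵇ Y) : Prop :=
  ∃ G : Y ⥤ᵇ X, Homotopic (F.comp G) (BasedFunctor.id X) ∧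
    Homotopic (G.comp F) (BasedFunctor.id Y)

/-! ## Pairs -/

/-- A closed substack of `X`: a class of objects such that for every `x`, viewed as a map `T → X`,
there is a closed subset `C` of `T` such that a pullback of `x` along `T' → T` is in the class iff
`T' → T` has image in `C`. -/
structure ClosedSubstack (X : BasedCategory.{v, w} TopCat.{u}) where
  mem : ObjectProperty X.obj
  exists_isClosed : ∀ x : X.obj, ∃ C : Set (X.p.obj x), IsClosed C ∧
    ∀ (z : X.obj) (f : z ⟶ x), mem z ↔ ∀ t : X.p.obj z, X.p.map f t ∈ C

/-- A closed substack as a category over `TopCat`. -/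
def ClosedSubstack.toBased {X : BasedCategory.{v, w} TopCat.{u}} (A : ClosedSubstack X) :
    BasedCategory.{v, w} TopCat.{u} :=
  BasedCategory.ofFunctor (A.mem.ι ⋙ X.p)

/-- The inclusion of a closed substack. -/
def ClosedSubstack.incl {X : BasedCategory.{v, w} TopCat.{u}} (A : ClosedSubstack X) :
    A.toBased ⥤ᵇ X where
  toFunctor := A.mem.ι
  w := rfl

/-- A map of pairs `(X, A) → (X', A')`: a map `X → X'` sending `A` inside `A'`. -/
structure PairMap {X : BasedCategory.{v, w} TopCat.{u}} {X' : BasedCategory.{v', w'} TopCat.{u}}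
    (A : ClosedSubstack X) (A' : ClosedSubstack X') where
  total : X ⥤ᵇ X'
  mem : ∀ x, A.mem x → A'.mem (total.obj x)

/-- The constituent map `A → A'` of a map of pairs `(X, A) → (X', A')`. -/
def PairMap.sub {X : BasedCategory.{v, w} TopCat.{u}} {X' : BasedCategory.{v', w'} TopCat.{u}}
    {A : ClosedSubstack X} {A' : ClosedSubstack X'} (f : PairMap A A') :
    A.toBased ⥤ᵇ A'.toBased where
  obj a := ⟨f.total.obj a.obj, f.mem a.obj a.property⟩
  map φ := ObjectProperty.homMk (f.total.map φ.hom)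
  map_id a := by
    apply ObjectProperty.hom_ext
    exact f.total.map_id a.obj
  map_comp φ ψ := by
    apply ObjectProperty.hom_ext
    exact f.total.map_comp φ.hom ψ.hom
  w := by
    change (A.mem.ι ⋙ f.total.toFunctor) ⋙ X'.p = A.mem.ι ⋙ X.p
    rw [Functor.assoc, f.total.w]

/-! ## Vector bundles -/

/-- For a map of spaces `π : V → T` with fiberwise operations, a trivialization over `U ⊆ T`:
an isomorphism of `π ⁻¹ U` with `U × ℂⁿ` over `U` compatible with the operations. -/
structure Trivialization {V T : Type u} [TopologicalSpace V] [TopologicalSpace T] (π : V → T)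
    (vadd : ∀ a b : V, π a = π b → V) (smul : ℂ → V → V) (U : Set T) (n : ℕ) where
  homeo : {a : V // π a ∈ U} ≃ₜ U × (Fin n → ℂ)
  fst_eq : ∀ a, ((homeo a).1 : T) = π a
  map_add : ∀ (a b : V) (h : π a = π b) (ha : π a ∈ U) (hb : π b ∈ U)
    (hs : π (vadd a b h) ∈ U),
    (homeo ⟨vadd a b h, hs⟩).2 = (homeo ⟨a, ha⟩).2 + (homeo ⟨b, hb⟩).2
  map_smul : ∀ (c : ℂ) (a : V) (ha : π a ∈ U) (hs : π (smul c a) ∈ U),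
    (homeo ⟨smul c a, hs⟩).2 = c • (homeo ⟨a, ha⟩).2

/-- A complex vector bundle of bounded rank on `X`: a representable map to `X` (for each object `x`,
viewed as a map `T → X`, a space `total.obj x` over `T`, compatible with pullback), with fiberwise
addition and scaling, such that each `total.obj x → T` is locally isomorphic to some
`ℂⁿ × U → U`, with `n` bounded on `X`.  (Continuity of the operations follows from local
triviality.) -/
structure VectorBundle (X : BasedCategory.{v, w} TopCat.{u}) where
  total : X.obj ⥤ TopCat.{u}
  proj : total ⟶ X.p
  cartesian : NatTrans.Equifibered proj
  vadd : ∀ (x : X.obj) (a b : total.obj x), proj.app x a = proj.app x b → total.obj x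
  smul : ∀ (x : X.obj), ℂ → total.obj x → total.obj x
  proj_vadd : ∀ x a b h, proj.app x (vadd x a b h) = proj.app x a
  proj_smul : ∀ x c a, proj.app x (smul x c a) = proj.app x a
  map_vadd : ∀ {x y : X.obj} (f : x ⟶ y) (a b : total.obj x) (h : proj.app x a = proj.app x b)
    (h' : proj.app y (total.map f a) = proj.app y (total.map f b)),
    total.map f (vadd x a b h) = vadd y (total.map f a) (total.map f b) h'
  map_smul : ∀ {x y : X.obj} (f : x ⟶ y) (c : ℂ) (a : total.obj x),
    total.map f (smul x c a) = smul y c (total.map f a)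
  exists_trivialization : ∃ N : ℕ, ∀ (x : X.obj) (t : X.p.obj x), ∃ n ≤ N, ∃ U : Set (X.p.obj x),
    IsOpen U ∧ t ∈ U ∧ Nonempty (Trivialization (proj.app x) (vadd x) (smul x) U n)

namespace VectorBundle

variable {X : BasedCategory.{v, w} TopCat.{u}} {Y : BasedCategory.{v', w'} TopCat.{u}}

/-- An isomorphism of vector bundles. -/
structure Iso (E F : VectorBundle X) where
  homeo : ∀ x : X.obj, E.total.obj x ≃ₜ F.total.obj x
  naturality : ∀ {x y : X.obj} (f : x ⟶ y) (a : E.total.obj x),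
    homeo y (E.total.map f a) = F.total.map f (homeo x a)
  proj_eq : ∀ x a, F.proj.app x (homeo x a) = E.proj.app x a
  map_vadd : ∀ x a b h h', homeo x (E.vadd x a b h) = F.vadd x (homeo x a) (homeo x b) h'
  map_smul : ∀ x c a, homeo x (E.smul x c a) = F.smul x c (homeo x a)

/-- The identity isomorphism. -/
def Iso.refl (E : VectorBundle X) : Iso E E where
  homeo _ := Homeomorph.refl _
  naturality _ _ := rfl
  proj_eq _ _ := rfl
  map_vadd _ _ _ _ _ := rfl
  map_smul _ _ _ := rfl

lemma vadd_congr (E : VectorBundle X) (x : X.obj) {a a' b b' : E.total.obj x} (ha : a = a')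
    (hb : b = b') (h : E.proj.app x a = E.proj.app x b) :
    E.vadd x a b h = E.vadd x a' b' (by rw [← ha, ← hb, h]) := by
  subst ha hb; rfl

/-- The inverse isomorphism. -/
def Iso.symm {E F : VectorBundle X} (α : Iso E F) : Iso F E where
  homeo x := (α.homeo x).symm
  naturality {x y} f a := by
    apply (α.homeo y).injective
    rw [α.naturality]; simp
  proj_eq x a := by
    rw [← α.proj_eq]; simp
  map_vadd x a b h h' := by
    apply (α.homeo x).injective
    rw [α.map_vadd x _ _ h' (by simpa using h)]
    rw [Homeomorph.apply_symm_apply]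
    exact F.vadd_congr x (by simp) (by simp) _
  map_smul x c a := by
    apply (α.homeo x).injective
    rw [α.map_smul]; simp

/-- The composition of isomorphisms. -/
def Iso.trans {E F G : VectorBundle X} (α : Iso E F) (β : Iso F G) : Iso E G where
  homeo x := (α.homeo x).trans (β.homeo x)
  naturality f a := by simp [α.naturality, β.naturality]
  proj_eq x a := by simp [α.proj_eq, β.proj_eq]
  map_vadd x a b h h' := by
    simp only [Homeomorph.trans_apply]
    rw [α.map_vadd x a b h (by rw [α.proj_eq, α.proj_eq, h]), β.map_vadd]
  map_smul x c a := by simp [α.map_smul, β.map_smul]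

/-! ### Pullback -/

lemma app_eqToHom_injective (F : Y ⥤ᵇ X) (y : Y.obj) :
    Function.Injective ((eqToHom F.w : F.toFunctor ⋙ X.p ⟶ Y.p).app y) :=
  (TopCat.homeoOfIso ((eqToIso F.w).app y)).injective

/-- Transport of a trivialization along a homeomorphism of base spaces. -/
def Trivialization.ofHomeo {V T T' : Type u} [TopologicalSpace V] [TopologicalSpace T]
    [TopologicalSpace T'] {π : V → T} {vadd : ∀ a b : V, π a = π b → V} {smul : ℂ → V → V}
    {U : Set T} {n : ℕ} (τ : Trivialization π vadd smul U n) (e : T ≃ₜ T') (π' : V → T')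
    (hπ' : ∀ a, π' a = e (π a)) :
    Trivialization π' (fun a b h => vadd a b (e.injective (by rw [← hπ', ← hπ', h]))) smul
      (e.symm ⁻¹' U) n where
  homeo :=
    { toFun := fun a => (⟨π' a.1, a.2⟩, (τ.homeo ⟨a.1, by simpa [hπ'] using a.2⟩).2)
      invFun := fun q => ⟨(τ.homeo.symm (⟨e.symm q.1.1, q.1.2⟩, q.2)).1, by
        simpa [hπ'] using (τ.homeo.symm (⟨e.symm q.1.1, q.1.2⟩, q.2)).2⟩
      left_inv := by
        intro a
        have h : (⟨⟨e.symm (π' a.1), a.2⟩, (τ.homeo ⟨a.1, by simpa [hπ'] using a.2⟩).2⟩ :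
            U × (Fin n → ℂ)) = τ.homeo ⟨a.1, by simpa [hπ'] using a.2⟩ := by
          refine Prod.ext (Subtype.ext ?_) rfl
          rw [τ.fst_eq]; simp [hπ']
        apply Subtype.ext
        simp only [h, Homeomorph.symm_apply_apply]
      right_inv := by
        rintro ⟨⟨t, ht⟩, c⟩
        refine Prod.ext (Subtype.ext ?_) ?_
        · have := τ.fst_eq (τ.homeo.symm (⟨e.symm t, ht⟩, c))
          simp only [Homeomorph.apply_symm_apply] at this
          simp [hπ', ← this]
        · simp
      continuous_toFun := by
        have hc : Continuous fun a : {a : V // π' a ∈ e.symm ⁻¹' U} =>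
            τ.homeo ⟨a.1, by simpa [hπ'] using a.2⟩ := by fun_prop
        have hp : Continuous fun a : {a : V // π' a ∈ e.symm ⁻¹' U} => π' a.1 := by
          have : (fun a : {a : V // π' a ∈ e.symm ⁻¹' U} => π' a.1) =
              fun a => e ((τ.homeo ⟨a.1, by simpa [hπ'] using a.2⟩).1 : T) := by
            funext a
            exact (hπ' a.1).trans (congrArg e (τ.fst_eq ⟨a.1, by simpa [hπ'] using a.2⟩).symm)
          rw [this]
          exact e.continuous.comp (continuous_subtype_val.comp hc.fst)
        exact (hp.subtype_mk _).prodMk hc.snd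
      continuous_invFun := by
        refine Continuous.subtype_mk ?_ _
        fun_prop }
  fst_eq _ := rfl
  map_add a b h ha hb hs := τ.map_add a b _ _ _ _
  map_smul c a ha hs := τ.map_smul c a _ _

/-- The pullback of a vector bundle along a map of stacks. -/
def pullback (E : VectorBundle X) (F : Y ⥤ᵇ X) : VectorBundle Y where
  total := F.toFunctor ⋙ E.total
  proj := Functor.whiskerLeft F.toFunctor E.proj ≫ eqToHom F.w
  cartesian := by
    apply NatTrans.Equifibered.comp
    · intro x y f
      exact E.cartesian (F.map f)
    · exact NatTrans.Equifibered.of_isIso _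
  vadd y a b h := E.vadd (F.obj y) a b (app_eqToHom_injective F y h)
  smul y c a := E.smul (F.obj y) c a
  proj_vadd y a b h := congrArg ((eqToHom F.w : F.toFunctor ⋙ X.p ⟶ Y.p).app y)
    (E.proj_vadd (F.obj y) a b _)
  proj_smul y c a := congrArg ((eqToHom F.w : F.toFunctor ⋙ X.p ⟶ Y.p).app y)
    (E.proj_smul (F.obj y) c a)
  map_vadd f a b _ _ := E.map_vadd (F.map f) a b _ _
  map_smul f c a := E.map_smul (F.map f) c a
  exists_trivialization := by
    obtain ⟨N, hN⟩ := E.exists_trivialization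
    refine ⟨N, fun y t => ?_⟩
    let e := TopCat.homeoOfIso ((eqToIso F.w).app y)
    obtain ⟨n, hn, U, hU, ht, ⟨τ⟩⟩ := hN (F.obj y) (e.symm t)
    exact ⟨n, hn, e.symm ⁻¹' U, hU.preimage e.symm.continuous, ht,
      ⟨Trivialization.ofHomeo τ e _ fun _ => rfl⟩⟩

/-- The pullback of an isomorphism of vector bundles. -/
def Iso.pullback {E E' : VectorBundle X} (α : Iso E E') (F : Y ⥤ᵇ X) :
    Iso (E.pullback F) (E'.pullback F) where
  homeo y := α.homeo (F.obj y)
  naturality f a := α.naturality (F.map f) a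
  proj_eq y a := congrArg ((eqToHom F.w : F.toFunctor ⋙ X.p ⟶ Y.p).app y)
    (α.proj_eq (F.obj y) a)
  map_vadd y a b _ _ := α.map_vadd (F.obj y) a b _ _
  map_smul y c a := α.map_smul (F.obj y) c a

/-! ### Direct sums -/

/-- The direct sum of two trivializations, on the fiber product. -/
def Trivialization.sum {V V' T : Type u} [TopologicalSpace V] [TopologicalSpace V']
    [TopologicalSpace T] {π : V → T} {vadd : ∀ a b : V, π a = π b → V} {smul : ℂ → V → V}
    {π' : V' → T} {vadd' : ∀ a b : V', π' a = π' b → V'} {smul' : ℂ → V' → V'}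
    {U U' : Set T} {n m : ℕ} (τ : Trivialization π vadd smul U n)
    (σ : Trivialization π' vadd' smul' U' m)
    (hv : ∀ a b h, π (vadd a b h) = π a) (hs : ∀ c a, π (smul c a) = π a)
    (hv' : ∀ a b h, π' (vadd' a b h) = π' a) (hs' : ∀ c a, π' (smul' c a) = π' a) :
    Trivialization (V := {q : V × V' // π q.1 = π' q.2}) (fun q => π q.1.1)
      (fun a b h => ⟨(vadd a.1.1 b.1.1 h, vadd' a.1.2 b.1.2 (by rw [← a.2, ← b.2]; exact h)), by
        rw [hv, hv', a.2]⟩)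
      (fun c a => ⟨(smul c a.1.1, smul' c a.1.2), by rw [hs, hs', a.2]⟩) (U ∩ U') (n + m) where
  homeo :=
    { toFun := fun q => (⟨π q.1.1.1, q.2⟩, Fin.append (τ.homeo ⟨q.1.1.1, q.2.1⟩).2
        (σ.homeo ⟨q.1.1.2, q.1.2 ▸ q.2.2⟩).2)
      invFun := fun r =>
        have h1 : π (τ.homeo.symm (⟨r.1.1, r.1.2.1⟩, fun k => r.2 (Fin.castAdd m k))).1 = r.1.1 := by
          rw [← τ.fst_eq]; simp
        have h2 : π' (σ.homeo.symm (⟨r.1.1, r.1.2.2⟩, fun k => r.2 (Fin.natAdd n k))).1 = r.1.1 := by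
          rw [← σ.fst_eq]; simp
        ⟨⟨((τ.homeo.symm (⟨r.1.1, r.1.2.1⟩, fun k => r.2 (Fin.castAdd m k))).1,
          (σ.homeo.symm (⟨r.1.1, r.1.2.2⟩, fun k => r.2 (Fin.natAdd n k))).1), h1.trans h2.symm⟩,
          h1.symm ▸ r.1.2⟩
      left_inv := by
        intro q
        apply Subtype.ext
        apply Subtype.ext
        refine Prod.ext ?_ ?_
        · refine congrArg Subtype.val (a₂ := (⟨q.1.1.1, q.2.1⟩ : {a : V // π a ∈ U})) ?_
          rw [Homeomorph.symm_apply_eq]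
          refine Prod.ext (Subtype.ext (τ.fst_eq ⟨q.1.1.1, q.2.1⟩).symm) ?_
          funext k
          simp
        · refine congrArg Subtype.val
            (a₂ := (⟨q.1.1.2, q.1.2 ▸ q.2.2⟩ : {a : V' // π' a ∈ U'})) ?_
          rw [Homeomorph.symm_apply_eq]
          refine Prod.ext (Subtype.ext (q.1.2.trans
            (σ.fst_eq ⟨q.1.1.2, q.1.2 ▸ q.2.2⟩).symm)) ?_
          funext k
          simp
      right_inv := by
        intro r
        refine Prod.ext (Subtype.ext ?_) ?_
        · change π (τ.homeo.symm (⟨r.1.1, r.1.2.1⟩, fun k => r.2 (Fin.castAdd m k))).1 = r.1.1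
          rw [← τ.fst_eq]; simp
        · simp only [Subtype.coe_eta, Homeomorph.apply_symm_apply]
          exact Fin.append_castAdd_natAdd
      continuous_toFun := by
        have h1 : Continuous fun q : {q : {q : V × V' // π q.1 = π' q.2} // π q.1.1 ∈ U ∩ U'} =>
            τ.homeo ⟨q.1.1.1, q.2.1⟩ := by fun_prop
        have h2 : Continuous fun q : {q : {q : V × V' // π q.1 = π' q.2} // π q.1.1 ∈ U ∩ U'} =>
            σ.homeo ⟨q.1.1.2, q.1.2 ▸ q.2.2⟩ := by fun_prop
        refine Continuous.prodMk (Continuous.subtype_mk ?_ _) (continuous_pi fun k => ?_)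
        · have : (fun q : {q : {q : V × V' // π q.1 = π' q.2} // π q.1.1 ∈ U ∩ U'} =>
              π q.1.1.1) = fun q => ((τ.homeo ⟨q.1.1.1, q.2.1⟩).1 : T) := by
            funext q; exact (τ.fst_eq ⟨q.1.1.1, q.2.1⟩).symm
          rw [this]
          exact continuous_subtype_val.comp h1.fst
        · refine Fin.addCases (fun k => ?_) (fun k => ?_) k
          · simp only [Fin.append_left]
            exact (continuous_apply k).comp h1.snd
          · simp only [Fin.append_right]
            exact (continuous_apply k).comp h2.snd
      continuous_invFun := by
        refine Continuous.subtype_mk (Continuous.subtype_mk ?_ _) _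
        fun_prop }
  fst_eq _ := rfl
  map_add a b h ha hb hs := by
    have h1 := τ.map_add a.1.1 b.1.1 h ha.1 hb.1 hs.1
    have h2 := σ.map_add a.1.2 b.1.2 (by rw [← a.2, ← b.2]; exact h) (a.2 ▸ ha.2) (b.2 ▸ hb.2)
      (by rw [hv', ← a.2]; exact ha.2)
    funext k
    refine Fin.addCases (fun k => ?_) (fun k => ?_) k
    · simpa using congrFun h1 k
    · simpa using congrFun h2 k
  map_smul c a ha hs := by
    have h1 := τ.map_smul c a.1.1 ha.1 hs.1
    have h2 := σ.map_smul c a.1.2 (a.2 ▸ ha.2) (by rw [hs', ← a.2]; exact ha.2)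
    funext k
    refine Fin.addCases (fun k => ?_) (fun k => ?_) k
    · simpa using congrFun h1 k
    · simpa using congrFun h2 k

/-- The total space of the direct sum: the fiber product over `X`. -/
def sumTotal (E F : VectorBundle X) : X.obj ⥤ TopCat.{u} where
  obj x := TopCat.of {q : E.total.obj x × F.total.obj x // E.proj.app x q.1 = F.proj.app x q.2}
  map {x y} f := TopCat.ofHom
    ⟨fun q => ⟨(E.total.map f q.1.1, F.total.map f q.1.2), by
      have h1 := ConcreteCategory.congr_hom (E.proj.naturality f) q.1.1
      have h2 := ConcreteCategory.congr_hom (F.proj.naturality f) q.1.2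
      simp only [ConcreteCategory.comp_apply] at h1 h2
      rw [h1, h2, q.2]⟩, by fun_prop⟩
  map_id x := by
    apply ConcreteCategory.hom_ext
    intro q
    refine Subtype.ext (Prod.ext ?_ ?_)
    · exact ConcreteCategory.congr_hom (E.total.map_id x) q.1.1
    · exact ConcreteCategory.congr_hom (F.total.map_id x) q.1.2
  map_comp f g := by
    apply ConcreteCategory.hom_ext
    intro q
    refine Subtype.ext (Prod.ext ?_ ?_)
    · exact ConcreteCategory.congr_hom (E.total.map_comp f g) q.1.1
    · exact ConcreteCategory.congr_hom (F.total.map_comp f g) q.1.2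

/-- The projection of the direct sum. -/
def sumProj (E F : VectorBundle X) : sumTotal E F ⟶ X.p where
  app x := TopCat.ofHom ⟨fun q => E.proj.app x q.1.1, by fun_prop⟩
  naturality x y f := by
    apply ConcreteCategory.hom_ext
    intro q
    exact ConcreteCategory.congr_hom (E.proj.naturality f) q.1.1

/-- The first projection of the direct sum. -/
def sumFst (E F : VectorBundle X) : sumTotal E F ⟶ E.total where
  app x := TopCat.ofHom ⟨fun q => q.1.1, by fun_prop⟩

/-- The second projection of the direct sum. -/
def sumSnd (E F : VectorBundle X) : sumTotal E F ⟶ F.total where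
  app x := TopCat.ofHom ⟨fun q => q.1.2, by fun_prop⟩

lemma sumFst_proj (E F : VectorBundle X) : sumFst E F ≫ E.proj = sumProj E F := rfl

lemma sumSnd_proj (E F : VectorBundle X) : sumSnd E F ≫ F.proj = sumProj E F := by
  ext x q
  exact q.2.symm

lemma sumFst_proj_app (E F : VectorBundle X) (x : X.obj) :
    (sumFst E F).app x ≫ E.proj.app x = (sumProj E F).app x := rfl

lemma sumSnd_proj_app (E F : VectorBundle X) (x : X.obj) :
    (sumSnd E F).app x ≫ F.proj.app x = (sumProj E F).app x :=
  congrArg (fun t => NatTrans.app t x) (sumSnd_proj E F)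

lemma sumProj_equifibered (E F : VectorBundle X) : NatTrans.Equifibered (sumProj E F) := by
  intro x y f
  have hE := E.cartesian f
  have hF := F.cartesian f
  have cE : ∀ s : Limits.PullbackCone ((sumProj E F).app y) (X.p.map f),
      (s.fst ≫ (sumFst E F).app y) ≫ E.proj.app y = s.snd ≫ X.p.map f := fun s => by
    rw [Category.assoc, sumFst_proj_app, s.condition]
  have cF : ∀ s : Limits.PullbackCone ((sumProj E F).app y) (X.p.map f),
      (s.fst ≫ (sumSnd E F).app y) ≫ F.proj.app y = s.snd ≫ X.p.map f := fun s => by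
    rw [Category.assoc, sumSnd_proj_app, s.condition]
  refine ⟨⟨(sumProj E F).naturality f⟩, ⟨Limits.PullbackCone.IsLimit.mk _
    (fun s => TopCat.ofHom ⟨fun z => ⟨(hE.lift _ s.snd (cE s) z, hF.lift _ s.snd (cF s) z), ?_⟩, ?_⟩)
    ?_ ?_ ?_⟩⟩
  · exact (ConcreteCategory.congr_hom (hE.lift_snd _ s.snd (cE s)) z).trans
      (ConcreteCategory.congr_hom (hF.lift_snd _ s.snd (cF s)) z).symm
  · fun_prop
  · intro s
    apply ConcreteCategory.hom_ext
    intro z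
    refine Subtype.ext (Prod.ext ?_ ?_)
    · exact ConcreteCategory.congr_hom (hE.lift_fst _ s.snd (cE s)) z
    · exact ConcreteCategory.congr_hom (hF.lift_fst _ s.snd (cF s)) z
  · intro s
    apply ConcreteCategory.hom_ext
    intro z
    exact ConcreteCategory.congr_hom (hE.lift_snd _ s.snd (cE s)) z
  · intro s m hm₁ hm₂
    apply ConcreteCategory.hom_ext
    intro z
    refine Subtype.ext (Prod.ext ?_ ?_)
    · have : m ≫ (sumFst E F).app x = hE.lift _ s.snd (cE s) := by
        apply hE.hom_ext
        · rw [hE.lift_fst, ← hm₁, Category.assoc, Category.assoc, (sumFst E F).naturality]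
        · rw [hE.lift_snd, ← hm₂, Category.assoc, sumFst_proj_app]
      exact ConcreteCategory.congr_hom this z
    · have : m ≫ (sumSnd E F).app x = hF.lift _ s.snd (cF s) := by
        apply hF.hom_ext
        · rw [hF.lift_fst, ← hm₁, Category.assoc, Category.assoc, (sumSnd E F).naturality]
        · rw [hF.lift_snd, ← hm₂, Category.assoc, sumSnd_proj_app]
      exact ConcreteCategory.congr_hom this z

/-- The direct sum of two vector bundles. -/
def sum (E F : VectorBundle X) : VectorBundle X where
  total := sumTotal E F
  proj := sumProj E F
  cartesian := sumProj_equifibered E F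
  vadd x a b h := ⟨(E.vadd x a.1.1 b.1.1 h, F.vadd x a.1.2 b.1.2 (a.2.symm.trans (h.trans b.2))),
    (E.proj_vadd x _ _ _).trans (a.2.trans (F.proj_vadd x _ _ _).symm)⟩
  smul x c a := ⟨(E.smul x c a.1.1, F.smul x c a.1.2),
    (E.proj_smul x _ _).trans (a.2.trans (F.proj_smul x _ _).symm)⟩
  proj_vadd x a b h := E.proj_vadd x a.1.1 b.1.1 h
  proj_smul x c a := E.proj_smul x c a.1.1
  map_vadd f _ _ _ _ := Subtype.ext (Prod.ext (E.map_vadd f _ _ _ _) (F.map_vadd f _ _ _ _))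
  map_smul f _ _ := Subtype.ext (Prod.ext (E.map_smul f _ _) (F.map_smul f _ _))
  exists_trivialization := by
    obtain ⟨N, hN⟩ := E.exists_trivialization
    obtain ⟨M, hM⟩ := F.exists_trivialization
    refine ⟨N + M, fun x t => ?_⟩
    obtain ⟨n, hn, U, hU, ht, ⟨τ⟩⟩ := hN x t
    obtain ⟨m, hm, U', hU', ht', ⟨σ⟩⟩ := hM x t
    exact ⟨n + m, by omega, U ∩ U', hU.inter hU', ⟨ht, ht'⟩,
      ⟨Trivialization.sum τ σ (E.proj_vadd x) (E.proj_smul x) (F.proj_vadd x) (F.proj_smul x)⟩⟩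

/-- The direct sum of isomorphisms of vector bundles. -/
def Iso.sum {E E' F F' : VectorBundle X} (α : Iso E E') (β : Iso F F') :
    Iso (E.sum F) (E'.sum F') where
  homeo x :=
    { toFun := fun q => ⟨(α.homeo x q.1.1, β.homeo x q.1.2), by
        rw [α.proj_eq, β.proj_eq, q.2]⟩
      invFun := fun q => ⟨(α.symm.homeo x q.1.1, β.symm.homeo x q.1.2), by
        rw [α.symm.proj_eq, β.symm.proj_eq, q.2]⟩
      left_inv := fun q => Subtype.ext (Prod.ext ((α.homeo x).symm_apply_apply _)
        ((β.homeo x).symm_apply_apply _))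
      right_inv := fun q => Subtype.ext (Prod.ext ((α.homeo x).apply_symm_apply _)
        ((β.homeo x).apply_symm_apply _))
      continuous_toFun := by fun_prop
      continuous_invFun := by fun_prop }
  naturality f q := Subtype.ext (Prod.ext (α.naturality f _) (β.naturality f _))
  proj_eq x q := α.proj_eq x _
  map_vadd x a b h h' := Subtype.ext (Prod.ext (α.map_vadd x _ _ _ _) (β.map_vadd x _ _ _ _))
  map_smul x c a := Subtype.ext (Prod.ext (α.map_smul x _ _) (β.map_smul x _ _))

/-- Pullback commutes with direct sums. -/
def Iso.pullbackSum (E E' : VectorBundle X) (F : Y ⥤ᵇ X) :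
    Iso ((E.sum E').pullback F) ((E.pullback F).sum (E'.pullback F)) where
  homeo y :=
    { toFun := fun q => ⟨(q.1.1, q.1.2),
        congrArg ((eqToHom F.w : F.toFunctor ⋙ X.p ⟶ Y.p).app y) q.2⟩
      invFun := fun q => ⟨(q.1.1, q.1.2), app_eqToHom_injective F y q.2⟩
      left_inv := fun _ => rfl
      right_inv := fun _ => rfl
      continuous_toFun := Continuous.subtype_mk (by fun_prop) _
      continuous_invFun := Continuous.subtype_mk (by fun_prop) _ }
  naturality _ _ := rfl
  proj_eq _ _ := rfl
  map_vadd _ _ _ _ _ := rfl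
  map_smul _ _ _ := rfl

/-- Commutativity of the direct sum. -/
def Iso.sumComm (E F : VectorBundle X) : Iso (E.sum F) (F.sum E) where
  homeo x :=
    { toFun := fun q => ⟨(q.1.2, q.1.1), q.2.symm⟩
      invFun := fun q => ⟨(q.1.2, q.1.1), q.2.symm⟩
      left_inv := fun _ => rfl
      right_inv := fun _ => rfl
      continuous_toFun := by fun_prop
      continuous_invFun := by fun_prop }
  naturality _ _ := rfl
  proj_eq _ q := q.2.symm
  map_vadd _ _ _ _ _ := rfl
  map_smul _ _ _ := rfl

/-- Associativity of the direct sum. -/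
def Iso.sumAssoc (E F G : VectorBundle X) : Iso ((E.sum F).sum G) (E.sum (F.sum G)) where
  homeo x :=
    { toFun := fun q => ⟨(q.1.1.1.1, ⟨(q.1.1.1.2, q.1.2), q.1.1.2.symm.trans q.2⟩), q.1.1.2⟩
      invFun := fun q => ⟨(⟨(q.1.1, q.1.2.1.1), q.2⟩, q.1.2.1.2), q.2.trans q.1.2.2⟩
      left_inv := fun _ => rfl
      right_inv := fun _ => rfl
      continuous_toFun := by fun_prop
      continuous_invFun := by fun_prop }
  naturality _ _ := rfl
  proj_eq _ _ := rfl
  map_vadd _ _ _ _ _ := rfl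
  map_smul _ _ _ := rfl

/-- The zero vector bundle. -/
def zero (X : BasedCategory.{v, w} TopCat.{u}) : VectorBundle X where
  total := X.p
  proj := 𝟙 X.p
  cartesian := NatTrans.Equifibered.of_isIso _
  vadd _ a _ _ := a
  smul _ _ a := a
  proj_vadd _ _ _ _ := rfl
  proj_smul _ _ _ := rfl
  map_vadd _ _ _ _ _ := rfl
  map_smul _ _ _ := rfl
  exists_trivialization := ⟨0, fun _ _ => ⟨0, le_rfl, Set.univ, isOpen_univ, trivial, ⟨
    { homeo := (Homeomorph.prodUnique _ _).symm
      fst_eq := fun _ => rfl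
      map_add := fun _ _ _ _ _ _ => Subsingleton.elim _ _
      map_smul := fun _ _ _ _ => Subsingleton.elim _ _ }⟩⟩⟩

/-- The pullback of the zero bundle is zero. -/
def Iso.pullbackZero (F : Y ⥤ᵇ X) : Iso ((zero X).pullback F) (zero Y) where
  homeo y := TopCat.homeoOfIso ((eqToIso F.w).app y)
  naturality f a := ConcreteCategory.congr_hom
    ((eqToHom F.w : F.toFunctor ⋙ X.p ⟶ Y.p).naturality f) a
  proj_eq _ _ := rfl
  map_vadd _ _ _ _ _ := rfl
  map_smul _ _ _ := rfl

/-- The zero bundle is neutral for the direct sum. -/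
def Iso.sumZero (E : VectorBundle X) : Iso (E.sum (zero X)) E where
  homeo x :=
    { toFun := fun q => q.1.1
      invFun := fun a => ⟨(a, E.proj.app x a), rfl⟩
      left_inv := fun q => Subtype.ext (Prod.ext rfl q.2)
      right_inv := fun _ => rfl
      continuous_toFun := by fun_prop
      continuous_invFun := by fun_prop }
  naturality _ _ := rfl
  proj_eq _ _ := rfl
  map_vadd _ _ _ _ _ := rfl
  map_smul _ _ _ := rfl

end VectorBundle

/-! ## Relative K-theory -/

/-- A triple `(E₀, E₁, i)` for a map of stacks `f : Y → X`: vector bundles `E₀`, `E₁` on `X` and an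
isomorphism `i : f^* E₀ → f^* E₁`. -/
structure Triple {X : BasedCategory.{v, w} TopCat.{u}} {Y : BasedCategory.{v', w'} TopCat.{u}}
    (f : Y ⥤ᵇ X) where
  E₀ : VectorBundle X
  E₁ : VectorBundle X
  i : VectorBundle.Iso (E₀.pullback f) (E₁.pullback f)

namespace Triple

variable {X : BasedCategory.{v, w} TopCat.{u}} {Y : BasedCategory.{v', w'} TopCat.{u}}
  {f : Y ⥤ᵇ X}

/-- Triples are isomorphic: there are isomorphisms `E₀ ≅ E₀'` and `E₁ ≅ E₁'` whose pullbacks to `Y`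
intertwine `i` and `i'`. -/
def IsIso (S T : Triple f) : Prop :=
  ∃ (α₀ : VectorBundle.Iso S.E₀ T.E₀) (α₁ : VectorBundle.Iso S.E₁ T.E₁),
    ∀ (y : Y.obj) (a : (S.E₀.pullback f).total.obj y),
      (α₁.pullback f).homeo y (S.i.homeo y a) = T.i.homeo y ((α₀.pullback f).homeo y a)

lemma IsIso.refl (S : Triple f) : IsIso S S :=
  ⟨.refl _, .refl _, fun _ _ => rfl⟩

lemma IsIso.symm {S T : Triple f} : IsIso S T → IsIso T S := by
  rintro ⟨α₀, α₁, h⟩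
  refine ⟨α₀.symm, α₁.symm, fun y a => ?_⟩
  apply ((α₁.pullback f).homeo y).injective
  refine ((α₁.homeo (f.obj y)).apply_symm_apply _).trans ?_
  rw [h]
  exact congrArg (T.i.homeo y) ((α₀.homeo (f.obj y)).apply_symm_apply _).symm

lemma IsIso.trans {S T R : Triple f} : IsIso S T → IsIso T R → IsIso S R := by
  rintro ⟨α₀, α₁, h⟩ ⟨β₀, β₁, h'⟩
  refine ⟨α₀.trans β₀, α₁.trans β₁, fun y a => ?_⟩
  exact (congrArg ((β₁.pullback f).homeo y) (h y a)).trans (h' y _)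

/-- The direct sum of triples. -/
def sum (S T : Triple f) : Triple f where
  E₀ := S.E₀.sum T.E₀
  E₁ := S.E₁.sum T.E₁
  i := ((VectorBundle.Iso.pullbackSum _ _ f).trans (S.i.sum T.i)).trans
    (VectorBundle.Iso.pullbackSum _ _ f).symm

/-- The triple `(E, E, id)`. -/
def ofBundle (f : Y ⥤ᵇ X) (E : VectorBundle X) : Triple f := ⟨E, E, .refl _⟩

lemma IsIso.sum {S S' T T' : Triple f} :
    IsIso S S' → IsIso T T' → IsIso (S.sum T) (S'.sum T') := by
  rintro ⟨α₀, α₁, h⟩ ⟨β₀, β₁, h'⟩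
  exact ⟨α₀.sum β₀, α₁.sum β₁, fun y a => Subtype.ext (Prod.ext (h y _) (h' y _))⟩

/-- Isomorphism of triples as an equivalence relation. -/
instance setoid (f : Y ⥤ᵇ X) : Setoid (Triple f) :=
  ⟨IsIso, IsIso.refl, IsIso.symm, IsIso.trans⟩

end Triple

/-- The set of isomorphism classes of triples. -/
def TripleClass {X : BasedCategory.{v, w} TopCat.{u}} {Y : BasedCategory.{v', w'} TopCat.{u}}
    (f : Y ⥤ᵇ X) : Type _ :=
  Quotient (Triple.setoid f)

instance {X : BasedCategory.{v, w} TopCat.{u}} {Y : BasedCategory.{v', w'} TopCat.{u}}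
    (f : Y ⥤ᵇ X) : Zero (TripleClass f) :=
  ⟨Quotient.mk _ (Triple.ofBundle f (VectorBundle.zero X))⟩

instance {X : BasedCategory.{v, w} TopCat.{u}} {Y : BasedCategory.{v', w'} TopCat.{u}}
    (f : Y ⥤ᵇ X) : Add (TripleClass f) :=
  ⟨Quotient.map₂ Triple.sum fun _ _ h _ _ h' => h.sum h'⟩

/-- Isomorphism classes of triples form an abelian monoid under direct sum. -/
instance {X : BasedCategory.{v, w} TopCat.{u}} {Y : BasedCategory.{v', w'} TopCat.{u}}
    (f : Y ⥤ᵇ X) : AddCommMonoid (TripleClass f) where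
  add_assoc := by
    rintro ⟨S⟩ ⟨T⟩ ⟨R⟩
    exact Quotient.sound ⟨.sumAssoc _ _ _, .sumAssoc _ _ _, fun _ _ => rfl⟩
  add_comm := by
    rintro ⟨S⟩ ⟨T⟩
    exact Quotient.sound ⟨.sumComm _ _, .sumComm _ _, fun _ _ => rfl⟩
  add_zero := by
    rintro ⟨S⟩
    exact Quotient.sound ⟨.sumZero _, .sumZero _, fun _ _ => rfl⟩
  zero_add := by
    rintro ⟨S⟩
    exact Quotient.sound ⟨(VectorBundle.Iso.sumComm _ _).trans (.sumZero _),
      (VectorBundle.Iso.sumComm _ _).trans (.sumZero _), fun _ _ => rfl⟩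
  nsmul := nsmulRec

/-- The submonoid of classes of triples of the form `(E, E, id)`. -/
def trivialTriples {X : BasedCategory.{v, w} TopCat.{u}} {Y : BasedCategory.{v', w'} TopCat.{u}}
    (f : Y ⥤ᵇ X) : AddSubmonoid (TripleClass f) where
  carrier := Set.range fun E : VectorBundle X => Quotient.mk _ (Triple.ofBundle f E)
  zero_mem' := ⟨VectorBundle.zero X, rfl⟩
  add_mem' := by
    rintro _ _ ⟨E, rfl⟩ ⟨F, rfl⟩
    exact ⟨E.sum F, Quotient.sound ⟨.refl _, .refl _, fun _ _ => rfl⟩⟩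

/-- For a submonoid `S` of an abelian monoid `M`, the congruence `x ∼ y` iff `x + a = y + b` for
some `a`, `b` in `S`.  Its quotient is the quotient monoid `M / S`. -/
def quotientCon {M : Type*} [AddCommMonoid M] (S : AddSubmonoid M) : AddCon M where
  r x y := ∃ a ∈ S, ∃ b ∈ S, x + a = y + b
  iseqv :=
    { refl := fun _ => ⟨0, S.zero_mem, 0, S.zero_mem, rfl⟩
      symm := fun ⟨a, ha, b, hb, h⟩ => ⟨b, hb, a, ha, h.symm⟩
      trans := by
        rintro x y z ⟨a, ha, b, hb, h⟩ ⟨c, hc, d, hd, h'⟩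
        refine ⟨a + c, S.add_mem ha hc, b + d, S.add_mem hb hd, ?_⟩
        rw [← add_assoc, h, add_right_comm, h', add_right_comm, add_assoc] }
  add' := by
    rintro x y z t ⟨a, ha, b, hb, h⟩ ⟨c, hc, d, hd, h'⟩
    refine ⟨a + c, S.add_mem ha hc, b + d, S.add_mem hb hd, ?_⟩
    rw [add_add_add_comm, h, h', add_add_add_comm]

/-- Relative K-theory of a map of stacks `f : Y → X`: the quotient of the monoid of isomorphism
classes of triples `(E₀, E₁, i)` by the submonoid of triples `(E, E, id)`. -/
abbrev RelK {X : BasedCategory.{v, w} TopCat.{u}} {Y : BasedCategory.{v', w'} TopCat.{u}}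
    (f : Y ⥤ᵇ X) : Type _ :=
  (quotientCon (trivialTriples f)).Quotient

/-- The relative K-theory `K⁰(X, A)` of a pair. -/
abbrev ClosedSubstack.K {X : BasedCategory.{v, w} TopCat.{u}} (A : ClosedSubstack X) : Type _ :=
  RelK A.incl

namespace PairMap

variable {X : BasedCategory.{v, w} TopCat.{u}} {X' : BasedCategory.{v', w'} TopCat.{u}}
  {A : ClosedSubstack X} {A' : ClosedSubstack X'}

/-- Pullback of triples along a map of pairs. -/
def pullbackTriple (f : PairMap A A') (T : Triple A'.incl) : Triple A.incl where
  E₀ := T.E₀.pullback f.total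
  E₁ := T.E₁.pullback f.total
  i :=
    { homeo := fun a => T.i.homeo (f.sub.obj a)
      naturality := fun φ v => T.i.naturality (f.sub.map φ) v
      proj_eq := fun a v => congrArg ((eqToHom f.total.w :
        f.total.toFunctor ⋙ X'.p ⟶ X.p).app a.obj) (T.i.proj_eq (f.sub.obj a) v)
      map_vadd := fun a v v' h h' => T.i.map_vadd (f.sub.obj a) v v'
        (VectorBundle.app_eqToHom_injective f.total a.obj h)
        (VectorBundle.app_eqToHom_injective f.total a.obj h')
      map_smul := fun a c v => T.i.map_smul (f.sub.obj a) c v }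

/-- Pullback of isomorphism classes of triples along a map of pairs. -/
def pullbackClass (f : PairMap A A') : TripleClass A'.incl →+ TripleClass A.incl where
  toFun := Quotient.map f.pullbackTriple fun _ _ ⟨α₀, α₁, h⟩ =>
    ⟨α₀.pullback f.total, α₁.pullback f.total, fun a v => h (f.sub.obj a) v⟩
  map_zero' := Quotient.sound ⟨.pullbackZero _, .pullbackZero _, fun _ _ => rfl⟩
  map_add' := by
    rintro ⟨S⟩ ⟨T⟩
    exact Quotient.sound ⟨.pullbackSum _ _ _, .pullbackSum _ _ _, fun _ _ => rfl⟩

/-- The map `K⁰(X', A') → K⁰(X, A)` induced by a map of pairs `(X, A) → (X', A')`. -/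
def mapK (f : PairMap A A') : A'.K →+ A.K :=
  (quotientCon (trivialTriples A'.incl)).lift
    ((quotientCon (trivialTriples A.incl)).mk'.comp f.pullbackClass) (by
      rintro x y ⟨_, ⟨E, rfl⟩, _, ⟨F, rfl⟩, h⟩
      refine (AddCon.eq _).2 ⟨_, ⟨E.pullback f.total, rfl⟩, _, ⟨F.pullback f.total, rfl⟩, ?_⟩
      have := congrArg f.pullbackClass h
      exact (f.pullbackClass.map_add _ _).symm.trans (this.trans (f.pullbackClass.map_add _ _)))

end PairMap

end Orbispace

/-!
A triple `(E, F, i)` on a pair `(X, A)` consists of two bundles on `X` and an isomorphism of their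
restrictions to `A`. Up to isomorphism of triples only the isotopy class of `i` matters, so that the
monoid of triples is determined by the groupoids of vector bundles and isotopy classes of
isomorphisms (`IsotopyCat`) on `X` and on `A`, and by the restriction functor between them. A
homotopy equivalence induces an equivalence of these groupoids, and therefore a map of pairs which
is a homotopy equivalence on `X` and on `A` induces a bijection on isomorphism classes of triples
(`PairMap.pullbackClass_injective`, `PairMap.pullbackClass_surjective`). This bijection matches the
submonoids of trivial triples, since every bundle is a pullback up to isomorphism. Hence it induces
an isomorphism on `K⁰`.

Two facts about vector bundles carry the argument.

* A bundle on `X × [0,1]` is pulled back from its restriction to `X × {0}`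
  (`VectorBundle.exists_iso_atZero`). Applied to the pullback of a bundle along a homotopy, this
  shows that homotopic maps induce isomorphic functors (`IsotopyCat.nonempty_pull_iso`), because an
  isomorphism of bundles on `X × [0,1]` is then an isotopy between its two ends.
* An automorphism of `E|_A` which is isotopic to the identity extends to an automorphism of `E`
  (`VectorBundle.exists_extension_of_homotopy`). Applied to `i⁻¹ ∘ i'`, this shows that isotopic
  identifications `i`, `i'` define isomorphic triples (`Triple.isIso_of_isotopic`).

Both are consequences of the Tietze extension theorem for homomorphisms of vector bundles
(`VectorBundle.Hom.exists_extension`). To prove it, paracompact orbispaces are replaced by étale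
groupoids with a separated and proper space of arrows and a paracompact Hausdorff quotient
(`Presentation`). Locally, the atlas contains slices, to which every nearby point of the stack has
the same finite number of arrows (`Presentation.exists_isSlice`). A slice is proper over the
quotient, hence normal, and the classical Tietze theorem applies to matrices of functions on it. The
resulting extension is made invariant by averaging over the arrows, and the local extensions are
glued by a partition of unity on the quotient. Such presentations exist on paracompact orbispaces,
on their products with compact Hausdorff spaces and on their closed substacks
(`IsPresentable`); descent is not needed.

Throughout, a bundle is handled through its fibers `VectorBundle.Fib`, and a homomorphism through
the families of linear maps `VectorBundle.FibHom`, which are compatible with pullback and may be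
checked on points.
-/

namespace Orbispace

open Topology Set Filter

/-! ### Topological preliminaries -/

/-- A space with a proper map to a paracompact space is paracompact. -/
lemma paracompactSpace_of_isProperMap {Z B : Type u} [TopologicalSpace Z] [TopologicalSpace B]
    [ParacompactSpace B] {f : Z → B} (hf : IsProperMap f) : ParacompactSpace Z where
  locallyFinite_refinement α s ho hu := by
    have hfin : ∀ b : B, ∃ F : Finset α, f ⁻¹' {b} ⊆ ⋃ a ∈ F, s a := fun b =>
      (hf.isCompact_preimage isCompact_singleton).elim_finite_subcover s ho (by simp [hu])
    choose F hF using hfin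
    have hO : ∀ b : B, ∃ O : Set B, IsOpen O ∧ b ∈ O ∧ f ⁻¹' O ⊆ ⋃ a ∈ F b, s a := fun b => by
      refine ⟨(f '' (⋃ a ∈ F b, s a)ᶜ)ᶜ, ?_, ?_, ?_⟩
      · exact (hf.isClosedMap _ (isOpen_biUnion fun a _ => ho a).isClosed_compl).isOpen_compl
      · rintro ⟨z, hz, hzb⟩
        exact hz (hF b hzb)
      · intro z hz
        by_contra h
        exact hz ⟨z, h, rfl⟩
    choose O hOo hbO hO using hO
    obtain ⟨v, hvo, hvc, hvf, hvO⟩ := precise_refinement O hOo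
      (iUnion_eq_univ_iff.2 fun b => ⟨b, hbO b⟩)
    refine ⟨Σ b, F b, fun q => f ⁻¹' v q.1 ∩ s q.2, fun q => ((hvo _).preimage hf.continuous).inter
      (ho _), ?_, ?_, fun q => ⟨q.2, inter_subset_right⟩⟩
    · refine iUnion_eq_univ_iff.2 fun z => ?_
      obtain ⟨b, hb⟩ := iUnion_eq_univ_iff.1 hvc (f z)
      obtain ⟨a, ha, hz⟩ := mem_iUnion₂.1 (hO b (hvO b hb))
      exact ⟨⟨b, a, ha⟩, hb, hz⟩
    · intro z
      obtain ⟨N, hN, hNf⟩ := hvf (f z)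
      refine ⟨f ⁻¹' N, hf.continuous.continuousAt hN, ?_⟩
      refine (hNf.preimage' (f := Sigma.fst) fun b _ => ?_).subset
        fun q ⟨z', h, h'⟩ => ⟨f z', h.1, h'⟩
      refine (finite_range fun a : F b => (⟨b, a⟩ : Σ b, F b)).subset ?_
      rintro ⟨b', a⟩ rfl
      exact ⟨a, rfl⟩

/-! ### Fibered categories over topological spaces -/

/-- The part of the stack axioms that does not concern gluing: pullbacks exist, and every morphism
is cartesian. -/
structure IsFibered (X : BasedCategory.{v, w} TopCat.{u}) : Prop where
  lift : ∀ (y : X.obj) {S : TopCat.{u}} (f : S ⟶ X.p.obj y),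
    ∃ (z : X.obj) (φ : z ⟶ y) (e : S ≅ X.p.obj z), e.hom ≫ X.p.map φ = f
  cart : ∀ {x y z : X.obj} (φ : x ⟶ y) (ψ : z ⟶ y) (g : X.p.obj z ⟶ X.p.obj x),
    g ≫ X.p.map φ = X.p.map ψ → ∃! χ : z ⟶ x, X.p.map χ = g ∧ χ ≫ φ = ψ

section Fibered

variable {X : BasedCategory.{v, w} TopCat.{u}}

lemma p_comp {x y z : X.obj} (f : x ⟶ y) (g : y ⟶ z) (t : X.p.obj x) :
    X.p.map (f ≫ g) t = X.p.map g (X.p.map f t) := by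
  simp

lemma p_id (x : X.obj) (t : X.p.obj x) : X.p.map (𝟙 x) t = t := by
  simp

lemma p_continuous {x y : X.obj} (f : x ⟶ y) : Continuous (X.p.map f) :=
  (X.p.map f).hom.continuous

lemma IsStack.isFibered (h : IsStack X) : IsFibered X where
  lift y S f := by
    obtain ⟨z, φ, hφ⟩ := h.exists_lift y f
    exact ⟨z, φ, eqToIso (IsHomLift.domain_eq X.p f φ).symm, by
      have := IsHomLift.fac' X.p f φ
      simp [this]⟩
  cart φ ψ g hg := by
    have := h.isStronglyCartesian φ
    obtain ⟨χ, ⟨h1, h2⟩, h3⟩ := Functor.IsStronglyCartesian.universal_property X.p (X.p.map φ) φ g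
      (X.p.map ψ) hg.symm ψ
    refine ⟨χ, ⟨(IsHomLift.eq_of_isHomLift X.p g χ).symm, h2⟩, ?_⟩
    rintro χ' ⟨rfl, h5⟩
    exact h3 χ' ⟨inferInstance, h5⟩

lemma ClosedSubstack.mem_of_hom (A : ClosedSubstack X) {z y : X.obj} (f : z ⟶ y) (hy : A.mem y) :
    A.mem z := by
  obtain ⟨C, -, hC⟩ := A.exists_isClosed y
  refine (hC z f).2 fun t => ?_
  simpa only [p_id] using (hC y (𝟙 _)).1 hy (X.p.map f t)

namespace IsFibered

variable (hX : IsFibered X)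
include hX

lemma hom_ext {x y z : X.obj} (φ : x ⟶ y) {χ χ' : z ⟶ x} (h : X.p.map χ = X.p.map χ')
    (h' : χ ≫ φ = χ' ≫ φ) : χ = χ' :=
  (hX.cart φ (χ' ≫ φ) (X.p.map χ') (by simp)).unique ⟨h, h'⟩ ⟨rfl, rfl⟩

/-- An object may be restricted to any subset of its base. -/
lemma exists_restrict (y : X.obj) (s : Set (X.p.obj y)) :
    ∃ (z : X.obj) (φ : z ⟶ y), IsEmbedding (X.p.map φ) ∧ range (X.p.map φ) = s := by
  obtain ⟨z, φ, e, he⟩ := hX.lift y (S := TopCat.of s) (TopCat.ofHom ⟨Subtype.val, by fun_prop⟩)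
  have h : X.p.map φ = e.inv ≫ TopCat.ofHom ⟨Subtype.val, by fun_prop⟩ := by simp [← he]
  have hc : (X.p.map φ : X.p.obj z → X.p.obj y) =
      Subtype.val ∘ (TopCat.homeoOfIso e).symm := by
    rw [h]; rfl
  refine ⟨z, φ, ?_, ?_⟩
  · rw [hc]
    exact IsEmbedding.subtypeVal.comp (TopCat.homeoOfIso e).symm.isEmbedding
  · rw [hc, range_comp, (TopCat.homeoOfIso e).symm.surjective.range_eq, image_univ,
      Subtype.range_val]

/-- Morphisms into `y` whose base map lands in the image of an embedding factor. -/
lemma exists_factor {x y z : X.obj} (φ : x ⟶ y) (hφ : IsEmbedding (X.p.map φ)) (ψ : z ⟶ y)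
    (h : ∀ t, X.p.map ψ t ∈ range (X.p.map φ)) : ∃ χ : z ⟶ x, χ ≫ φ = ψ := by
  choose g hg using h
  have hgc : Continuous g := by
    rw [hφ.continuous_iff]
    have : X.p.map φ ∘ g = X.p.map ψ := funext hg
    rw [this]
    exact p_continuous ψ
  obtain ⟨χ, ⟨-, h2⟩, -⟩ := hX.cart φ ψ (TopCat.ofHom ⟨g, hgc⟩) (by ext t; exact hg t)
  exact ⟨χ, h2⟩

/-- The restriction of an object to a point of its base. -/
lemma exists_point (y : X.obj) (t : X.p.obj y) :
    ∃ (z : X.obj) (φ : z ⟶ y) (s : X.p.obj z), Subsingleton (X.p.obj z) ∧ X.p.map φ s = t := by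
  obtain ⟨z, φ, hφ, hr⟩ := hX.exists_restrict y {t}
  obtain ⟨s, hs⟩ : t ∈ range (X.p.map φ) := by rw [hr]; rfl
  refine ⟨z, φ, s, ⟨fun a b => hφ.injective ?_⟩, hs⟩
  have ha : X.p.map φ a ∈ ({t} : Set _) := hr ▸ mem_range_self a
  have hb : X.p.map φ b ∈ ({t} : Set _) := hr ▸ mem_range_self b
  exact ha.trans hb.symm

/-- Over a point, a morphism to `y` factors through `φ : x ⟶ y` as soon as its image does. -/
lemma exists_factor_point {x y z : X.obj} [Subsingleton (X.p.obj z)] (φ : x ⟶ y) (ψ : z ⟶ y)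
    (s : X.p.obj z) (t : X.p.obj x) (h : X.p.map φ t = X.p.map ψ s) :
    ∃ χ : z ⟶ x, X.p.map χ s = t ∧ χ ≫ φ = ψ := by
  obtain ⟨χ, ⟨h1, h2⟩, -⟩ := hX.cart φ ψ (TopCat.ofHom (ContinuousMap.const _ t)) (by
    ext s'
    rw [Subsingleton.elim s' s]
    exact h)
  exact ⟨χ, by rw [h1]; rfl, h2⟩

lemma hom_ext_point {x y z : X.obj} [Subsingleton (X.p.obj z)] (φ : x ⟶ y) {χ χ' : z ⟶ x}
    (s : X.p.obj z) (h : X.p.map χ s = X.p.map χ' s) (h' : χ ≫ φ = χ' ≫ φ) : χ = χ' :=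
  hX.hom_ext φ (by ext s'; rw [Subsingleton.elim s' s]; exact h) h'

/-- Morphisms between objects over points are isomorphisms. -/
lemma exists_inverse_point {x z : X.obj} [Subsingleton (X.p.obj z)] [Subsingleton (X.p.obj x)]
    (φ : z ⟶ x) (s : X.p.obj z) : ∃ ψ : x ⟶ z, φ ≫ ψ = 𝟙 z ∧ ψ ≫ φ = 𝟙 x := by
  obtain ⟨ψ, h1, h2⟩ := hX.exists_factor_point φ (𝟙 x) (X.p.map φ s) s (p_id _ _).symm
  refine ⟨ψ, hX.hom_ext_point φ s (Subsingleton.elim _ _) ?_, h2⟩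
  rw [Category.assoc, h2, Category.comp_id, Category.id_comp]

lemma prodSpace (K : TopCat.{u}) : IsFibered (prodSpace X K) where
  lift y S f := by
    obtain ⟨z, φ, e, he⟩ := hX.lift y.left f
    exact ⟨CostructuredArrow.mk (Y := z) (X.p.map φ ≫ y.hom), CostructuredArrow.homMk φ rfl, e, he⟩
  cart {x y z} φ ψ g hg := by
    obtain ⟨χ, ⟨h1, h2⟩, h3⟩ := hX.cart φ.left ψ.left g hg
    refine ⟨CostructuredArrow.homMk χ ?_, ⟨h1, CostructuredArrow.hom_ext _ _ h2⟩, ?_⟩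
    · rw [← CostructuredArrow.w φ, ← CostructuredArrow.w ψ, ← h2]
      simp
    · rintro χ' ⟨h4, h5⟩
      exact CostructuredArrow.hom_ext _ _ (h3 χ'.left ⟨h4, congrArg CommaMorphism.left h5⟩)

lemma closedSubstack (A : ClosedSubstack X) : IsFibered A.toBased where
  lift y S f := by
    obtain ⟨z, φ, e, he⟩ := hX.lift y.obj f
    exact ⟨⟨z, A.mem_of_hom φ y.property⟩, ObjectProperty.homMk φ, e, he⟩
  cart {x y z} φ ψ g hg := by
    obtain ⟨χ, ⟨h1, h2⟩, h3⟩ := hX.cart φ.hom ψ.hom g hg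
    refine ⟨ObjectProperty.homMk χ, ⟨h1, ObjectProperty.hom_ext _ h2⟩, ?_⟩
    rintro χ' ⟨h4, h5⟩
    exact ObjectProperty.hom_ext _ (h3 χ'.hom ⟨h4, congrArg InducedCategory.Hom.hom h5⟩)

end IsFibered

end Fibered

/-! ### Fibers of vector bundles -/

namespace VectorBundle

variable {X : BasedCategory.{v, w} TopCat.{u}} (E F G : VectorBundle X)

/-- The fiber of a vector bundle over a point `t` of the base of the object `y`. -/
@[ext]
structure Fib (y : X.obj) (t : X.p.obj y) : Type u where
  val : E.total.obj y
  proj_val : E.proj.app y val = t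

/-- A point of the total space, as a point of a fiber. -/
def toFib {E : VectorBundle X} {y : X.obj} (a : E.total.obj y) : E.Fib y (E.proj.app y a) :=
  ⟨a, rfl⟩

/-- Trivializations of `E` over a subset of the base of `y`. -/
abbrev LocalTriv (y : X.obj) (U : Set (X.p.obj y)) (n : ℕ) :=
  Trivialization (E.proj.app y) (E.vadd y) (E.smul y) U n

variable {E F G}

/-- The coordinates of the points of a fiber given by a trivialization. -/
def LocalTriv.equiv {y : X.obj} {U : Set (X.p.obj y)} {n : ℕ} (τ : E.LocalTriv y U n)
    {t : X.p.obj y} (ht : t ∈ U) : E.Fib y t ≃ (Fin n → ℂ) where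
  toFun a := (τ.homeo ⟨a.1, a.2.symm ▸ ht⟩).2
  invFun c := ⟨(τ.homeo.symm (⟨t, ht⟩, c)).1, by rw [← τ.fst_eq]; simp⟩
  left_inv a := by
    apply Fib.ext
    change (τ.homeo.symm _).1 = a.1
    have : (⟨⟨t, ht⟩, (τ.homeo ⟨a.1, a.2.symm ▸ ht⟩).2⟩ : U × (Fin n → ℂ)) =
        τ.homeo ⟨a.1, a.2.symm ▸ ht⟩ :=
      Prod.ext (Subtype.ext (a.2.symm.trans (τ.fst_eq ⟨a.1, a.2.symm ▸ ht⟩).symm)) rfl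
    rw [this, Homeomorph.symm_apply_apply]
  right_inv c := by simp

namespace Fib

variable {y : X.obj} {t : X.p.obj y}

instance : Add (E.Fib y t) :=
  ⟨fun a b => ⟨E.vadd y a.1 b.1 (a.2.trans b.2.symm), (E.proj_vadd _ _ _ _).trans a.2⟩⟩

instance : SMul ℂ (E.Fib y t) :=
  ⟨fun c a => ⟨E.smul y c a.1, (E.proj_smul _ _ _).trans a.2⟩⟩

lemma _root_.Orbispace.VectorBundle.LocalTriv.equiv_add {U : Set (X.p.obj y)} {n : ℕ}
    (τ : E.LocalTriv y U n) (ht : t ∈ U) (a b : E.Fib y t) :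
    τ.equiv ht (a + b) = τ.equiv ht a + τ.equiv ht b :=
  τ.map_add _ _ _ _ _ _

lemma _root_.Orbispace.VectorBundle.LocalTriv.equiv_smul {U : Set (X.p.obj y)} {n : ℕ}
    (τ : E.LocalTriv y U n) (ht : t ∈ U) (c : ℂ) (a : E.Fib y t) :
    τ.equiv ht (c • a) = c • τ.equiv ht a :=
  τ.map_smul _ _ _ _

variable (E y t) in
lemma exists_equiv : ∃ (n : ℕ) (e : E.Fib y t ≃ (Fin n → ℂ)), (∀ a b, e (a + b) = e a + e b) ∧
    ∀ (c : ℂ) a, e (c • a) = c • e a := by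
  obtain ⟨N, hN⟩ := E.exists_trivialization
  obtain ⟨n, -, U, -, ht, ⟨τ⟩⟩ := hN y t
  exact ⟨n, LocalTriv.equiv τ ht, LocalTriv.equiv_add τ ht, LocalTriv.equiv_smul τ ht⟩

variable (E y t) in
/-- Some linear coordinates on a fiber. -/
def coords : E.Fib y t ≃ (Fin (exists_equiv E y t).choose → ℂ) :=
  (exists_equiv E y t).choose_spec.choose

lemma coords_add (a b : E.Fib y t) : coords E y t (a + b) = coords E y t a + coords E y t b :=
  (exists_equiv E y t).choose_spec.choose_spec.1 a b

lemma coords_smul (c : ℂ) (a : E.Fib y t) : coords E y t (c • a) = c • coords E y t a :=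
  (exists_equiv E y t).choose_spec.choose_spec.2 c a

instance : AddCommGroup (E.Fib y t) :=
  letI : Zero (E.Fib y t) := ⟨(coords E y t).symm 0⟩
  letI : Neg (E.Fib y t) := ⟨fun a => (-1 : ℂ) • a⟩
  letI : Sub (E.Fib y t) := ⟨fun a b => a + (-1 : ℂ) • b⟩
  letI : SMul ℕ (E.Fib y t) := ⟨fun n a => (n : ℂ) • a⟩
  letI : SMul ℤ (E.Fib y t) := ⟨fun n a => (n : ℂ) • a⟩
  (coords E y t).injective.addCommGroup _ ((coords E y t).apply_symm_apply 0) coords_add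
    (fun a => (coords_smul (-1) a).trans (by simp))
    (fun a b => (coords_add _ _).trans (by rw [coords_smul]; simp [sub_eq_add_neg]))
    (fun n a => (coords_smul _ _).trans (by ext i; simp))
    (fun n a => (coords_smul _ _).trans (by ext i; simp))

instance : Module ℂ (E.Fib y t) :=
  (coords E y t).injective.module ℂ ⟨⟨coords E y t, (coords E y t).apply_symm_apply 0⟩, coords_add⟩
    coords_smul

lemma val_add (a b : E.Fib y t) : (a + b).1 = E.vadd y a.1 b.1 (a.2.trans b.2.symm) := rfl

lemma val_smul (c : ℂ) (a : E.Fib y t) : (c • a).1 = E.smul y c a.1 := rfl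

end Fib

/-- The linear coordinates on a fiber given by a trivialization. -/
def LocalTriv.fib {y : X.obj} {U : Set (X.p.obj y)} {n : ℕ} (τ : E.LocalTriv y U n)
    {t : X.p.obj y} (ht : t ∈ U) : E.Fib y t ≃ₗ[ℂ] (Fin n → ℂ) :=
  { LocalTriv.equiv τ ht with
    map_add' := LocalTriv.equiv_add τ ht
    map_smul' := LocalTriv.equiv_smul τ ht }

lemma exists_localTriv (E : VectorBundle X) (y : X.obj) (t : X.p.obj y) :
    ∃ (n : ℕ) (U : Set (X.p.obj y)), IsOpen U ∧ t ∈ U ∧ Nonempty (E.LocalTriv y U n) := by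
  obtain ⟨N, hN⟩ := E.exists_trivialization
  obtain ⟨n, -, U, hU, ht, hτ⟩ := hN y t
  exact ⟨n, U, hU, ht, hτ⟩

/-! ### Transport along morphisms -/

lemma proj_map (E : VectorBundle X) {x y : X.obj} (f : x ⟶ y) (a : E.total.obj x) :
    E.proj.app y (E.total.map f a) = X.p.map f (E.proj.app x a) :=
  ConcreteCategory.congr_hom (E.proj.naturality f) a

lemma map_comp_apply (E : VectorBundle X) {x y z : X.obj} (f : x ⟶ y) (g : y ⟶ z)
    (a : E.total.obj x) : E.total.map (f ≫ g) a = E.total.map g (E.total.map f a) := by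
  simp

lemma map_id_apply (E : VectorBundle X) {x : X.obj} (a : E.total.obj x) :
    E.total.map (𝟙 x) a = a := by
  simp

lemma continuous_map (E : VectorBundle X) {x y : X.obj} (f : x ⟶ y) :
    Continuous (E.total.map f) :=
  (E.total.map f).hom.continuous

lemma continuous_proj (E : VectorBundle X) (x : X.obj) : Continuous (E.proj.app x) :=
  (E.proj.app x).hom.continuous

/-- The total space over `x` is the fiber product of that over `y` with the base of `x`. -/
lemma exists_homeo_pullback (E : VectorBundle X) {x y : X.obj} (f : x ⟶ y) :
    ∃ e : E.total.obj x ≃ₜ {q : E.total.obj y × X.p.obj x // E.proj.app y q.1 = X.p.map f q.2},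
      ∀ a, (e a).1 = (E.total.map f a, E.proj.app x a) := by
  have hE := E.cartesian f
  let P : TopCat.{u} :=
    TopCat.of {q : E.total.obj y × X.p.obj x // E.proj.app y q.1 = X.p.map f q.2}
  let l : P ⟶ E.total.obj x := hE.lift (TopCat.ofHom ⟨fun q => q.1.1, by fun_prop⟩)
    (TopCat.ofHom ⟨fun q => q.1.2, by fun_prop⟩) (by ext q; exact q.2)
  have h1 : ∀ q : P, E.total.map f (l q) = q.1.1 := fun q =>
    ConcreteCategory.congr_hom (hE.lift_fst _ _ _) q
  have h2 : ∀ q : P, E.proj.app x (l q) = q.1.2 := fun q =>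
    ConcreteCategory.congr_hom (hE.lift_snd _ _ _) q
  let k : E.total.obj x ⟶ P :=
    TopCat.ofHom ⟨fun a => ⟨(E.total.map f a, E.proj.app x a), E.proj_map f a⟩, by fun_prop⟩
  have h3 : k ≫ l = 𝟙 _ := by
    apply hE.hom_ext
    · ext a; exact h1 (k a)
    · ext a; exact h2 (k a)
  exact ⟨{ toFun := k
           invFun := l
           left_inv := fun a => ConcreteCategory.congr_hom h3 a
           right_inv := fun q => Subtype.ext (Prod.ext (h1 q) (h2 q))
           continuous_toFun := k.hom.continuous
           continuous_invFun := l.hom.continuous }, fun a => rfl⟩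

lemma exists_pullback_point (E : VectorBundle X) {x y : X.obj} (f : x ⟶ y) (s : X.p.obj x)
    (b : E.total.obj y) (h : E.proj.app y b = X.p.map f s) :
    ∃ a : E.total.obj x, E.total.map f a = b ∧ E.proj.app x a = s := by
  obtain ⟨e, he⟩ := E.exists_homeo_pullback f
  refine ⟨e.symm ⟨(b, s), h⟩, ?_⟩
  have := he (e.symm ⟨(b, s), h⟩)
  rw [Homeomorph.apply_symm_apply] at this
  exact ⟨(congrArg Prod.fst this).symm, (congrArg Prod.snd this).symm⟩

lemma pullback_point_ext (E : VectorBundle X) {x y : X.obj} (f : x ⟶ y) {a b : E.total.obj x}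
    (h : E.total.map f a = E.total.map f b) (h' : E.proj.app x a = E.proj.app x b) : a = b := by
  obtain ⟨e, he⟩ := E.exists_homeo_pullback f
  exact e.injective (Subtype.ext (by rw [he, he, h, h']))

lemma isInducing_pullback (E : VectorBundle X) {x y : X.obj} (f : x ⟶ y) :
    IsInducing fun a : E.total.obj x => (E.total.map f a, E.proj.app x a) := by
  obtain ⟨e, he⟩ := E.exists_homeo_pullback f
  have : (fun a : E.total.obj x => (E.total.map f a, E.proj.app x a)) = Subtype.val ∘ e :=
    funext fun a => (he a).symm
  rw [this]
  exact IsInducing.subtypeVal.comp e.isInducing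

lemma isOpenMap_map (E : VectorBundle X) {x y : X.obj} (f : x ⟶ y)
    (hf : IsOpenMap (X.p.map f)) : IsOpenMap (E.total.map f) := by
  rw [isOpenMap_iff_nhds_le]
  intro a s hs
  rw [Filter.mem_map, (E.isInducing_pullback f).nhds_eq_comap, nhds_prod_eq, mem_comap] at hs
  obtain ⟨s', hs', hss⟩ := hs
  obtain ⟨P, hP, Q, hQ, hPQ⟩ := mem_prod_iff.1 hs'
  have h1 : X.p.map f '' Q ∈ 𝓝 (E.proj.app y (E.total.map f a)) := by
    rw [proj_map]
    exact hf.image_mem_nhds hQ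
  filter_upwards [hP, (E.continuous_proj y).continuousAt h1] with b hb ⟨q, hq, hqb⟩
  obtain ⟨a', ha', ha''⟩ := E.exists_pullback_point f q b hqb.symm
  rw [← ha']
  exact hss (hPQ ⟨by simpa [ha'] using hb, by simpa [ha''] using hq⟩)

/-- The linear map of fibers along a morphism of `X`. -/
def mapFibLinear (E : VectorBundle X) {x y : X.obj} (f : x ⟶ y) {s : X.p.obj x} {t : X.p.obj y}
    (h : X.p.map f s = t) : E.Fib x s →ₗ[ℂ] E.Fib y t where
  toFun a := ⟨E.total.map f a.1, (E.proj_map f a.1).trans (a.2.symm ▸ h)⟩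
  map_add' _ _ := Fib.ext (E.map_vadd f _ _ _ _)
  map_smul' _ _ := Fib.ext (E.map_smul f _ _)

/-- The isomorphism of fibers along a morphism of `X`. -/
def mapFib (E : VectorBundle X) {x y : X.obj} (f : x ⟶ y) {s : X.p.obj x} {t : X.p.obj y}
    (h : X.p.map f s = t) : E.Fib x s ≃ₗ[ℂ] E.Fib y t :=
  LinearEquiv.ofBijective (E.mapFibLinear f h) <| by
    constructor
    · intro a b hab
      exact Fib.ext (E.pullback_point_ext f (congrArg Fib.val hab) (a.2.trans b.2.symm))
    · intro b
      obtain ⟨a, ha, ha'⟩ := E.exists_pullback_point f s b.1 (b.2.trans h.symm)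
      exact ⟨⟨a, ha'⟩, Fib.ext ha⟩

@[simp]
lemma mapFib_val (E : VectorBundle X) {x y : X.obj} (f : x ⟶ y) {s : X.p.obj x} {t : X.p.obj y}
    (h : X.p.map f s = t) (a : E.Fib x s) : (E.mapFib f h a).1 = E.total.map f a.1 := rfl

lemma map_mapFib_symm (E : VectorBundle X) {x y : X.obj} (f : x ⟶ y) {s : X.p.obj x}
    {t : X.p.obj y} (h : X.p.map f s = t) (b : E.Fib y t) :
    E.total.map f ((E.mapFib f h).symm b).1 = b.1 := by
  rw [← mapFib_val E f h, LinearEquiv.apply_symm_apply]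

/-! ### Families of linear maps between fibers -/

variable (E F) in
/-- A family of linear maps between the fibers of `E` and `F` over the base of `y`, without any
continuity. -/
abbrev FibHom (y : X.obj) : Type u := ∀ t : X.p.obj y, E.Fib y t →ₗ[ℂ] F.Fib y t

namespace FibHom

variable {x y z : X.obj}

/-- The map of total spaces given by a family of linear maps. -/
def tot (M : FibHom E F y) (a : E.total.obj y) : F.total.obj y := (M (E.proj.app y a) (toFib a)).1

lemma tot_val (M : FibHom E F y) {t : X.p.obj y} (a : E.Fib y t) : M.tot a.1 = (M t a).1 := by
  obtain ⟨a, rfl⟩ := a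
  rfl

lemma proj_tot (M : FibHom E F y) (a : E.total.obj y) :
    F.proj.app y (M.tot a) = E.proj.app y a :=
  (M _ _).2

lemma ext_tot {M N : FibHom E F y} (h : ∀ a, M.tot a = N.tot a) : M = N := by
  funext t
  refine LinearMap.ext fun a => Fib.ext ?_
  rw [← tot_val, ← tot_val, h]

/-- Pullback of a family of linear maps. -/
def pull (M : FibHom E F y) (f : x ⟶ y) : FibHom E F x := fun s =>
  (F.mapFib f rfl).symm.toLinearMap ∘ₗ M (X.p.map f s) ∘ₗ (E.mapFib f rfl).toLinearMap

lemma map_tot_pull (M : FibHom E F y) (f : x ⟶ y) (a : E.total.obj x) :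
    F.total.map f ((M.pull f).tot a) = M.tot (E.total.map f a) := by
  refine (map_mapFib_symm F f rfl _).trans ?_
  exact (M.tot_val (E.mapFib f rfl (toFib a))).symm

lemma pull_eq_iff (M : FibHom E F y) (f : x ⟶ y) (N : FibHom E F x) :
    M.pull f = N ↔ ∀ a, F.total.map f (N.tot a) = M.tot (E.total.map f a) := by
  constructor
  · rintro rfl a
    exact M.map_tot_pull f a
  · intro h
    refine ext_tot fun a => F.pullback_point_ext f ?_ ?_
    · rw [h, map_tot_pull]
    · rw [proj_tot, proj_tot]

lemma pull_comp (M : FibHom E F z) (f : x ⟶ y) (g : y ⟶ z) :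
    M.pull (f ≫ g) = (M.pull g).pull f := by
  rw [pull_eq_iff]
  intro a
  rw [map_comp_apply, map_tot_pull, map_tot_pull, map_comp_apply]

lemma pull_id (M : FibHom E F x) : M.pull (𝟙 x) = M := by
  rw [pull_eq_iff]
  intro a
  rw [map_id_apply, map_id_apply]

lemma pull_add (M N : FibHom E F y) (f : x ⟶ y) : (M + N).pull f = M.pull f + N.pull f := by
  funext t
  refine LinearMap.ext fun a => ?_
  simp [pull]

lemma pull_sub (M N : FibHom E F y) (f : x ⟶ y) : (M - N).pull f = M.pull f - N.pull f := by
  funext t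
  refine LinearMap.ext fun a => ?_
  simp [pull]

lemma pull_sum {ι : Type*} (s : Finset ι) (M : ι → FibHom E F y) (f : x ⟶ y) :
    (∑ i ∈ s, M i).pull f = ∑ i ∈ s, (M i).pull f :=
  map_sum (AddMonoidHom.mk' (fun M : FibHom E F y => M.pull f) fun M N => pull_add M N f) M s

/-- Scaling of a family of linear maps by a function. -/
def scale (φ : X.p.obj y → ℂ) (M : FibHom E F y) : FibHom E F y := fun t => φ t • M t

lemma pull_scale (φ : X.p.obj y → ℂ) (M : FibHom E F y) (f : x ⟶ y) :
    (scale φ M).pull f = scale (φ ∘ X.p.map f) (M.pull f) := by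
  funext t
  refine LinearMap.ext fun a => ?_
  simp [pull, scale]

lemma bijective_pull_iff (M : FibHom E F y) (f : x ⟶ y) (s : X.p.obj x) :
    Function.Bijective (M.pull f s) ↔ Function.Bijective (M (X.p.map f s)) := by
  have : (M.pull f s : E.Fib x s → F.Fib x s) =
      (F.mapFib f rfl).symm ∘ M (X.p.map f s) ∘ (E.mapFib f rfl) := rfl
  rw [this, (F.mapFib f rfl).symm.bijective.of_comp_iff',
    Function.Bijective.of_comp_iff _ (E.mapFib f rfl).bijective]

/-! ### Continuity -/

/-- A family of linear maps is continuous at a point of the base. -/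
def ContAt (M : FibHom E F y) (t : X.p.obj y) : Prop :=
  ∀ a : E.total.obj y, E.proj.app y a = t → ContinuousAt M.tot a

lemma ContAt.pull {M : FibHom E F y} (f : x ⟶ y) {s : X.p.obj x} (h : M.ContAt (X.p.map f s)) :
    (M.pull f).ContAt s := by
  rintro a rfl
  rw [(F.isInducing_pullback f).continuousAt_iff]
  have : (fun a : F.total.obj x => (F.total.map f a, F.proj.app x a)) ∘ (M.pull f).tot =
      fun a => (M.tot (E.total.map f a), E.proj.app x a) :=
    funext fun a => Prod.ext (M.map_tot_pull f a) (proj_tot _ a)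
  rw [this]
  exact ((h _ (E.proj_map f a)).comp (E.continuous_map f).continuousAt).prodMk
    (E.continuous_proj x).continuousAt

lemma contAt_of_pull {M : FibHom E F y} (f : x ⟶ y) (hf : IsOpenMap (X.p.map f)) {s : X.p.obj x}
    (h : (M.pull f).ContAt s) : M.ContAt (X.p.map f s) := by
  intro b hb
  obtain ⟨a, rfl, rfl⟩ := E.exists_pullback_point f s b hb
  have h1 : Tendsto (M.tot ∘ E.total.map f) (𝓝 a) (𝓝 (M.tot (E.total.map f a))) := by
    have : M.tot ∘ E.total.map f = F.total.map f ∘ (M.pull f).tot :=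
      funext fun a => (M.map_tot_pull f a).symm
    rw [this, ← map_tot_pull]
    exact (F.continuous_map f).continuousAt.comp (h a rfl)
  exact (tendsto_map'_iff.2 h1).mono_left ((E.isOpenMap_map f hf).nhds_le a)

end FibHom

end VectorBundle

namespace VectorBundle

variable {X : BasedCategory.{v, w} TopCat.{u}} {E F G : VectorBundle X} {x y : X.obj}

/-! ### Local coordinates -/

namespace LocalTriv

variable {U : Set (X.p.obj y)} {n : ℕ} (τ : E.LocalTriv y U n)

open Classical in
/-- The coordinates of a point of the total space; zero outside of the trivialization. -/
def chart (a : E.total.obj y) : Fin n → ℂ :=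
  if h : E.proj.app y a ∈ U then (τ.homeo ⟨a, h⟩).2 else 0

open Classical in
/-- The point of the total space with the given coordinates; zero outside of the trivialization. -/
def point (q : X.p.obj y × (Fin n → ℂ)) : E.total.obj y :=
  if h : q.1 ∈ U then (τ.homeo.symm (⟨q.1, h⟩, q.2)).1 else (0 : E.Fib y q.1).1

variable {τ}

lemma chart_val {t : X.p.obj y} (ht : t ∈ U) (a : E.Fib y t) :
    chart τ a.1 = fib τ ht a := by
  obtain ⟨a, rfl⟩ := a
  exact dif_pos ht

lemma point_eq {t : X.p.obj y} (ht : t ∈ U) (c : Fin n → ℂ) :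
    point τ (t, c) = ((fib τ ht).symm c).1 :=
  dif_pos ht

lemma proj_point (q : X.p.obj y × (Fin n → ℂ)) : E.proj.app y (point τ q) = q.1 := by
  by_cases h : q.1 ∈ U
  · rw [← Prod.mk.eta (p := q), point_eq h]
    exact ((fib τ h).symm q.2).2
  · rw [point, dif_neg h]
    exact (0 : E.Fib y q.1).2

lemma continuousAt_chart (hU : IsOpen U) {a : E.total.obj y} (ha : E.proj.app y a ∈ U) :
    ContinuousAt (chart τ) a := by
  have ho : IsOpen (E.proj.app y ⁻¹' U) := hU.preimage (E.continuous_proj y)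
  have : ContinuousOn (chart τ) (E.proj.app y ⁻¹' U) := by
    rw [continuousOn_iff_continuous_domRestrict]
    have h : (E.proj.app y ⁻¹' U).domRestrict (chart τ) = fun a => (τ.homeo a).2 := by
      funext a
      exact dif_pos a.2
    rw [h]
    exact continuous_snd.comp τ.homeo.continuous
  exact this.continuousAt (ho.mem_nhds ha)

lemma continuousAt_point (hU : IsOpen U) {q : X.p.obj y × (Fin n → ℂ)} (hq : q.1 ∈ U) :
    ContinuousAt (point τ) q := by
  have ho : IsOpen (Prod.fst ⁻¹' U : Set (X.p.obj y × (Fin n → ℂ))) := hU.preimage continuous_fst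
  have : ContinuousOn (point τ) (Prod.fst ⁻¹' U) := by
    rw [continuousOn_iff_continuous_domRestrict]
    have h : (Prod.fst ⁻¹' U).domRestrict (point τ) =
        fun q => (τ.homeo.symm (⟨q.1.1, q.2⟩, q.1.2)).1 := by
      funext q
      exact dif_pos q.2
    rw [h]
    fun_prop
  exact this.continuousAt (ho.mem_nhds hq)

end LocalTriv

namespace FibHom

open LocalTriv

variable {U U' : Set (X.p.obj y)} {n m : ℕ} (τ : E.LocalTriv y U n) (τ' : F.LocalTriv y U' m)

open Classical in
/-- The matrix of a family of linear maps in local trivializations. -/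
def coord (M : FibHom E F y) (t : X.p.obj y) : (Fin n → ℂ) →L[ℂ] (Fin m → ℂ) :=
  if h : t ∈ U ∧ t ∈ U' then
    LinearMap.toContinuousLinearMap
      ((fib τ' h.2).toLinearMap ∘ₗ M t ∘ₗ (fib τ h.1).symm.toLinearMap)
  else 0

variable {τ τ'}

lemma coord_apply (M : FibHom E F y) {t : X.p.obj y} (h : t ∈ U) (h' : t ∈ U') (c : Fin n → ℂ) :
    M.coord τ τ' t c = fib τ' h' (M t ((fib τ h).symm c)) := by
  rw [coord, dif_pos ⟨h, h'⟩]
  rfl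

lemma coord_add (M N : FibHom E F y) : (M + N).coord τ τ' = M.coord τ τ' + N.coord τ τ' := by
  funext t
  by_cases h : t ∈ U ∧ t ∈ U'
  · ext1 c
    simp only [Pi.add_apply, _root_.add_apply]
    rw [coord_apply _ h.1 h.2, coord_apply _ h.1 h.2, coord_apply _ h.1 h.2, Pi.add_apply,
      LinearMap.add_apply, map_add]
  · simp [coord, h]

lemma coord_scale (φ : X.p.obj y → ℂ) (M : FibHom E F y) (t : X.p.obj y) :
    (scale φ M).coord τ τ' t = φ t • M.coord τ τ' t := by
  by_cases h : t ∈ U ∧ t ∈ U'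
  · ext1 c
    rw [_root_.smul_apply, coord_apply _ h.1 h.2, coord_apply _ h.1 h.2, scale,
      LinearMap.smul_apply, _root_.map_smul]
  · rw [coord, coord, dif_neg h, dif_neg h]
    exact (_root_.smul_zero (φ t) : _ • (0 : (Fin n → ℂ) →L[ℂ] (Fin m → ℂ)) = 0).symm

/-- The matrix of a family is continuous along `f` if the pullback of the family along `f` is. -/
lemma ContAt.continuousAt_coord (hU : IsOpen U) (hU' : IsOpen U') {M : FibHom E F y} (f : x ⟶ y)
    {s : X.p.obj x} (h : (M.pull f).ContAt s) (hs : X.p.map f s ∈ U) (hs' : X.p.map f s ∈ U') :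
    ContinuousAt (fun s' => M.coord τ τ' (X.p.map f s')) s := by
  refine continuousAt_clm_apply.2 fun c => ?_
  -- the points of the total space over `x` with constant coordinates
  let ω : X.p.obj x → E.total.obj x := fun s' =>
    ((E.mapFib f rfl).symm ⟨point τ (X.p.map f s', c), proj_point _⟩).val
  have hω : ∀ s', E.total.map f (ω s') = point τ (X.p.map f s', c) := fun s' =>
    E.map_mapFib_symm f rfl _
  have hωs : ∀ s', E.proj.app x (ω s') = s' := fun s' => Fib.proj_val _
  have hp : ContinuousAt (fun s' => point τ (X.p.map f s', c)) s :=
    ContinuousAt.comp (f := fun s' : X.p.obj x => (X.p.map f s', c)) (continuousAt_point hU hs)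
      (by fun_prop)
  have hωc : ContinuousAt ω s := by
    rw [(E.isInducing_pullback f).continuousAt_iff]
    have : (fun a : E.total.obj x => (E.total.map f a, E.proj.app x a)) ∘ ω =
        fun s' => (point τ (X.p.map f s', c), s') :=
      funext fun s' => Prod.ext (hω s') (hωs s')
    rw [this]
    exact hp.prodMk continuousAt_id
  have hM : ContinuousAt (fun s' => F.total.map f ((M.pull f).tot (ω s'))) s :=
    (F.continuous_map f).continuousAt.comp (ContinuousAt.comp (h _ (hωs s)) hωc)
  simp only [map_tot_pull, hω] at hM
  have hc : ContinuousAt (fun s' => chart τ' (M.tot (point τ (X.p.map f s', c)))) s :=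
    ContinuousAt.comp (continuousAt_chart hU' (by rw [proj_tot, proj_point]; exact hs')) hM
  refine hc.congr ?_
  filter_upwards [((hU.inter hU').preimage (p_continuous f)).mem_nhds ⟨hs, hs'⟩] with s' h'
  replace h' : X.p.map f s' ∈ U ∧ X.p.map f s' ∈ U' := h'
  rw [point_eq h'.1, tot_val, chart_val h'.2, coord_apply _ h'.1 h'.2]

lemma contAt_iff_coord (hU : IsOpen U) (hU' : IsOpen U') (M : FibHom E F y) {t : X.p.obj y}
    (ht : t ∈ U) (ht' : t ∈ U') : M.ContAt t ↔ ContinuousAt (M.coord τ τ') t := by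
  constructor
  · intro h
    have := ContAt.continuousAt_coord (τ := τ) (τ' := τ') hU hU' (M := M) (𝟙 y) (s := t)
      (by rwa [pull_id]) (by rwa [p_id]) (by rwa [p_id])
    simpa only [p_id] using this
  · rintro h a rfl
    have h1 : ContinuousAt (fun b => (E.proj.app y b, M.coord τ τ' (E.proj.app y b) (chart τ b))) a
        := by
      refine (E.continuous_proj y).continuousAt.prodMk ?_
      exact (ContinuousAt.comp (f := E.proj.app y) h (E.continuous_proj y).continuousAt).clm_apply
        (continuousAt_chart hU ht)
    refine (ContinuousAt.comp (f := fun b => (E.proj.app y b,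
      M.coord τ τ' (E.proj.app y b) (chart τ b))) (g := point τ')
      (continuousAt_point hU' ht') h1).congr ?_
    filter_upwards [((hU.inter hU').preimage (E.continuous_proj y)).mem_nhds ⟨ht, ht'⟩] with b hb
    replace hb : E.proj.app y b ∈ U ∧ E.proj.app y b ∈ U' := hb
    change point τ' (_, _) = _
    rw [point_eq hb.2, coord_apply _ hb.1 hb.2, show chart τ b = _ from chart_val hb.1 (toFib b),
      LinearEquiv.symm_apply_apply, LinearEquiv.symm_apply_apply]
    rfl

lemma ContAt.congr {M N : FibHom E F y} {t : X.p.obj y} (h : M.ContAt t)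
    (h' : ∀ᶠ s in 𝓝 t, M s = N s) : N.ContAt t := by
  rintro a rfl
  refine (h a rfl).congr ?_
  filter_upwards [(E.continuous_proj y).continuousAt.eventually h'] with b hb
  simp [tot, hb]

lemma ContAt.add {M N : FibHom E F y} {t : X.p.obj y} (h : M.ContAt t) (h' : N.ContAt t) :
    (M + N).ContAt t := by
  obtain ⟨n, U, hU, ht, ⟨τ⟩⟩ := E.exists_localTriv y t
  obtain ⟨m, U', hU', ht', ⟨τ'⟩⟩ := F.exists_localTriv y t
  rw [contAt_iff_coord (τ := τ) (τ' := τ') hU hU' _ ht ht'] at *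
  rw [coord_add]
  exact ContinuousAt.add h h'

lemma ContAt.scale {φ : X.p.obj y → ℂ} {M : FibHom E F y} {t : X.p.obj y} (hφ : ContinuousAt φ t)
    (h : M.ContAt t) : (scale φ M).ContAt t := by
  obtain ⟨n, U, hU, ht, ⟨τ⟩⟩ := E.exists_localTriv y t
  obtain ⟨m, U', hU', ht', ⟨τ'⟩⟩ := F.exists_localTriv y t
  rw [contAt_iff_coord (τ := τ) (τ' := τ') hU hU' _ ht ht'] at *
  rw [funext (coord_scale φ M)]
  exact ContinuousAt.smul hφ h

lemma contAt_zero (t : X.p.obj y) : (0 : FibHom E F y).ContAt t := by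
  obtain ⟨n, U, hU, ht, ⟨τ⟩⟩ := E.exists_localTriv y t
  obtain ⟨m, U', hU', ht', ⟨τ'⟩⟩ := F.exists_localTriv y t
  rw [contAt_iff_coord (τ := τ) (τ' := τ') hU hU' _ ht ht']
  have : (0 : FibHom E F y).coord τ τ' = 0 := by
    have := coord_add (τ := τ) (τ' := τ') (0 : FibHom E F y) 0
    rwa [add_zero, left_eq_add] at this
  rw [this]
  exact continuousAt_const

lemma ContAt.sub {M N : FibHom E F y} {t : X.p.obj y} (h : M.ContAt t) (h' : N.ContAt t) :
    (M - N).ContAt t := by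
  have : M - N = M + FibHom.scale (fun _ => -1) N := by
    funext t
    simp [FibHom.scale, sub_eq_add_neg]
  rw [this]
  exact h.add (ContAt.scale continuousAt_const h')

lemma ContAt.sum {ι : Type*} {s : Finset ι} {M : ι → FibHom E F y} {t : X.p.obj y}
    (h : ∀ i ∈ s, (M i).ContAt t) : (∑ i ∈ s, M i).ContAt t := by
  classical
  induction s using Finset.induction_on with
  | empty => simpa using contAt_zero t
  | insert i s hi ih =>
    rw [Finset.sum_insert hi]
    exact (h i (by simp)).add (ih fun j hj => h j (by simp [hj]))

open Classical in
/-- The inverses of a family of linear maps, zero where there is none. -/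
def inv (M : FibHom E F y) : FibHom F E y := fun t =>
  if h : Function.Bijective (M t) then (LinearEquiv.ofBijective (M t) h).symm.toLinearMap else 0

lemma inv_apply_apply (M : FibHom E F y) {t : X.p.obj y} (h : Function.Bijective (M t))
    (a : E.Fib y t) : M.inv t (M t a) = a := by
  rw [inv, dif_pos h]
  exact (LinearEquiv.ofBijective (M t) h).symm_apply_apply a

lemma apply_inv_apply (M : FibHom E F y) {t : X.p.obj y} (h : Function.Bijective (M t))
    (b : F.Fib y t) : M t (M.inv t b) = b := by
  rw [inv, dif_pos h]
  exact (LinearEquiv.ofBijective (M t) h).apply_symm_apply b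

/-- The matrix of a bijective linear map between fibers is invertible, and its inverse is the
matrix of the inverse map. -/
lemma exists_coord_eq (M : FibHom E F y) {t : X.p.obj y} (ht : t ∈ U) (ht' : t ∈ U')
    (h : Function.Bijective (M t)) : ∃ e : (Fin n → ℂ) ≃L[ℂ] (Fin m → ℂ),
      M.coord τ τ' t = e ∧ M.inv.coord τ' τ t = e.symm := by
  let e := (fib τ ht).symm.trans ((LinearEquiv.ofBijective (M t) h).trans (fib τ' ht'))
  refine ⟨e.toContinuousLinearEquiv, ?_, ?_⟩
  · ext1 c
    rw [coord_apply _ ht ht']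
    rfl
  · ext1 c
    rw [coord_apply _ ht' ht, inv, dif_pos h]
    rfl

/-- Bijectivity is an open condition. -/
lemma ContAt.eventually_bijective {M : FibHom E F y} {t : X.p.obj y} (h : M.ContAt t)
    (hb : Function.Bijective (M t)) : ∀ᶠ s in 𝓝 t, Function.Bijective (M s) := by
  obtain ⟨n, U, hU, ht, ⟨τ⟩⟩ := E.exists_localTriv y t
  obtain ⟨m, U', hU', ht', ⟨τ'⟩⟩ := F.exists_localTriv y t
  rw [contAt_iff_coord (τ := τ) (τ' := τ') hU hU' _ ht ht'] at h
  obtain ⟨e, he, -⟩ := exists_coord_eq (τ := τ) (τ' := τ') M ht ht' hb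
  have hn := ContinuousLinearEquiv.nhds e
  rw [← he] at hn
  filter_upwards [h hn, (hU.inter hU').mem_nhds ⟨ht, ht'⟩] with s ⟨e', he'⟩ hs
  have : (M s : E.Fib y s → F.Fib y s) = (fib τ' hs.2).symm ∘ e' ∘ fib τ hs.1 := by
    funext a
    rw [Function.comp_apply, Function.comp_apply, LinearEquiv.eq_symm_apply]
    have := congrArg (fun L => L (fib τ hs.1 a)) he'
    simpa [coord_apply _ hs.1 hs.2] using this.symm
  rw [this]
  exact (fib τ' hs.2).symm.bijective.comp (e'.bijective.comp (fib τ hs.1).bijective)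

lemma ContAt.inv {M : FibHom E F y} {t : X.p.obj y} (h : M.ContAt t)
    (hb : Function.Bijective (M t)) : M.inv.ContAt t := by
  have hev := h.eventually_bijective hb
  obtain ⟨n, U, hU, ht, ⟨τ⟩⟩ := E.exists_localTriv y t
  obtain ⟨m, U', hU', ht', ⟨τ'⟩⟩ := F.exists_localTriv y t
  rw [contAt_iff_coord (τ := τ) (τ' := τ') hU hU' _ ht ht'] at h
  rw [contAt_iff_coord (τ := τ') (τ' := τ) hU' hU _ ht' ht]
  obtain ⟨e, he, -⟩ := exists_coord_eq (τ := τ) (τ' := τ') M ht ht' hb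
  have hc : ContinuousAt ContinuousLinearMap.inverse (M.coord τ τ' t) := by
    rw [he]
    exact (contDiffAt_map_inverse (n := 0) e).continuousAt
  refine (ContinuousAt.comp (f := M.coord τ τ') hc h).congr ?_
  filter_upwards [hev, (hU.inter hU').mem_nhds ⟨ht, ht'⟩] with s hbs hs
  obtain ⟨e', he', he''⟩ := exists_coord_eq (τ := τ) (τ' := τ') M hs.1 hs.2 hbs
  rw [he'', Function.comp_apply, he', ContinuousLinearMap.inverse_equiv]

end FibHom

end VectorBundle

namespace VectorBundle

variable {X : BasedCategory.{v, w} TopCat.{u}} {Y : BasedCategory.{v', w'} TopCat.{u}}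
  {E F G : VectorBundle X} {x y : X.obj}

/-! ### Homomorphisms of vector bundles -/

variable (E F) in
/-- A homomorphism of vector bundles. -/
structure Hom where
  toFun : ∀ x : X.obj, E.total.obj x → F.total.obj x
  continuous : ∀ x, Continuous (toFun x)
  naturality : ∀ {x y : X.obj} (f : x ⟶ y) (a : E.total.obj x),
    toFun y (E.total.map f a) = F.total.map f (toFun x a)
  proj_eq : ∀ x a, F.proj.app x (toFun x a) = E.proj.app x a
  map_vadd : ∀ x a b h h', toFun x (E.vadd x a b h) = F.vadd x (toFun x a) (toFun x b) h'
  map_smul : ∀ x c a, toFun x (E.smul x c a) = F.smul x c (toFun x a)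

/-- An isomorphism as a homomorphism. -/
def Iso.toHom (α : Iso E F) : Hom E F where
  toFun x := α.homeo x
  continuous x := (α.homeo x).continuous
  naturality := α.naturality
  proj_eq := α.proj_eq
  map_vadd := α.map_vadd
  map_smul := α.map_smul

namespace Hom

/-- The linear maps of fibers given by a homomorphism. -/
def fib (h : Hom E F) (y : X.obj) : FibHom E F y := fun _ =>
  { toFun := fun a => ⟨h.toFun y a.val, (h.proj_eq y _).trans a.proj_val⟩
    map_add' := fun _ _ => Fib.ext (h.map_vadd y _ _ _ _)
    map_smul' := fun _ _ => Fib.ext (h.map_smul y _ _) }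

lemma fib_tot (h : Hom E F) (a : E.total.obj y) : (h.fib y).tot a = h.toFun y a := rfl

lemma fib_pull (h : Hom E F) (f : x ⟶ y) : (h.fib y).pull f = h.fib x := by
  rw [FibHom.pull_eq_iff]
  exact fun a => (h.naturality f a).symm

lemma fib_contAt (h : Hom E F) (y : X.obj) (t : X.p.obj y) : (h.fib y).ContAt t :=
  fun _ _ => (h.continuous y).continuousAt

/-- A natural continuous family of linear maps of fibers is a homomorphism. -/
def ofFib (M : ∀ y, FibHom E F y) (hM : ∀ {x y : X.obj} (f : x ⟶ y), (M y).pull f = M x)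
    (hc : ∀ y t, (M y).ContAt t) : Hom E F where
  toFun y := (M y).tot
  continuous y := continuous_iff_continuousAt.2 fun a => hc y _ a rfl
  naturality f a := by rw [← hM f, FibHom.map_tot_pull]
  proj_eq y a := FibHom.proj_tot _ _
  map_vadd y a b h h' := by
    have h1 := congrArg Fib.val (map_add (M y (E.proj.app y a)) ⟨a, rfl⟩ ⟨b, h.symm⟩)
    rw [← FibHom.tot_val, Fib.val_add, Fib.val_add] at h1
    refine h1.trans (F.vadd_congr y ?_ ?_ _)
    · rw [← FibHom.tot_val]
    · rw [← FibHom.tot_val]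
  map_smul y c a := by
    have h1 := congrArg Fib.val (_root_.map_smul (M y (E.proj.app y a)) c ⟨a, rfl⟩)
    rw [← FibHom.tot_val, Fib.val_smul, Fib.val_smul] at h1
    exact h1

lemma fib_ofFib (M : ∀ y, FibHom E F y) (hM : ∀ {x y : X.obj} (f : x ⟶ y), (M y).pull f = M x)
    (hc : ∀ y t, (M y).ContAt t) (y : X.obj) : (ofFib M hM hc).fib y = M y :=
  FibHom.ext_tot fun _ => rfl

instance : Add (Hom E F) :=
  ⟨fun h k => ofFib (fun y => h.fib y + k.fib y)
    (fun f => by rw [FibHom.pull_add, fib_pull, fib_pull])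
    (fun y t => (h.fib_contAt y t).add (k.fib_contAt y t))⟩

instance : Sub (Hom E F) :=
  ⟨fun h k => ofFib (fun y => h.fib y - k.fib y)
    (fun f => by rw [FibHom.pull_sub, fib_pull, fib_pull])
    (fun y t => (h.fib_contAt y t).sub (k.fib_contAt y t))⟩

lemma fib_add (h k : Hom E F) (y : X.obj) : (h + k).fib y = h.fib y + k.fib y :=
  FibHom.ext_tot fun _ => rfl

lemma fib_sub (h k : Hom E F) (y : X.obj) : (h - k).fib y = h.fib y - k.fib y :=
  FibHom.ext_tot fun _ => rfl

/-- The pullback of a homomorphism along a map of stacks. -/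
def pullback (h : Hom E F) (K : Y ⥤ᵇ X) : Hom (E.pullback K) (F.pullback K) where
  toFun y := h.toFun (K.obj y)
  continuous y := h.continuous (K.obj y)
  naturality f a := h.naturality (K.map f) a
  proj_eq y a := congrArg ((eqToHom K.w : K.toFunctor ⋙ X.p ⟶ Y.p).app y)
    (h.proj_eq (K.obj y) a)
  map_vadd y a b _ _ := h.map_vadd (K.obj y) a b _ _
  map_smul y c a := h.map_smul (K.obj y) c a

/-- The composition of homomorphisms. -/
def comp (h : Hom E F) (k : Hom F G) : Hom E G where
  toFun y a := k.toFun y (h.toFun y a)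
  continuous y := (k.continuous y).comp (h.continuous y)
  naturality f a := by rw [h.naturality, k.naturality]
  proj_eq y a := by rw [k.proj_eq, h.proj_eq]
  map_vadd y a b e e' := by
    rw [h.map_vadd y a b e (by rw [h.proj_eq, h.proj_eq, e]), k.map_vadd]
  map_smul y c a := by rw [h.map_smul, k.map_smul]

end Hom

lemma Hom.bijective_fib_iff (h : Hom E F) (y : X.obj) :
    (∀ t, Function.Bijective (h.fib y t)) ↔ Function.Bijective (h.toFun y) := by
  constructor
  · intro H
    constructor
    · intro a b hab
      have h1 : E.proj.app y b = E.proj.app y a := by rw [← h.proj_eq, ← h.proj_eq, hab]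
      exact congrArg Fib.val ((H (E.proj.app y a)).1 (a₁ := ⟨a, rfl⟩) (a₂ := ⟨b, h1⟩)
        (Fib.ext hab))
    · intro b
      obtain ⟨a, ha⟩ := (H (F.proj.app y b)).2 ⟨b, rfl⟩
      exact ⟨a.val, congrArg Fib.val ha⟩
  · intro H t
    constructor
    · intro a b hab
      exact Fib.ext (H.1 (congrArg Fib.val hab))
    · intro b
      obtain ⟨a, ha⟩ := H.2 b.val
      exact ⟨⟨a, by rw [← h.proj_eq, ha, b.proj_val]⟩, Fib.ext ha⟩

/-- A fiberwise bijective homomorphism is an isomorphism. -/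
def Iso.ofHom (h : Hom E F) (hb : ∀ y t, Function.Bijective (h.fib y t)) : Iso E F where
  homeo y :=
    { toFun := h.toFun y
      invFun := (h.fib y).inv.tot
      left_inv := fun a => by
        have := congrArg Fib.val ((h.fib y).inv_apply_apply (hb y _) (toFib a))
        rwa [← FibHom.tot_val] at this
      right_inv := fun b => by
        have := congrArg Fib.val ((h.fib y).apply_inv_apply (hb y _) (toFib b))
        rwa [← FibHom.tot_val, ← FibHom.tot_val] at this
      continuous_toFun := h.continuous y
      continuous_invFun := continuous_iff_continuousAt.2 fun b =>
        (h.fib_contAt y _).inv (hb y _) b rfl }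
  naturality := h.naturality
  proj_eq := h.proj_eq
  map_vadd := h.map_vadd
  map_smul := h.map_smul

/-! ### Families given on points -/

namespace FibHom

lemma ext_point (hX : IsFibered X) {M N : FibHom E F y}
    (h : ∀ (z : X.obj) (φ : z ⟶ y), Subsingleton (X.p.obj z) → M.pull φ = N.pull φ) : M = N := by
  refine ext_tot fun b => ?_
  obtain ⟨z, φ, s, hs, hst⟩ := hX.exists_point y (E.proj.app y b)
  obtain ⟨a, rfl, -⟩ := E.exists_pullback_point φ s b hst.symm
  rw [← map_tot_pull, h z φ hs, map_tot_pull]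

variable (hX : IsFibered X) (N : ∀ z : X.obj, Subsingleton (X.p.obj z) → FibHom E F z)

/-- The family over `y` determined by families over points. -/
def ofPoints (y : X.obj) : FibHom E F y := fun t =>
  have h := (hX.exists_point y t).choose_spec.choose_spec.choose_spec
  (F.mapFib _ h.2).toLinearMap ∘ₗ N _ h.1 _ ∘ₗ (E.mapFib _ h.2).symm.toLinearMap

lemma ofPoints_spec (y : X.obj) (t : X.p.obj y) :
    ∃ (z : X.obj) (φ : z ⟶ y) (s : X.p.obj z) (hs : Subsingleton (X.p.obj z))
      (hst : X.p.map φ s = t), ofPoints hX N y t =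
        (F.mapFib φ hst).toLinearMap ∘ₗ N z hs s ∘ₗ (E.mapFib φ hst).symm.toLinearMap :=
  ⟨_, _, _, (hX.exists_point y t).choose_spec.choose_spec.choose_spec.1,
    (hX.exists_point y t).choose_spec.choose_spec.choose_spec.2, rfl⟩

variable {N}

lemma ofPoints_pull_point (hN : ∀ {z z' : X.obj} (hz : Subsingleton (X.p.obj z))
    (hz' : Subsingleton (X.p.obj z')) (f : z ⟶ z'), (N z' hz').pull f = N z hz)
    {z : X.obj} (hz : Subsingleton (X.p.obj z)) (φ : z ⟶ y) :
    (ofPoints hX N y).pull φ = N z hz := by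
  rw [pull_eq_iff]
  intro a
  obtain ⟨z', φ', s', hs', hst', h⟩ := ofPoints_spec hX N y (X.p.map φ (E.proj.app z a))
  obtain ⟨χ, hχ, rfl⟩ := hX.exists_factor_point φ' φ (E.proj.app z a) s' hst'
  have h1 := congrArg Fib.val (LinearMap.congr_fun h ⟨_, E.proj_map _ a⟩)
  rw [← tot_val] at h1
  change _ = F.total.map φ' (N z' hs' s' ((E.mapFib φ' hst').symm _)).val at h1
  have h2 : (E.mapFib φ' hst').symm ⟨_, E.proj_map (χ ≫ φ') a⟩ =
      ⟨E.total.map χ a, (E.proj_map χ a).trans hχ⟩ := by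
    rw [LinearEquiv.symm_apply_eq]
    exact Fib.ext (E.map_comp_apply χ φ' a)
  rw [h1, h2, ← tot_val, map_comp_apply, ← hN hz hs' χ, map_tot_pull]

lemma ofPoints_pull (hN : ∀ {z z' : X.obj} (hz : Subsingleton (X.p.obj z))
    (hz' : Subsingleton (X.p.obj z')) (f : z ⟶ z'), (N z' hz').pull f = N z hz) (f : x ⟶ y) :
    (ofPoints hX N y).pull f = ofPoints hX N x :=
  ext_point hX fun z φ hz => by
    rw [← pull_comp, ofPoints_pull_point hX hN hz, ofPoints_pull_point hX hN hz]

end FibHom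

end VectorBundle

/-! ### Étale presentations and slices -/

/-- An étale presentation of a stack with separated and proper diagonal, together with a paracompact
Hausdorff quotient `B` of the atlas by the equivalence relation given by the groupoid `R`.

The arrows of the groupoid are the universal span `x₀ ⟵ R ⟶ x₀`.  The quotient map `q` is given on
the base of every object, compatibly with pullback.  In place of the coarse space, which may lie in
a larger universe, any space `B` with the listed properties is allowed. -/
structure Presentation (X : BasedCategory.{v, w} TopCat.{u}) where
  isFibered : IsFibered X
  x₀ : X.obj
  atlas : IsEtaleAtlas X x₀
  R : X.obj
  a : R ⟶ x₀
  b : R ⟶ x₀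
  span : ∀ (t : X.obj) (a₁ b₁ : t ⟶ x₀), ∃! m : t ⟶ R, m ≫ a = a₁ ∧ m ≫ b = b₁
  isLocalHomeomorph : IsLocalHomeomorph (X.p.map b)
  isSeparatedMap : IsSeparatedMap fun r => (X.p.map a r, X.p.map b r)
  isProperMap : IsProperMap fun r => (X.p.map a r, X.p.map b r)
  B : Type u
  [topologicalSpace : TopologicalSpace B]
  [t2Space : T2Space B]
  [paracompactSpace : ParacompactSpace B]
  q : ∀ y : X.obj, X.p.obj y → B
  continuous_q : ∀ y, Continuous (q y)
  q_map : ∀ {x y : X.obj} (f : x ⟶ y) (t : X.p.obj x), q y (X.p.map f t) = q x t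
  isOpenMap_q : IsOpenMap (q x₀)
  surjective_q : Function.Surjective (q x₀)
  exists_of_q_eq : ∀ s t : X.p.obj x₀, q x₀ s = q x₀ t →
    ∃ r : X.p.obj R, X.p.map a r = s ∧ X.p.map b r = t

namespace Presentation

attribute [instance] topologicalSpace t2Space paracompactSpace

variable {X : BasedCategory.{v, w} TopCat.{u}} (P : Presentation X)

/-- The arrow of the groupoid given by two morphisms to the atlas. -/
lemma exists_span {z : X.obj} (k k' : z ⟶ P.x₀) : ∃ m : z ⟶ P.R, m ≫ P.a = k ∧ m ≫ P.b = k' :=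
  (P.span z k k').exists

lemma span_ext {z : X.obj} {m m' : z ⟶ P.R} (h : m ≫ P.a = m' ≫ P.a) (h' : m ≫ P.b = m' ≫ P.b) :
    m = m' :=
  (P.span z _ _).unique ⟨h, h'⟩ ⟨rfl, rfl⟩

/-- The unit of the groupoid. -/
def unit : P.x₀ ⟶ P.R := (P.exists_span (𝟙 _) (𝟙 _)).choose

@[simp]
lemma unit_a : P.unit ≫ P.a = 𝟙 _ := (P.exists_span (𝟙 _) (𝟙 _)).choose_spec.1

@[simp]
lemma unit_b : P.unit ≫ P.b = 𝟙 _ := (P.exists_span (𝟙 _) (𝟙 _)).choose_spec.2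

lemma a_unit (t : X.p.obj P.x₀) : X.p.map P.a (X.p.map P.unit t) = t := by
  rw [← p_comp, unit_a, p_id]

lemma b_unit (t : X.p.obj P.x₀) : X.p.map P.b (X.p.map P.unit t) = t := by
  rw [← p_comp, unit_b, p_id]

/-- Morphisms from a point of `y` to the atlas extend to a neighborhood. -/
lemma exists_extend_arrow {y z : X.obj} [Subsingleton (X.p.obj z)] (φ : z ⟶ y) (s : X.p.obj z)
    (k : z ⟶ P.x₀) : ∃ (y' : X.obj) (ψ : y' ⟶ y) (k' : y' ⟶ P.x₀) (χ : z ⟶ y'),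
      IsOpenEmbedding (X.p.map ψ) ∧ χ ≫ ψ = φ ∧ χ ≫ k' = k := by
  obtain ⟨c, a', b', hu, hl, -⟩ := P.atlas y
  obtain ⟨m, ⟨hma, hmb⟩, -⟩ := hu z k φ
  let σ := hl.localInverseAt (X.p.map m s)
  have hbm : X.p.map b' (X.p.map m s) = X.p.map φ s := by rw [← p_comp, hmb]
  obtain ⟨y', ψ, hψ, hr⟩ := P.isFibered.exists_restrict y σ.source
  have hmem : ∀ t, X.p.map ψ t ∈ σ.source := fun t => hr ▸ mem_range_self t
  obtain ⟨χ', ⟨h1, h2⟩, -⟩ := P.isFibered.cart b' ψ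
    (TopCat.ofHom ⟨fun t => σ (X.p.map ψ t), σ.continuousOn.comp_continuous (p_continuous ψ) hmem⟩)
    (by ext t; exact hl.apply_localInverseAt_of_mem (hmem t))
  have hs : X.p.map φ s ∈ σ.source := by
    rw [← hbm]
    exact hl.apply_self_mem_localInverseAt_source
  obtain ⟨χ, hχ⟩ := P.isFibered.exists_factor ψ hψ φ fun t => by
    rw [hr, Subsingleton.elim t s]
    exact hs
  refine ⟨y', ψ, χ' ≫ a', χ, ⟨hψ, hr ▸ σ.open_source⟩, hχ, ?_⟩
  have : χ ≫ χ' = m := by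
    refine P.isFibered.hom_ext_point b' s ?_ ?_
    · rw [p_comp, h1]
      change σ (X.p.map ψ (X.p.map χ s)) = _
      rw [← p_comp, hχ, ← hbm]
      exact hl.localInverseAt_apply_self
    · rw [Category.assoc, h2, hχ, hmb]
  rw [← Category.assoc, this, hma]

/-- A slice of order `n`: an open subset `V` of the atlas such that every point of the stack that
has an arrow to `V` has precisely `n` of them, and such that the non-identity arrows within `V`
form a closed and open subset. -/
structure IsSlice (V : Set (X.p.obj P.x₀)) (n : ℕ) : Prop where
  isOpen : IsOpen V
  pos : 0 < n
  card : ∀ {z : X.obj} (_ : Subsingleton (X.p.obj z)) (s : X.p.obj z) (k : z ⟶ P.x₀),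
    X.p.map k s ∈ V → Nat.card {k' : z ⟶ P.x₀ // X.p.map k' s ∈ V} = n
  distinct : ∃ D : Set (X.p.obj P.R), IsOpen D ∧ ∀ r, X.p.map P.a r ∈ V → X.p.map P.b r ∈ V →
    (r ∈ D ↔ r ∉ range (X.p.map P.unit))

/-- The isotropy group of a point is finite, and its elements have disjoint neighborhoods. -/
lemma exists_isotropy_neighborhoods (t : X.p.obj P.x₀) :
    ∃ (T : Set (X.p.obj P.R)) (W : T → Set (X.p.obj P.R)), T.Finite ∧
      (∀ r, r ∈ T ↔ X.p.map P.a r = t ∧ X.p.map P.b r = t) ∧ (∀ i, IsOpen (W i) ∧ i.1 ∈ W i) ∧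
      (∀ i, InjOn (X.p.map P.b) (W i)) ∧ Pairwise (Function.onFun Disjoint W) := by
  classical
  let T : Set (X.p.obj P.R) := {r | X.p.map P.a r = t ∧ X.p.map P.b r = t}
  have hinj : ∀ r : X.p.obj P.R, ∃ N : Set (X.p.obj P.R), IsOpen N ∧ r ∈ N ∧
      InjOn (X.p.map P.b) N := fun r => by
    obtain ⟨e, he, hb⟩ := P.isLocalHomeomorph r
    exact ⟨e.source, e.open_source, he, hb ▸ e.injOn⟩
  choose N hNo hN hNi using hinj
  have hTc : IsCompact T := by
    have := P.isProperMap.isCompact_preimage (isCompact_singleton (x := (t, t)))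
    convert this using 1
    ext r
    simp [T]
  have hT : T.Finite := by
    obtain ⟨F, hF⟩ := hTc.elim_nhds_subcover' (fun r _ => N r) fun r _ => (hNo r).mem_nhds (hN r)
    refine (F.finite_toSet.biUnion (t := fun r => N r.1 ∩ T) fun r _ => ?_).subset fun r hr => ?_
    · exact Set.Subsingleton.finite fun r₁ h₁ r₂ h₂ =>
        hNi r h₁.1 h₂.1 (h₁.2.2.trans h₂.2.2.symm)
    · obtain ⟨r', hr', h⟩ := mem_iUnion₂.1 (hF hr)
      exact mem_iUnion₂.2 ⟨r', hr', h, hr⟩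
  have : Fintype T := hT.fintype
  have hsep : ∀ i j : T, ∃ A C : Set (X.p.obj P.R), IsOpen A ∧ IsOpen C ∧ i.1 ∈ A ∧ j.1 ∈ C ∧
      (i ≠ j → Disjoint A C) := fun i j => by
    by_cases h : i = j
    · exact ⟨univ, univ, isOpen_univ, isOpen_univ, trivial, trivial, fun h' => (h' h).elim⟩
    · obtain ⟨A, C, hA, hC, hi, hj, hd⟩ := P.isSeparatedMap i.1 j.1
        (Prod.ext (i.2.1.trans j.2.1.symm) (i.2.2.trans j.2.2.symm)) fun h' => h (Subtype.ext h')
      exact ⟨A, C, hA, hC, hi, hj, fun _ => hd⟩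
  choose A C hA hC hi hj hd using hsep
  refine ⟨T, fun i => N i ∩ ((⋂ j, A i j) ∩ ⋂ j, C j i), hT, fun r => Iff.rfl, fun i => ⟨?_, ?_⟩,
    fun i => (hNi i).mono inter_subset_left, fun i j hij => ?_⟩
  · exact (hNo i).inter ((isOpen_iInter_of_finite fun j => hA i j).inter
      (isOpen_iInter_of_finite fun j => hC j i))
  · exact ⟨hN i, mem_iInter.2 fun j => hi i j, mem_iInter.2 fun j => hj j i⟩
  · refine (hd i j hij).mono ?_ ?_
    · exact fun r hr => mem_iInter.1 hr.2.1 j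
    · exact fun r hr => mem_iInter.1 hr.2.2 i

/-- Every point `t` of the atlas has arbitrarily small slices.  If `V` is small then an arrow within
`V` is close to precisely one element of the isotropy group of `t`, by which it may be labelled. The
slice `V'` consists of the points of `V` which have an incoming arrow with every label, so that its
order is that of the isotropy group. -/
lemma exists_isSlice (t : X.p.obj P.x₀) {O : Set (X.p.obj P.x₀)} (hO : IsOpen O) (ht : t ∈ O) :
    ∃ V ⊆ O, t ∈ V ∧ ∃ n, P.IsSlice V n := by
  classical
  obtain ⟨T, W, hT, hTt, hW, hWi, hWd⟩ := P.exists_isotropy_neighborhoods t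
  have : Finite T := hT
  let i₀ : T := ⟨X.p.map P.unit t, (hTt _).2 ⟨P.a_unit t, P.b_unit t⟩⟩
  -- by properness, arrows within a small neighborhood of `t` are close to isotropy elements
  obtain ⟨V₁, hV₁, htV₁, hVW⟩ : ∃ V₁ : Set (X.p.obj P.x₀), IsOpen V₁ ∧ t ∈ V₁ ∧
      ∀ r, X.p.map P.a r ∈ V₁ → X.p.map P.b r ∈ V₁ → ∃ i, r ∈ W i := by
    have hcl := P.isProperMap.isClosedMap _
      (isOpen_iUnion fun i => (hW i).1).isClosed_compl
    have hmem : (t, t) ∉ (fun r => (X.p.map P.a r, X.p.map P.b r)) '' (⋃ i, W i)ᶜ := by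
      rintro ⟨r, hr, hrt⟩
      have hrT : r ∈ T := (hTt r).2 ⟨congrArg Prod.fst hrt, congrArg Prod.snd hrt⟩
      exact hr (mem_iUnion.2 ⟨⟨r, hrT⟩, (hW ⟨r, hrT⟩).2⟩)
    obtain ⟨A, C, hA, hC, h1, h2, h3⟩ := isOpen_prod_iff.1 hcl.isOpen_compl t t hmem
    refine ⟨A ∩ C, hA.inter hC, ⟨h1, h2⟩, fun r ha hb => ?_⟩
    by_contra hr
    exact h3 (mk_mem_prod ha.1 hb.2) ⟨r, fun h => hr (mem_iUnion.1 h), rfl⟩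
  let V := (V₁ ∩ O) ∩ X.p.map P.unit ⁻¹' W i₀
  have hV : IsOpen V := (hV₁.inter hO).inter ((hW i₀).1.preimage (p_continuous _))
  have htV : t ∈ V := ⟨⟨htV₁, ht⟩, (hW i₀).2⟩
  have hlabel : ∀ r, X.p.map P.a r ∈ V → X.p.map P.b r ∈ V → ∃ i, r ∈ W i :=
    fun r ha hb => hVW r ha.1.1 hb.1.1
  let V' := V ∩ ⋂ i, X.p.map P.b '' (W i ∩ X.p.map P.a ⁻¹' V)
  refine ⟨V', fun s hs => hs.1.1.2, ⟨htV, mem_iInter.2 fun i => ?_⟩, Nat.card T,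
    ⟨?_, ?_, ?_, ?_⟩⟩
  · refine ⟨i.1, ⟨(hW i).2, ?_⟩, ((hTt i.1).1 i.2).2⟩
    rw [mem_preimage, ((hTt i.1).1 i.2).1]
    exact htV
  · exact hV.inter (isOpen_iInter_of_finite fun i =>
      P.isLocalHomeomorph.isOpenMap _ ((hW i).1.inter (hV.preimage (p_continuous _))))
  · exact Nat.card_pos_iff.2 ⟨⟨i₀⟩, inferInstance⟩
  · intro z hz s k₀ hk₀
    -- the label of the arrow between two points of `V` given by maps from `z`
    let S := {k : z ⟶ P.x₀ // X.p.map k s ∈ V}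
    have hlab : ∀ κ k : S, ∃ i, ∃ m : z ⟶ P.R, m ≫ P.a = k ∧ m ≫ P.b = κ ∧ X.p.map m s ∈ W i := by
      intro κ k
      obtain ⟨m, hma, hmb⟩ := P.exists_span k.1 κ.1
      obtain ⟨i, hi⟩ := hlabel (X.p.map m s) (by rw [← p_comp, hma]; exact k.2)
        (by rw [← p_comp, hmb]; exact κ.2)
      exact ⟨i, m, hma, hmb, hi⟩
    choose lab m hma hmb hm using hlab
    have hinj : ∀ κ, Function.Injective (lab κ) := fun κ k k' h => by
      have hm' := hm κ k'
      rw [← h] at hm'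
      have : X.p.map (m κ k) s = X.p.map (m κ k') s := by
        refine hWi _ (hm κ k) hm' ?_
        rw [← p_comp, ← p_comp, hmb, hmb]
      have : m κ k = m κ k' :=
        P.isFibered.hom_ext_point P.b s this (by rw [hmb, hmb])
      exact Subtype.ext (by rw [← hma κ k, ← hma κ k', this])
    have hsurj : ∀ κ, X.p.map κ.1 s ∈ V' → Function.Surjective (lab κ) := fun κ hκ i => by
      obtain ⟨r, ⟨hrW, hrV⟩, hr⟩ := mem_iInter.1 hκ.2 i
      obtain ⟨n, hn, hnb⟩ := P.isFibered.exists_factor_point P.b κ.1 s r hr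
      have hk : X.p.map (n ≫ P.a) s ∈ V := by rw [p_comp, hn]; exact hrV
      refine ⟨⟨n ≫ P.a, hk⟩, ?_⟩
      have hmn : m κ ⟨n ≫ P.a, hk⟩ = n := P.span_ext (hma _ _) ((hmb _ _).trans hnb.symm)
      by_contra hne
      have h1 := hm κ ⟨n ≫ P.a, hk⟩
      rw [hmn, hn] at h1
      exact (hWd hne).le_bot ⟨h1, hrW⟩
    have hk₀V : X.p.map k₀ s ∈ V := hk₀.1
    have e := Equiv.ofBijective (lab ⟨k₀, hk₀V⟩) ⟨hinj _, hsurj ⟨k₀, hk₀V⟩ hk₀⟩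
    -- `V'` is saturated in `V`: an injective labelling by a finite set of the right size is onto
    have hSV : ∀ k : z ⟶ P.x₀, X.p.map k s ∈ V' ↔ X.p.map k s ∈ V := fun k => by
      refine ⟨fun h => h.1, fun h => ⟨h, mem_iInter.2 fun i => ?_⟩⟩
      have hs : Function.Surjective (lab ⟨k, h⟩) := by
        have : Function.Surjective (lab ⟨k, h⟩ ∘ e.symm) :=
          Finite.injective_iff_surjective.1 ((hinj _).comp e.symm.injective)
        exact this.of_comp
      obtain ⟨k', rfl⟩ := hs i
      refine ⟨X.p.map (m ⟨k, h⟩ k') s, ⟨hm _ _, ?_⟩, ?_⟩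
      · rw [mem_preimage, ← p_comp, hma]
        exact k'.2
      · rw [← p_comp, hmb]
    exact (Nat.card_congr (Equiv.subtypeEquivRight hSV)).trans (Nat.card_congr e)
  -- an arrow within `V'` is a unit iff it is labelled by the unit at `t`
  · refine ⟨⋃ i, ⋃ (_ : i ≠ i₀), W i, isOpen_iUnion fun i => isOpen_iUnion fun _ => (hW i).1,
      fun r ha hb => ⟨?_, ?_⟩⟩
    · rintro hr ⟨s, rfl⟩
      obtain ⟨i, hi, hsi⟩ := mem_iUnion₂.1 hr
      rw [b_unit] at hb
      exact (hWd hi).le_bot ⟨hsi, hb.1.2⟩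
    · intro hr
      obtain ⟨i, hi⟩ := hlabel r ha.1 hb.1
      refine mem_iUnion₂.2 ⟨i, ?_, hi⟩
      rintro rfl
      exact hr ⟨X.p.map P.b r, hWi i₀ hb.1.2 hi (P.b_unit _)⟩

end Presentation

namespace Presentation

variable {X : BasedCategory.{v, w} TopCat.{u}} (P : Presentation X)

/-- Points with the same image in the quotient are isomorphic. -/
lemma exists_arrow {z : X.obj} [Subsingleton (X.p.obj z)] (s : X.p.obj z) (t : X.p.obj P.x₀)
    (h : P.q P.x₀ t = P.q z s) : ∃ k : z ⟶ P.x₀, X.p.map k s = t := by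
  obtain ⟨c, a', b', -, -, hs⟩ := P.atlas z
  obtain ⟨r, hr⟩ := hs s
  obtain ⟨m, hm, hm'⟩ := P.isFibered.exists_factor_point b' (𝟙 z) s r (by rw [hr, p_id])
  obtain ⟨r', hr₁, hr₂⟩ := P.exists_of_q_eq t (X.p.map (m ≫ a') s) (by rw [h, P.q_map])
  obtain ⟨n, hn, -⟩ := P.isFibered.exists_factor_point P.b (m ≫ a') s r' hr₂
  exact ⟨n ≫ P.a, by rw [p_comp, hn, hr₁]⟩

/-- Two morphisms to the atlas agree at a point iff the corresponding arrow is a unit. -/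
lemma comp_eq_comp_iff {y z : X.obj} [Subsingleton (X.p.obj z)] (m : y ⟶ P.R) (χ : z ⟶ y)
    (s : X.p.obj z) : χ ≫ m ≫ P.a = χ ≫ m ≫ P.b ↔
      X.p.map m (X.p.map χ s) ∈ range (X.p.map P.unit) := by
  constructor
  · intro h
    have : χ ≫ m = (χ ≫ m ≫ P.b) ≫ P.unit := P.span_ext
      (by rw [Category.assoc, Category.assoc, unit_a, Category.comp_id, h])
      (by rw [Category.assoc, Category.assoc, unit_b, Category.comp_id])
    rw [← p_comp, this, p_comp]
    exact mem_range_self _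
  · rintro ⟨t, ht⟩
    obtain ⟨κ, -, hκ⟩ := P.isFibered.exists_factor_point P.unit (χ ≫ m) s t (by rw [ht, p_comp])
    rw [← Category.assoc, ← Category.assoc, ← hκ, Category.assoc, Category.assoc, unit_a, unit_b]

namespace IsSlice

variable {P} {V : Set (X.p.obj P.x₀)} {n : ℕ} (hV : P.IsSlice V n)
include hV

lemma t2Space : T2Space V := by
  obtain ⟨D, hD, hDr⟩ := hV.distinct
  refine ⟨fun s t hst => ?_⟩
  have hcl := P.isProperMap.isClosedMap _ hD.isClosed_compl
  have hmem : (s.1, t.1) ∉ (fun r => (X.p.map P.a r, X.p.map P.b r)) '' Dᶜ := by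
    rintro ⟨r, hr, hrst⟩
    have ha : X.p.map P.a r = s.1 := congrArg Prod.fst hrst
    have hb : X.p.map P.b r = t.1 := congrArg Prod.snd hrst
    have h := (hDr r (ha ▸ s.2) (hb ▸ t.2)).not.1 hr
    obtain ⟨x, rfl⟩ := not_not.1 h
    rw [a_unit] at ha
    rw [b_unit] at hb
    exact hst (Subtype.ext (ha.symm.trans hb))
  obtain ⟨A, C, hA, hC, hs, ht, hAC⟩ := isOpen_prod_iff.1 hcl.isOpen_compl s.1 t.1 hmem
  refine ⟨Subtype.val ⁻¹' A, Subtype.val ⁻¹' C, hA.preimage continuous_subtype_val,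
    hC.preimage continuous_subtype_val, hs, ht, ?_⟩
  rw [Set.disjoint_left]
  intro x hxA hxC
  refine hAC (mk_mem_prod hxA hxC) ⟨X.p.map P.unit x.1, ?_, by simp [a_unit, b_unit]⟩
  have := hDr (X.p.map P.unit x.1) (by rw [a_unit]; exact x.2) (by rw [b_unit]; exact x.2)
  exact this.not.2 (not_not.2 (mem_range_self _))

lemma finite {z : X.obj} (hz : Subsingleton (X.p.obj z)) (s : X.p.obj z) :
    Finite {k : z ⟶ P.x₀ // X.p.map k s ∈ V} := by
  by_cases h : ∃ k : z ⟶ P.x₀, X.p.map k s ∈ V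
  · obtain ⟨k, hk⟩ := h
    exact Nat.finite_of_card_ne_zero (by rw [hV.card hz s k hk]; exact hV.pos.ne')
  · have : IsEmpty {k : z ⟶ P.x₀ // X.p.map k s ∈ V} := ⟨fun k => h ⟨k.1, k.2⟩⟩
    infer_instance

/-- Near a point that has arrows to a slice, these arrows vary continuously. -/
lemma exists_enumeration (y : X.obj) (t : X.p.obj y) (ht : P.q y t ∈ P.q P.x₀ '' V) :
    ∃ (y' : X.obj) (ψ : y' ⟶ y) (k : Fin n → (y' ⟶ P.x₀)), IsOpenEmbedding (X.p.map ψ) ∧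
      t ∈ range (X.p.map ψ) ∧ (∀ i t', X.p.map (k i) t' ∈ V) ∧
      ∀ {z : X.obj} (_ : Subsingleton (X.p.obj z)) (χ : z ⟶ y') (s : X.p.obj z)
        (l : z ⟶ P.x₀), X.p.map l s ∈ V → ∃! i, χ ≫ k i = l := by
  classical
  obtain ⟨z, φ, s, hz, rfl⟩ := P.isFibered.exists_point y t
  obtain ⟨v, hv, hvt⟩ := ht
  rw [P.q_map] at hvt
  obtain ⟨k₀, rfl⟩ := P.exists_arrow s v hvt
  have hcard := hV.card hz s k₀ hv
  have := hV.finite hz s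
  let e : {k : z ⟶ P.x₀ // X.p.map k s ∈ V} ≃ Fin n :=
    (Finite.equivFin _).trans (finCongr hcard)
  choose c ψ l χ hψ hχ hl using fun i => P.exists_extend_arrow φ s (e.symm i).1
  -- first restrict to a neighborhood where all the arrows are defined
  obtain ⟨y₁, ψ₁, hψ₁, hr₁⟩ := P.isFibered.exists_restrict y (⋂ i, range (X.p.map (ψ i)))
  have ho₁ : IsOpen (range (X.p.map ψ₁)) :=
    hr₁ ▸ isOpen_iInter_of_finite fun i => (hψ i).isOpen_range
  have hf : ∀ i, ∃ ρ : y₁ ⟶ c i, ρ ≫ ψ i = ψ₁ := fun i =>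
    P.isFibered.exists_factor (ψ i) (hψ i).isEmbedding ψ₁ fun t' =>
      mem_iInter.1 (hr₁ ▸ mem_range_self t' : X.p.map ψ₁ t' ∈ ⋂ i, range (X.p.map (ψ i))) i
  choose ρ hρ using hf
  obtain ⟨χ₁, hχ₁⟩ := P.isFibered.exists_factor ψ₁ hψ₁ φ fun s' => by
    rw [hr₁, mem_iInter]
    intro i
    rw [← hχ i, p_comp]
    exact mem_range_self _
  have hχρ : ∀ i, χ₁ ≫ ρ i = χ i := fun i => by
    refine P.isFibered.hom_ext_point (ψ i) s ((hψ i).injective ?_) ?_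
    · rw [← p_comp, ← p_comp, Category.assoc, hρ, hχ₁, hχ]
    · rw [Category.assoc, hρ, hχ₁, hχ]
  have hχl : ∀ i, χ₁ ≫ ρ i ≫ l i = (e.symm i).1 := fun i => by
    rw [← Category.assoc, hχρ, hl]
  -- then restrict to a neighborhood where they stay in `V` and distinct
  choose m hma hmb using fun i j => P.exists_span (ρ i ≫ l i) (ρ j ≫ l j)
  obtain ⟨D, hD, hDr⟩ := hV.distinct
  let O : Set (X.p.obj y₁) := (⋂ i, X.p.map (ρ i ≫ l i) ⁻¹' V) ∩
    ⋂ i, ⋂ j, {t' | i ≠ j → X.p.map (m i j) t' ∈ D}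
  have hO : IsOpen O := by
    refine (isOpen_iInter_of_finite fun i => hV.isOpen.preimage (p_continuous _)).inter
      (isOpen_iInter_of_finite fun i => isOpen_iInter_of_finite fun j => ?_)
    by_cases hij : i = j
    · simp [hij]
    · simp only [ne_eq, hij, not_false_eq_true, forall_const]
      exact hD.preimage (p_continuous (m i j))
  have hVi : ∀ i, X.p.map (ρ i ≫ l i) (X.p.map χ₁ s) ∈ V := fun i => by
    rw [← p_comp, hχl]
    exact (e.symm i).2
  have htO : X.p.map χ₁ s ∈ O := by
    refine ⟨mem_iInter.2 hVi, mem_iInter₂.2 fun i j hij => ?_⟩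
    refine (hDr _ ?_ ?_).2 ?_
    · rw [← p_comp, hma]; exact hVi i
    · rw [← p_comp, hmb]; exact hVi j
    · rw [← P.comp_eq_comp_iff (m i j) χ₁ s, hma, hmb, hχl, hχl]
      exact fun h => hij (e.symm.injective (Subtype.ext h))
  obtain ⟨y', ψ', hψ', hr'⟩ := P.isFibered.exists_restrict y₁ O
  have hmem : ∀ t', X.p.map ψ' t' ∈ O := fun t' => hr' ▸ mem_range_self t'
  have hψO : IsOpenEmbedding (X.p.map (ψ' ≫ ψ₁)) := by
    have : (X.p.map (ψ' ≫ ψ₁) : X.p.obj y' → X.p.obj y) = X.p.map ψ₁ ∘ X.p.map ψ' :=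
      funext fun t' => p_comp ψ' ψ₁ t'
    rw [this]
    exact (IsOpenEmbedding.mk hψ₁ ho₁).comp ⟨hψ', hr' ▸ hO⟩
  have hkV : ∀ i t', X.p.map (ψ' ≫ ρ i ≫ l i) t' ∈ V := fun i t' => by
    rw [p_comp]
    exact mem_iInter.1 (hmem t').1 i
  refine ⟨y', ψ' ≫ ψ₁, fun i => ψ' ≫ ρ i ≫ l i, hψO, ?_, hkV, ?_⟩
  · obtain ⟨t', ht'⟩ : X.p.map χ₁ s ∈ range (X.p.map ψ') := hr' ▸ htO
    exact ⟨t', by rw [p_comp, ht', ← p_comp, hχ₁]⟩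
  · intro z' hz' χ' s' l' hl'
    have := hV.finite hz' s'
    let g : Fin n → {k : z' ⟶ P.x₀ // X.p.map k s' ∈ V} := fun i =>
      ⟨χ' ≫ ψ' ≫ ρ i ≫ l i, by rw [p_comp]; exact hkV i _⟩
    have hg : Function.Injective g := fun i j hij => by
      by_contra hne
      have h1 : (χ' ≫ ψ') ≫ m i j ≫ P.a = (χ' ≫ ψ') ≫ m i j ≫ P.b := by
        rw [hma, hmb, Category.assoc, Category.assoc]
        exact congrArg Subtype.val hij
      rw [P.comp_eq_comp_iff _ _ s', p_comp] at h1
      have h2 := hmem (X.p.map χ' s')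
      refine (hDr _ ?_ ?_).1 (mem_iInter₂.1 h2.2 i j hne) h1
      · rw [← p_comp, hma]; exact mem_iInter.1 h2.1 i
      · rw [← p_comp, hmb]; exact mem_iInter.1 h2.1 j
    have hb : Function.Bijective g :=
      (Nat.bijective_iff_injective_and_card g).2 ⟨hg, by rw [hV.card hz' s' l' hl', Nat.card_fin]⟩
    obtain ⟨i, hi⟩ := hb.2 ⟨l', hl'⟩
    exact ⟨i, congrArg Subtype.val hi, fun j hj => hb.1 (Subtype.ext (hj.trans
      (congrArg Subtype.val hi).symm))⟩

/-- The part of a slice over a closed set contained in its image is a normal space: its map to that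
closed subset of the paracompact space `B` is proper. -/
lemma normalSpace {N : Set P.B} (hN : IsClosed N) (hNV : N ⊆ P.q P.x₀ '' V) :
    NormalSpace {t : X.p.obj P.x₀ // t ∈ V ∧ P.q P.x₀ t ∈ N} := by
  have : T2Space V := hV.t2Space
  have hi : IsEmbedding fun t : {t : X.p.obj P.x₀ // t ∈ V ∧ P.q P.x₀ t ∈ N} =>
      (⟨t.1, t.2.1⟩ : V) :=
    IsEmbedding.of_comp (by fun_prop) continuous_subtype_val IsEmbedding.subtypeVal
  have : T2Space {t : X.p.obj P.x₀ // t ∈ V ∧ P.q P.x₀ t ∈ N} := hi.t2Space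
  have : ParacompactSpace N := hN.isClosedEmbedding_subtypeVal.paracompactSpace
  let f : {t : X.p.obj P.x₀ // t ∈ V ∧ P.q P.x₀ t ∈ N} → N := fun t => ⟨P.q P.x₀ t.1, t.2.2⟩
  have hf : Continuous f := by
    have := P.continuous_q P.x₀
    fun_prop
  have hproper : IsProperMap f := by
    refine isProperMap_iff_isClosedMap_and_compact_fibers.2 ⟨hf, ?_, ?_⟩
    · intro K hK
      obtain ⟨K', hK', rfl⟩ := isClosed_induced_iff.1 hK
      rw [← isOpen_compl_iff, isOpen_iff_mem_nhds]
      rintro ⟨ξ, hξ⟩ hξK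
      obtain ⟨v, hv, rfl⟩ := hNV hξ
      obtain ⟨y', ψ, k, hψ, ⟨t, rfl⟩, hkV, hk⟩ := hV.exists_enumeration P.x₀ v ⟨v, hv, rfl⟩
      have hqk : ∀ i t', P.q P.x₀ (X.p.map (k i) t') = P.q P.x₀ (X.p.map ψ t') := fun i t' => by
        rw [P.q_map, P.q_map]
      let O : Set (X.p.obj y') := ⋂ i, X.p.map (k i) ⁻¹' K'ᶜ
      have hO : IsOpen O :=
        isOpen_iInter_of_finite fun i => hK'.isOpen_compl.preimage (p_continuous _)
      have htO : t ∈ O := mem_iInter.2 fun i hi =>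
        hξK ⟨⟨X.p.map (k i) t, hkV i t, by rw [hqk]; exact hξ⟩, hi, Subtype.ext (hqk i t)⟩
      have hM : IsOpen (P.q P.x₀ '' (X.p.map ψ '' O)) :=
        P.isOpenMap_q _ (hψ.isOpenMap _ hO)
      filter_upwards [(hM.preimage continuous_subtype_val).mem_nhds
        ⟨_, ⟨t, htO, rfl⟩, rfl⟩] with ξ' hξ'
      rintro ⟨w, hwK, rfl⟩
      obtain ⟨_, ⟨t', ht', rfl⟩, hq⟩ := hξ'
      obtain ⟨z, χ, s, hz, rfl⟩ := P.isFibered.exists_point y' t'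
      obtain ⟨l, hl⟩ := P.exists_arrow s w.1 (by
        rw [show P.q P.x₀ w.1 = P.q P.x₀ _ from hq.symm, P.q_map, P.q_map])
      obtain ⟨i, hi, -⟩ := hk hz χ s l (by rw [hl]; exact w.2.1)
      refine mem_iInter.1 ht' i ?_
      rw [← p_comp, hi, hl]
      exact hwK
    · rintro ⟨ξ, hξ⟩
      obtain ⟨v, hv, rfl⟩ := hNV hξ
      obtain ⟨z, φ, s, hz, rfl⟩ := P.isFibered.exists_point P.x₀ v
      have := hV.finite hz s
      refine Set.Finite.isCompact ?_
      have hfin := (finite_range fun k : {k : z ⟶ P.x₀ // X.p.map k s ∈ V} => X.p.map k.1 s)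
      refine (hfin.preimage (f := Subtype.val) Subtype.val_injective.injOn).subset ?_
      intro w hw
      obtain ⟨l, hl⟩ := P.exists_arrow s w.1 ((congrArg Subtype.val hw).trans (P.q_map φ s))
      exact ⟨⟨l, by rw [hl]; exact w.2.1⟩, hl⟩
  have := paracompactSpace_of_isProperMap hproper
  infer_instance

end IsSlice

end Presentation

namespace VectorBundle

variable {X : BasedCategory.{v, w} TopCat.{u}} {E F : VectorBundle X} (P : Presentation X)

/-! ### Averaging over a slice -/

namespace FibHom

lemma map_tot_apply {x y : X.obj} (M : FibHom E F y) (f : x ⟶ y) {s : X.p.obj x} {t : X.p.obj y}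
    (h : X.p.map f s = t) (a : E.Fib x s) :
    F.mapFib f h (M.pull f s a) = M t (E.mapFib f h a) := by
  refine Fib.ext ?_
  rw [mapFib_val, ← tot_val, map_tot_pull, ← tot_val, mapFib_val]

/-- The average, over the arrows from a point to a slice `V`, of a family of linear maps given on
the atlas. -/
def average (V : Set (X.p.obj P.x₀)) (n : ℕ) (M : FibHom E F P.x₀) (z : X.obj) : FibHom E F z :=
  fun s => (n : ℂ)⁻¹ • ∑ᶠ k : {k : z ⟶ P.x₀ // X.p.map k s ∈ V}, M.pull k.1 s

variable {P} {V : Set (X.p.obj P.x₀)} {n : ℕ} (hV : P.IsSlice V n) (M : FibHom E F P.x₀)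

lemma average_eq_sum {z : X.obj} {ι : Type*} [Fintype ι]
    (k : ι → (z ⟶ P.x₀)) (s : X.p.obj z) (hk : ∀ i, X.p.map (k i) s ∈ V)
    (h : ∀ l : z ⟶ P.x₀, X.p.map l s ∈ V → ∃! i, k i = l) :
    average P V n M z s = (n : ℂ)⁻¹ • ∑ i, M.pull (k i) s := by
  have hb : Function.Bijective fun i => (⟨k i, hk i⟩ : {k : z ⟶ P.x₀ // X.p.map k s ∈ V}) := by
    refine Function.bijective_iff_existsUnique _ |>.2 fun l => ?_
    obtain ⟨i, hi, hi'⟩ := h l.1 l.2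
    exact ⟨i, Subtype.ext hi, fun j hj => hi' j (congrArg Subtype.val hj)⟩
  rw [average, ← finsum_eq_sum_of_fintype]
  congr 1
  exact (finsum_eq_of_bijective _ hb fun i => rfl).symm

include hV

lemma average_pull {z z' : X.obj} (hz : Subsingleton (X.p.obj z))
    (hz' : Subsingleton (X.p.obj z')) (f : z ⟶ z') :
    (average P V n M z').pull f = average P V n M z := by
  classical
  funext s
  have := hV.finite hz s
  have := hV.finite hz' (X.p.map f s)
  have := Fintype.ofFinite {k : z' ⟶ P.x₀ // X.p.map k (X.p.map f s) ∈ V}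
  obtain ⟨g, hfg, hgf⟩ := P.isFibered.exists_inverse_point f s
  rw [average_eq_sum (n := n) M (ι := {k : z' ⟶ P.x₀ // X.p.map k (X.p.map f s) ∈ V})
    (fun k => f ≫ k.1) s (fun k => by rw [p_comp]; exact k.2)]
  · have h := average_eq_sum (n := n) M (ι := {k : z' ⟶ P.x₀ // X.p.map k (X.p.map f s) ∈ V})
      (fun k => k.1) (X.p.map f s) (fun k => k.2)
      (fun l hl => ⟨⟨l, hl⟩, rfl, fun j hj => Subtype.ext hj⟩)
    refine LinearMap.ext fun a => (F.mapFib f rfl).injective ?_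
    rw [map_tot_apply, h, LinearMap.smul_apply, LinearMap.smul_apply, _root_.map_smul,
      LinearMap.sum_apply, LinearMap.sum_apply, map_sum]
    congr 1
    refine Finset.sum_congr rfl fun k _ => ?_
    rw [pull_comp, map_tot_apply]
  · intro l hl
    refine ⟨⟨g ≫ l, ?_⟩, ?_, ?_⟩
    · rw [← p_comp, ← Category.assoc, hfg, Category.id_comp]
      exact hl
    · change f ≫ g ≫ l = l
      rw [← Category.assoc, hfg, Category.id_comp]
    · rintro j rfl
      refine Subtype.ext ?_
      change j.1 = g ≫ f ≫ j.1
      rw [← Category.assoc, hgf, Category.id_comp]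

/-- The average is continuous where the given family is. -/
lemma average_contAt (y : X.obj) (t : X.p.obj y) (ht : P.q y t ∈ P.q P.x₀ '' V)
    (hM : ∀ v ∈ V, P.q P.x₀ v = P.q y t → M.ContAt v) :
    (ofPoints P.isFibered (fun z _ => average P V n M z) y).ContAt t := by
  obtain ⟨y', ψ, k, hψ, ⟨t', rfl⟩, hkV, hk⟩ := hV.exists_enumeration y t ht
  refine contAt_of_pull ψ hψ.isOpenMap ?_
  have hN := fun {z z' : X.obj} (hz : Subsingleton (X.p.obj z)) (hz' : Subsingleton (X.p.obj z'))
    (f : z ⟶ z') => average_pull hV M hz hz' f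
  have : (ofPoints P.isFibered (fun z _ => average P V n M z) y).pull ψ =
      scale (fun _ => (n : ℂ)⁻¹) (∑ i, M.pull (k i)) := by
    refine ext_point P.isFibered fun z χ hz => ?_
    rw [← pull_comp, ofPoints_pull_point P.isFibered hN hz, pull_scale, pull_sum]
    funext s
    rw [average_eq_sum M (fun i => χ ≫ k i) s (fun i => by rw [p_comp]; exact hkV i _)
      fun l hl => hk hz χ s l hl]
    simp [scale, pull_comp]
  rw [this]
  refine ContAt.scale continuousAt_const (ContAt.sum fun i _ => ContAt.pull _ (hM _ (hkV i t') ?_))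
  rw [P.q_map, P.q_map]

/-- If all pullbacks of the given family agree then they are equal to the average. -/
lemma average_eq_of_forall {z : X.obj} (hz : Subsingleton (X.p.obj z)) (s : X.p.obj z)
    (h : P.q z s ∈ P.q P.x₀ '' V) (L : E.Fib z s →ₗ[ℂ] F.Fib z s)
    (hL : ∀ k : z ⟶ P.x₀, X.p.map k s ∈ V → M.pull k s = L) : average P V n M z s = L := by
  have := hV.finite hz s
  have := Fintype.ofFinite {k : z ⟶ P.x₀ // X.p.map k s ∈ V}
  obtain ⟨v, hv, hvs⟩ := h
  obtain ⟨k₀, rfl⟩ := P.exists_arrow s v hvs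
  have hcard := hV.card hz s k₀ hv
  rw [average, finsum_eq_sum_of_fintype, Finset.sum_congr rfl fun k _ => hL k.1 k.2,
    Finset.sum_const, Finset.card_univ, ← Nat.card_eq_fintype_card, hcard, ← Nat.cast_smul_eq_nsmul ℂ,
    smul_smul, inv_mul_cancel₀ (Nat.cast_ne_zero.2 hV.pos.ne'), one_smul]

end FibHom

/-! ### Gluing with a partition of unity -/

/-- Natural families of linear maps which are continuous over the members of an open cover of the
quotient space may be glued to a homomorphism, which takes a given value wherever all of the
families do. -/
lemma exists_hom_of_local (M : P.B → ∀ y : X.obj, FibHom E F y) (O : P.B → Set P.B)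
    (hO : ∀ ξ, IsOpen (O ξ)) (hξ : ∀ ξ, ξ ∈ O ξ)
    (hM : ∀ ξ {x y : X.obj} (f : x ⟶ y), (M ξ y).pull f = M ξ x)
    (hc : ∀ ξ y t, P.q y t ∈ O ξ → (M ξ y).ContAt t) :
    ∃ h : Hom E F, ∀ y t (L : E.Fib y t →ₗ[ℂ] F.Fib y t),
      (∀ ξ, P.q y t ∈ O ξ → M ξ y t = L) → h.fib y t = L := by
  classical
  obtain ⟨χ, hχ⟩ := PartitionOfUnity.exists_isSubordinate (s := (univ : Set P.B)) isClosed_univ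
    O hO fun ξ _ => mem_iUnion.2 ⟨ξ, hξ ξ⟩
  let φ : P.B → P.B → ℂ := fun ξ η => (χ ξ η : ℂ)
  have hφ : ∀ ξ, Continuous (φ ξ) := fun ξ =>
    Complex.continuous_ofReal.comp (χ ξ).continuous
  have hfin : ∀ η, (Function.support fun ξ => φ ξ η).Finite := fun η =>
    (χ.locallyFinite.point_finite η).subset fun ξ hξ => by simpa [φ] using hξ
  have hsupp : ∀ y t, (Function.support fun ξ => φ ξ (P.q y t) • M ξ y t) ⊆
      Function.support fun ξ => φ ξ (P.q y t) := fun y t ξ h h0 => h (by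
    change φ ξ (P.q y t) • M ξ y t = 0
    rw [show φ ξ (P.q y t) = 0 from h0, zero_smul])
  let S : ∀ y, FibHom E F y := fun y t => ∑ᶠ ξ, φ ξ (P.q y t) • M ξ y t
  have hS : ∀ {x y : X.obj} (f : x ⟶ y), (S y).pull f = S x := fun {x y} f => by
    funext s
    refine LinearMap.ext fun a => (F.mapFib f rfl).injective ?_
    rw [FibHom.map_tot_apply]
    let F₀ : Finset P.B := (hfin (P.q x s)).toFinset
    have h1 : S x s = ∑ ξ ∈ F₀, φ ξ (P.q x s) • M ξ x s :=
      finsum_eq_sum_of_support_subset _ (by simpa [F₀] using hsupp x s)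
    have h2 : S y (X.p.map f s) =
        ∑ ξ ∈ F₀, φ ξ (P.q y (X.p.map f s)) • M ξ y (X.p.map f s) :=
      finsum_eq_sum_of_support_subset _ (by simpa [F₀, P.q_map] using hsupp y (X.p.map f s))
    rw [h1, h2, LinearMap.sum_apply, LinearMap.sum_apply, map_sum]
    refine Finset.sum_congr rfl fun ξ _ => ?_
    rw [LinearMap.smul_apply, LinearMap.smul_apply, _root_.map_smul, P.q_map, ← hM ξ f,
      FibHom.map_tot_apply]
  have hSc : ∀ y t, (S y).ContAt t := fun y t => by
    obtain ⟨N, hN, hNf⟩ := χ.locallyFinite (P.q y t)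
    let F₀ : Finset P.B := hNf.toFinset
    have hsum : (∑ ξ ∈ F₀, FibHom.scale (fun t => φ ξ (P.q y t)) (M ξ y)).ContAt t := by
      refine FibHom.ContAt.sum fun ξ _ => ?_
      by_cases hξt : P.q y t ∈ tsupport (χ ξ)
      · exact FibHom.ContAt.scale ((hφ ξ).comp (P.continuous_q y)).continuousAt
          (hc ξ y t (hχ ξ hξt))
      · refine (FibHom.contAt_zero t).congr ?_
        have := (isClosed_tsupport (χ ξ)).isOpen_compl.mem_nhds hξt
        filter_upwards [(P.continuous_q y).continuousAt this] with s hs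
        have h0 : χ ξ (P.q y s) = 0 := image_eq_zero_of_notMem_tsupport hs
        simp [FibHom.scale, φ, h0]
    refine hsum.congr ?_
    filter_upwards [(P.continuous_q y).continuousAt hN] with s hs
    have : S y s = ∑ ξ ∈ F₀, φ ξ (P.q y s) • M ξ y s := by
      refine finsum_eq_sum_of_support_subset _ ?_
      refine (hsupp y s).trans fun ξ hξ => ?_
      simp only [F₀, Finite.coe_toFinset]
      exact ⟨P.q y s, by simpa [φ] using hξ, hs⟩
    rw [this]
    simp [FibHom.scale]
  refine ⟨Hom.ofFib S hS hSc, fun y t L hL => ?_⟩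
  rw [Hom.fib_ofFib]
  have h1 : ∀ ξ, φ ξ (P.q y t) • M ξ y t = φ ξ (P.q y t) • L := fun ξ => by
    by_cases h : P.q y t ∈ O ξ
    · rw [hL ξ h]
    · have h0 : χ ξ (P.q y t) = 0 :=
        image_eq_zero_of_notMem_tsupport fun h' => h (hχ ξ h')
      simp [φ, h0]
  have h2 : ∑ᶠ ξ, φ ξ (P.q y t) = 1 := by
    have := χ.sum_eq_one (mem_univ (P.q y t))
    have h3 := congrArg (fun r : ℝ => (r : ℂ)) this
    simp only [Complex.ofReal_one] at h3
    rw [← h3]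
    exact (Complex.ofRealHom.toAddMonoidHom.map_finsum (χ.locallyFinite.point_finite _)).symm
  calc S y t = ∑ᶠ ξ, φ ξ (P.q y t) • L := finsum_congr h1
    _ = (∑ᶠ ξ, φ ξ (P.q y t)) • L := (finsum_smul' (hfin _) L).symm
    _ = L := by rw [h2, one_smul]

end VectorBundle

namespace VectorBundle

variable {X : BasedCategory.{v, w} TopCat.{u}} {E F : VectorBundle X}

/-! ### Extension of homomorphisms from closed substacks -/

/-- The linear maps given by a homomorphism on a closed substack. -/
def Hom.onSub {A : ClosedSubstack X} (σ : Hom (E.pullback A.incl) (F.pullback A.incl)) (y : X.obj)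
    (hy : A.mem y) : FibHom E F y := fun _ =>
  { toFun := fun a => ⟨σ.toFun ⟨y, hy⟩ a.val, (σ.proj_eq ⟨y, hy⟩ a.val).trans a.proj_val⟩
    map_add' := fun a b => Fib.ext (σ.map_vadd ⟨y, hy⟩ a.val b.val (a.proj_val.trans b.proj_val.symm)
      (((σ.proj_eq ⟨y, hy⟩ a.val).trans a.proj_val).trans
        ((σ.proj_eq ⟨y, hy⟩ b.val).trans b.proj_val).symm))
    map_smul' := fun c a => Fib.ext (σ.map_smul ⟨y, hy⟩ c a.val) }

section

variable {A : ClosedSubstack X} (σ : Hom (E.pullback A.incl) (F.pullback A.incl))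

lemma Hom.onSub_tot (y : X.obj) (hy : A.mem y) (a : E.total.obj y) :
    (σ.onSub y hy).tot a = σ.toFun ⟨y, hy⟩ a := rfl

lemma Hom.onSub_pull {x y : X.obj} (hx : A.mem x) (hy : A.mem y) (f : x ⟶ y) :
    (σ.onSub y hy).pull f = σ.onSub x hx := by
  rw [FibHom.pull_eq_iff]
  exact fun a => (σ.naturality (x := ⟨x, hx⟩) (y := ⟨y, hy⟩) (ObjectProperty.homMk f) a).symm

lemma Hom.onSub_contAt (y : X.obj) (hy : A.mem y) (t : X.p.obj y) : (σ.onSub y hy).ContAt t :=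
  fun _ _ => (σ.continuous ⟨y, hy⟩).continuousAt

variable (P : Presentation X)

open Classical in
/-- Near every point of the atlas, a homomorphism given on a closed substack extends to a continuous
family of linear maps. -/
lemma Hom.exists_local_extension (ξ : P.B) : ∃ (V : Set (X.p.obj P.x₀)) (n : ℕ) (N : Set P.B)
    (M : FibHom E F P.x₀), P.IsSlice V n ∧ N ∈ 𝓝 ξ ∧ N ⊆ P.q P.x₀ '' V ∧
      (∀ v ∈ V, P.q P.x₀ v ∈ interior N → M.ContAt v) ∧
      ∀ (z : X.obj) (hz : A.mem z) (_ : Subsingleton (X.p.obj z)) (s : X.p.obj z) (k : z ⟶ P.x₀),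
        X.p.map k s ∈ V → P.q z s ∈ N → M.pull k s = σ.onSub z hz s := by
  obtain ⟨t, rfl⟩ := P.surjective_q ξ
  obtain ⟨n, U, hU, htU, ⟨τ⟩⟩ := E.exists_localTriv P.x₀ t
  obtain ⟨m, U', hU', htU', ⟨τ'⟩⟩ := F.exists_localTriv P.x₀ t
  obtain ⟨V, hVU, htV, d, hV⟩ := P.exists_isSlice t (hU.inter hU') ⟨htU, htU'⟩
  obtain ⟨N, hN, hNc, hNV⟩ := exists_mem_nhds_isClosed_subset
    ((P.isOpenMap_q _ hV.isOpen).mem_nhds ⟨t, htV, rfl⟩)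
  have := hV.normalSpace hNc hNV
  obtain ⟨C, hC, hAC⟩ := A.exists_isClosed P.x₀
  obtain ⟨c, φ, hφ, hr⟩ := P.isFibered.exists_restrict P.x₀ C
  have hc : A.mem c := (hAC c φ).2 fun s => hr ▸ mem_range_self s
  -- the given homomorphism, as a (discontinuous) family on the atlas
  let M₀ : FibHom E F P.x₀ := fun v =>
    if h : ∃ s, X.p.map φ s = v then
      (F.mapFib φ h.choose_spec).toLinearMap ∘ₗ σ.onSub c hc h.choose ∘ₗ
        (E.mapFib φ h.choose_spec).symm.toLinearMap
    else 0
  have hM₀ : M₀.pull φ = σ.onSub c hc := by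
    rw [FibHom.pull_eq_iff]
    intro a
    have h : ∃ s, X.p.map φ s = X.p.map φ (E.proj.app c a) := ⟨_, rfl⟩
    have hs : h.choose = E.proj.app c a := hφ.injective h.choose_spec
    have h1 : M₀ (X.p.map φ (E.proj.app c a)) = _ := dif_pos h
    have h2 := congrArg Fib.val (LinearMap.congr_fun h1 ⟨E.total.map φ a, E.proj_map _ a⟩)
    rw [← FibHom.tot_val] at h2
    refine Eq.trans ?_ h2.symm
    change _ = F.total.map φ (σ.onSub c hc h.choose ((E.mapFib φ h.choose_spec).symm _)).val
    have h3 : (E.mapFib φ h.choose_spec).symm ⟨E.total.map φ a, E.proj_map _ a⟩ =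
        ⟨a, hs.symm⟩ := by
      rw [LinearEquiv.symm_apply_eq]
      exact Fib.ext rfl
    rw [h3, ← FibHom.tot_val]
  let Z := {v : X.p.obj P.x₀ // v ∈ V ∧ P.q P.x₀ v ∈ N}
  let K : Set Z := Subtype.val ⁻¹' C
  have hK : IsClosed K := hC.preimage continuous_subtype_val
  have hcont : Continuous fun z : K => M₀.coord τ τ' z.1.1 := by
    have h1 : ContinuousOn (M₀.coord τ τ') (C ∩ V) := by
      rintro v ⟨hvC, hvV⟩
      obtain ⟨s, rfl⟩ : v ∈ range (X.p.map φ) := hr ▸ hvC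
      have h2 := FibHom.ContAt.continuousAt_coord (τ := τ) (τ' := τ') hU hU' (M := M₀) φ (s := s)
        (by rw [hM₀]; exact σ.onSub_contAt c hc s) (hVU hvV).1 (hVU hvV).2
      refine ContinuousWithinAt.mono (t := C) ?_ inter_subset_left
      rw [ContinuousWithinAt, ← hr, ← hφ.isInducing.map_nhds_eq, tendsto_map'_iff]
      exact h2
    exact h1.comp_continuous (continuous_subtype_val.comp continuous_subtype_val)
      fun z => ⟨z.2, z.1.2.1⟩
  -- the Tietze extension theorem, applied to matrices on the normal space `Z`
  obtain ⟨S, hS⟩ := ContinuousMap.exists_restrict_eq hK ⟨_, hcont⟩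
  let M : FibHom E F P.x₀ := fun v =>
    if h : v ∈ V ∧ P.q P.x₀ v ∈ N then
      (LocalTriv.fib τ' (hVU h.1).2).symm.toLinearMap ∘ₗ (S ⟨v, h⟩).toLinearMap ∘ₗ
        (LocalTriv.fib τ (hVU h.1).1).toLinearMap
    else 0
  have hMS : ∀ z : Z, M.coord τ τ' z.1 = S z := fun z => by
    ext1 e
    rw [FibHom.coord_apply _ (hVU z.2.1).1 (hVU z.2.1).2]
    simp only [M, dif_pos z.2]
    simp
  refine ⟨V, d, N, M, hV, hN, hNV, fun v hv hvN => ?_, fun z hz hzs s k hk hs => ?_⟩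
  · rw [FibHom.contAt_iff_coord (τ := τ) (τ' := τ') hU hU' M (hVU hv).1 (hVU hv).2]
    have h1 : ContinuousOn (M.coord τ τ') {v | v ∈ V ∧ P.q P.x₀ v ∈ N} := by
      rw [continuousOn_iff_continuous_domRestrict]
      have : ({v | v ∈ V ∧ P.q P.x₀ v ∈ N} : Set _).domRestrict (M.coord τ τ') = S :=
        funext fun z => hMS z
      rw [this]
      exact S.continuous
    refine h1.continuousAt ?_
    filter_upwards [hV.isOpen.mem_nhds hv, (P.continuous_q _).continuousAt
      (isOpen_interior.mem_nhds hvN)] with v' h h'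
    exact ⟨h, interior_subset h'⟩
  · have hkC : ∀ s', X.p.map k s' ∈ range (X.p.map φ) := fun s' => hr ▸ (hAC z k).1 hz s'
    obtain ⟨κ, rfl⟩ := P.isFibered.exists_factor φ hφ k hkC
    rw [← P.q_map (κ ≫ φ)] at hs
    have h1 : M (X.p.map (κ ≫ φ) s) = M₀ (X.p.map (κ ≫ φ) s) := by
      have h2 := hMS ⟨_, hk, hs⟩
      have h3 := congrArg (fun g => g ⟨⟨_, hk, hs⟩, (hAC z (κ ≫ φ)).1 hz s⟩) hS
      change S ⟨_, hk, hs⟩ = M₀.coord τ τ' (X.p.map (κ ≫ φ) s) at h3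
      rw [h3] at h2
      refine LinearMap.ext fun a => ?_
      have h4 := congrArg (fun L => L (LocalTriv.fib τ (hVU hk).1 a)) h2
      simp only [FibHom.coord_apply _ (hVU hk).1 (hVU hk).2, LinearEquiv.symm_apply_apply] at h4
      exact (LocalTriv.fib τ' (hVU hk).2).injective h4
    have h2 : M.pull (κ ≫ φ) s = M₀.pull (κ ≫ φ) s := by
      simp only [FibHom.pull, h1]
    rw [h2, FibHom.pull_comp, hM₀, σ.onSub_pull hz]

/-- **Tietze extension** on orbispaces: a homomorphism of vector bundles given on a closed substack
extends to the whole stack.  Local extensions to slices of the atlas are made invariant by averaging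
over the arrows into the slice, and glued with a partition of unity on the quotient. -/
theorem Hom.exists_extension (P : Presentation X)
    (σ : Hom (E.pullback A.incl) (F.pullback A.incl)) :
    ∃ h : Hom E F, ∀ (y : A.toBased.obj) (a : E.total.obj y.obj),
      h.toFun y.obj a = σ.toFun y a := by
  choose V n N M hV hN hNV hMc hMA using σ.exists_local_extension P
  have hpull := fun ξ {z z' : X.obj} (hz : Subsingleton (X.p.obj z))
    (hz' : Subsingleton (X.p.obj z')) (f : z ⟶ z') =>
      FibHom.average_pull (hV ξ) (M ξ) hz hz' f
  obtain ⟨h, hh⟩ := exists_hom_of_local P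
    (fun ξ y => FibHom.ofPoints P.isFibered (fun z _ => FibHom.average P (V ξ) (n ξ) (M ξ) z) y)
    (fun ξ => interior (N ξ)) (fun ξ => isOpen_interior)
    (fun ξ => mem_interior_iff_mem_nhds.2 (hN ξ))
    (fun ξ {x y} f => FibHom.ofPoints_pull P.isFibered (hpull ξ) f)
    (fun ξ y t ht => FibHom.average_contAt (hV ξ) (M ξ) y t (hNV ξ (interior_subset ht))
      fun v hv hvt => hMc ξ v hv (by rw [hvt]; exact ht))
  refine ⟨h, fun y => ?_⟩
  have : h.fib y.obj = σ.onSub y.obj y.property := by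
    refine FibHom.ext_point P.isFibered fun z φ hz => ?_
    have hzA : A.mem z := A.mem_of_hom φ y.property
    rw [h.fib_pull, σ.onSub_pull hzA]
    funext s
    refine hh z s _ fun ξ hξ => ?_
    have hp := congrFun (FibHom.ofPoints_pull_point P.isFibered (hpull ξ) hz (𝟙 z)) s
    rw [FibHom.pull_id] at hp
    rw [hp]
    exact FibHom.average_eq_of_forall (hV ξ) (M ξ) hz s (hNV ξ (interior_subset hξ)) _
      fun k hk => hMA ξ z hzA hz s k hk (interior_subset hξ)
  intro a
  rw [← h.fib_tot, this, σ.onSub_tot]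
  rfl

end

end VectorBundle

/-! ### Existence of presentations -/

section

variable {X : BasedCategory.{v, w} TopCat.{u}} (hX : IsFibered X) {x₀ : X.obj}
  (hx₀ : IsEtaleAtlas X x₀) (hd : HasSeparatedProperDiagonal X)

/-- Two points of the base of `x₀` are identified if they are images of one point of the stack. -/
def OrbitRel (x₀ : X.obj) (t t' : X.p.obj x₀) : Prop :=
  ∃ (z : X.obj) (s : X.p.obj z) (k k' : z ⟶ x₀), X.p.map k s = t ∧ X.p.map k' s = t'

/-- The quotient of the base of an atlas by the groupoid. -/
def OrbitSpace (x₀ : X.obj) : Type u := Quot (OrbitRel x₀)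

instance : TopologicalSpace (OrbitSpace x₀) := inferInstanceAs (TopologicalSpace (Quot _))

namespace OrbitSpace

/-- The orbit of a point of the base of an atlas. -/
def mk (t : X.p.obj x₀) : OrbitSpace x₀ := Quot.mk _ t

lemma continuous_mk : Continuous (mk (x₀ := x₀)) := continuous_quot_mk

lemma isQuotientMap_mk : IsQuotientMap (mk (x₀ := x₀)) := isQuotientMap_quot_mk

include hX in
lemma equivalence : Equivalence (OrbitRel x₀) where
  refl t := ⟨x₀, t, 𝟙 _, 𝟙 _, p_id _ _, p_id _ _⟩
  symm := fun ⟨z, s, k, k', h, h'⟩ => ⟨z, s, k', k, h', h⟩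
  trans := by
    rintro t _ t'' ⟨z, s, k, k', rfl, rfl⟩ ⟨z₂, s₂, l, l', h, rfl⟩
    obtain ⟨w, φ, r, hw, rfl⟩ := hX.exists_point z s
    obtain ⟨χ, h1, -⟩ := hX.exists_factor_point l (φ ≫ k') r s₂ (by rw [h, p_comp])
    exact ⟨w, r, φ ≫ k, χ ≫ l', p_comp _ _ _, by rw [p_comp, h1]⟩

include hX in
lemma mk_eq_iff {t t' : X.p.obj x₀} : mk t = mk t' ↔ OrbitRel x₀ t t' :=
  (equivalence hX).quot_mk_eq_iff _ _

/-- The orbit of a point of the stack. -/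
def orbit (y : X.obj) (t : X.p.obj y) : OrbitSpace x₀ :=
  mk (X.p.map (hx₀ y).choose_spec.choose ((hx₀ y).choose_spec.choose_spec.choose_spec.2.2 t).choose)

include hX in
lemma orbit_map {z y : X.obj} (f : z ⟶ y) (k : z ⟶ x₀) (s : X.p.obj z) :
    orbit hx₀ y (X.p.map f s) = mk (X.p.map k s) := by
  obtain ⟨w, φ, r, hw, rfl⟩ := hX.exists_point z s
  let b := (hx₀ y).choose_spec.choose_spec.choose
  have hb := ((hx₀ y).choose_spec.choose_spec.choose_spec.2.2 (X.p.map f (X.p.map φ r))).choose_spec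
  obtain ⟨χ, h1, -⟩ := hX.exists_factor_point b (φ ≫ f) r _ (hb.trans (p_comp _ _ _).symm)
  refine (mk_eq_iff hX).2 ⟨w, r, χ ≫ (hx₀ y).choose_spec.choose, φ ≫ k, ?_, p_comp _ _ _⟩
  rw [p_comp, h1]

include hX in
lemma orbit_eq (t : X.p.obj x₀) : orbit hx₀ x₀ t = mk t := by
  have := orbit_map hX hx₀ (𝟙 x₀) (𝟙 x₀) t
  rwa [p_id] at this

include hX in
lemma orbit_natural {x y : X.obj} (f : x ⟶ y) (t : X.p.obj x) :
    orbit hx₀ y (X.p.map f t) = orbit hx₀ x t := by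
  obtain ⟨c, a, b, -, -, hb⟩ := hx₀ x
  obtain ⟨s, rfl⟩ := hb t
  rw [orbit_map hX hx₀ b a, ← p_comp, orbit_map hX hx₀ (b ≫ f) a]

include hX in
lemma continuous_orbit (y : X.obj) : Continuous (orbit hx₀ y) := by
  obtain ⟨c, a, b, -, hl, hb⟩ := hx₀ y
  have hq : IsQuotientMap (X.p.map b) := hl.isOpenMap.isQuotientMap (p_continuous b) hb
  rw [hq.continuous_iff]
  have : orbit hx₀ y ∘ X.p.map b = mk ∘ X.p.map a := funext fun s => orbit_map hX hx₀ b a s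
  rw [this]
  exact continuous_mk.comp (p_continuous a)

include hX hx₀ in
lemma isOpenMap_mk : IsOpenMap (mk (x₀ := x₀)) := fun U hU => by
  obtain ⟨r, a, b, hs, hl, -⟩ := hx₀ x₀
  rw [← isQuotientMap_mk.isOpen_preimage]
  convert hl.isOpenMap _ (hU.preimage (p_continuous a)) using 1
  ext t
  constructor
  · rintro ⟨t', ht', h⟩
    obtain ⟨z, s, k, k', rfl, rfl⟩ := (mk_eq_iff hX).1 h
    obtain ⟨m, ⟨rfl, rfl⟩, -⟩ := hs z k k'
    exact ⟨X.p.map m s, by rwa [mem_preimage, ← p_comp], (p_comp _ _ _).symm⟩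
  · rintro ⟨s, hs', rfl⟩
    exact ⟨_, hs', (mk_eq_iff hX).2 ⟨r, s, a, b, rfl, rfl⟩⟩

include hX hx₀ in
/-- The quotient by the groupoid is the coarse space. -/
lemma nonempty_homeomorph_coarse : Nonempty (OrbitSpace x₀ ≃ₜ Coarse X) := by
  have hc : ∀ y : X.obj, Continuous fun t : X.p.obj y =>
      (Quot.mk _ (⟨y, t⟩ : Σ x : X.obj, X.p.obj x) : Coarse X) :=
    fun y => continuous_quot_mk.comp continuous_sigmaMk
  have hm : ∀ {x y : X.obj} (f : x ⟶ y) (t : X.p.obj x),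
      (Quot.mk _ (⟨x, t⟩ : Σ x : X.obj, X.p.obj x) : Coarse X) =
        Quot.mk _ (⟨y, X.p.map f t⟩ : Σ x : X.obj, X.p.obj x) := fun f t =>
    Quot.sound ⟨f, rfl⟩
  let Φ : OrbitSpace x₀ → Coarse X := Quot.lift (fun t => Quot.mk _ ⟨x₀, t⟩) (by
    rintro _ _ ⟨z, s, k, k', rfl, rfl⟩
    exact (hm k s).symm.trans (hm k' s))
  refine ⟨{
    toFun := Φ
    invFun := Quot.lift (fun a => orbit hx₀ a.1 a.2) ?_
    left_inv := ?_
    right_inv := ?_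
    continuous_toFun := continuous_quot_lift _ (hc x₀)
    continuous_invFun := continuous_quot_lift _ (continuous_sigma fun y =>
      continuous_orbit hX hx₀ y) }⟩
  · rintro ⟨x, t⟩ ⟨y, t'⟩ ⟨f, h⟩
    exact (orbit_natural hX hx₀ f t).symm.trans (congrArg (orbit hx₀ y) h)
  · rintro ⟨t⟩
    exact orbit_eq hX hx₀ t
  · rintro ⟨⟨y, t⟩⟩
    obtain ⟨c, a, b, -, -, hb⟩ := hx₀ y
    obtain ⟨s, rfl⟩ := hb t
    have h : Φ (orbit hx₀ y (X.p.map b s)) = Quot.mk _ ⟨y, X.p.map b s⟩ := by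
      rw [orbit_map hX hx₀ b a]
      exact (hm a s).symm.trans (hm b s)
    exact h

end OrbitSpace

include hx₀ in
lemma IsEtaleAtlas.isLocalHomeomorph {y c : X.obj} {a : c ⟶ x₀} {b : c ⟶ y}
    (hs : ∀ (t : X.obj) (a₁ : t ⟶ x₀) (b₁ : t ⟶ y), ∃! m : t ⟶ c, m ≫ a = a₁ ∧ m ≫ b = b₁) :
    IsLocalHomeomorph (X.p.map b) := by
  obtain ⟨c', a', b', hs', hl, -⟩ := hx₀ y
  obtain ⟨m, ⟨hm, hm'⟩, -⟩ := hs' c a b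
  obtain ⟨n, ⟨hn, hn'⟩, -⟩ := hs c' a' b'
  have h1 : m ≫ n = 𝟙 c := (hs c a b).unique
    ⟨by rw [Category.assoc, hn, hm], by rw [Category.assoc, hn', hm']⟩ (by simp)
  have h2 : n ≫ m = 𝟙 c' := (hs' c' a' b').unique
    ⟨by rw [Category.assoc, hm, hn], by rw [Category.assoc, hm', hn']⟩ (by simp)
  let e : X.p.obj c ≃ₜ X.p.obj c' := TopCat.homeoOfIso (X.p.mapIso ⟨m, n, h1, h2⟩)
  have : (X.p.map b : X.p.obj c → X.p.obj y) = X.p.map b' ∘ e := by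
    funext t
    rw [← hm', p_comp]
    rfl
  rw [this]
  exact hl.comp e.isLocalHomeomorph

include hX hd in
/-- The arrows of the groupoid given by an atlas form a separated and proper space over the product
of the base with itself. -/
lemma isSeparatedMap_isProperMap_of_span {r : X.obj} {a b : r ⟶ x₀}
    (hs : ∀ (t : X.obj) (a₁ b₁ : t ⟶ x₀), ∃! m : t ⟶ r, m ≫ a = a₁ ∧ m ≫ b = b₁) :
    IsSeparatedMap (fun s => (X.p.map a s, X.p.map b s)) ∧
      IsProperMap (fun s => (X.p.map a s, X.p.map b s)) := by
  obtain ⟨z₁, φ₁, e₁, h₁⟩ := hX.lift x₀ (S := TopCat.of (X.p.obj x₀ × X.p.obj x₀))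
    (TopCat.ofHom ⟨Prod.fst, continuous_fst⟩)
  obtain ⟨z₂, φ₂, e₂, h₂⟩ := hX.lift x₀ (S := TopCat.of (X.p.obj x₀ × X.p.obj x₀))
    (TopCat.ofHom ⟨Prod.snd, continuous_snd⟩)
  obtain ⟨d, α, β, hαβ, hu, hsep, hprop⟩ := hd z₁ z₂ (e₁.symm ≪≫ e₂)
  obtain ⟨m, ⟨hma, hmb⟩, -⟩ := hs d (α ≫ φ₁) (β ≫ φ₂)
  let g : X.p.obj r ⟶ TopCat.of (X.p.obj x₀ × X.p.obj x₀) :=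
    TopCat.ofHom ⟨fun s => (X.p.map a s, X.p.map b s), (p_continuous a).prodMk (p_continuous b)⟩
  obtain ⟨α', ⟨hα, hα'⟩, -⟩ := hX.cart φ₁ a (g ≫ e₁.hom) (by rw [Category.assoc, h₁]; rfl)
  obtain ⟨β', ⟨hβ, hβ'⟩, -⟩ := hX.cart φ₂ b (g ≫ e₂.hom) (by rw [Category.assoc, h₂]; rfl)
  obtain ⟨n, ⟨hn, hn'⟩, -⟩ := hu r α' β' (by rw [hα, hβ]; simp)
  have hmα : m ≫ α' = α := by
    refine hX.hom_ext φ₁ ?_ (by rw [Category.assoc, hα', hma])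
    have h3 : X.p.map m ≫ g = X.p.map α ≫ e₁.inv := by
      ext s
      · have h4 : (X.p.map α ≫ e₁.inv) ≫ e₁.hom ≫ X.p.map φ₁ = X.p.map m ≫ X.p.map a := by
          rw [← X.p.map_comp, hma, X.p.map_comp]
          simp
        rw [h₁] at h4
        exact (ConcreteCategory.congr_hom h4 s).symm
      · have h4 : (X.p.map α ≫ e₁.inv) ≫ e₂.hom ≫ X.p.map φ₂ = X.p.map m ≫ X.p.map b := by
          rw [← X.p.map_comp, hmb, X.p.map_comp, ← hαβ]
          simp
        rw [h₂] at h4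
        exact (ConcreteCategory.congr_hom h4 s).symm
    rw [X.p.map_comp, hα, ← Category.assoc, h3]
    simp
  have hnm : n ≫ m = 𝟙 r := (hs r a b).unique
    ⟨by rw [Category.assoc, hma, ← Category.assoc, hn, hα'],
      by rw [Category.assoc, hmb, ← Category.assoc, hn', hβ']⟩ (by simp)
  have hmn : m ≫ n = 𝟙 d := by
    refine (hu d α β hαβ).unique ⟨by rw [Category.assoc, hn, hmα], ?_⟩ (by simp)
    rw [Category.assoc, hn']
    refine hX.hom_ext φ₂ ?_ (by rw [Category.assoc, hβ', hmb])
    have h5 : X.p.map β' = X.p.map α' ≫ (e₁.symm ≪≫ e₂).hom := by rw [hα, hβ]; simp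
    rw [X.p.map_comp, h5, ← Category.assoc, ← X.p.map_comp, hmα, hαβ]
  let e : X.p.obj r ≃ₜ X.p.obj d := TopCat.homeoOfIso (X.p.mapIso ⟨n, m, hnm, hmn⟩)
  have : (fun s => (X.p.map a s, X.p.map b s)) =
      (TopCat.homeoOfIso e₁).symm ∘ (X.p.map α : X.p.obj d → X.p.obj z₁) ∘ e := by
    have h3 : g = X.p.map n ≫ X.p.map α ≫ e₁.inv := by
      rw [← Category.assoc, ← X.p.map_comp, hn, hα]
      simp
    funext s
    exact ConcreteCategory.congr_hom h3 s
  rw [this]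
  exact ⟨(hsep.comp_right e.continuous e.injective).comp_left (TopCat.homeoOfIso e₁).symm.injective,
    (TopCat.homeoOfIso e₁).symm.isProperMap.comp (hprop.comp e.isProperMap)⟩

include hX hx₀ hd in
lemma nonempty_presentation [ParacompactSpace (OrbitSpace x₀)] :
    ∃ P : Presentation X, P.x₀ = x₀ := by
  obtain ⟨r, a, b, hs, hl, -⟩ := hx₀ x₀
  obtain ⟨hsep, hprop⟩ := isSeparatedMap_isProperMap_of_span hX hd hs
  have hrel : ∀ t t', OrbitSpace.mk t = OrbitSpace.mk t' →
      ∃ s, X.p.map a s = t ∧ X.p.map b s = t' := fun t t' h => by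
    obtain ⟨z, s, k, k', rfl, rfl⟩ := (OrbitSpace.mk_eq_iff hX).1 h
    obtain ⟨m, ⟨hm, hm'⟩, -⟩ := hs z k k'
    exact ⟨X.p.map m s, by rw [← p_comp, hm], by rw [← p_comp, hm']⟩
  have hopen := OrbitSpace.isOpenMap_mk hX hx₀
  have hT2 : T2Space (OrbitSpace x₀) := by
    rw [t2Space_iff_of_isOpenQuotientMap (π := OrbitSpace.mk (x₀ := x₀))
      ⟨OrbitSpace.isQuotientMap_mk.surjective, OrbitSpace.continuous_mk, hopen⟩]
    convert hprop.isClosedMap.isClosed_range using 1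
    ext ⟨t, t'⟩
    constructor
    · intro h
      obtain ⟨s, rfl, rfl⟩ := hrel _ _ h
      exact ⟨s, rfl⟩
    · rintro ⟨s, h⟩
      cases h
      exact (OrbitSpace.mk_eq_iff hX).2 ⟨r, s, a, b, rfl, rfl⟩
  exact ⟨{
    isFibered := hX
    x₀ := x₀
    atlas := hx₀
    R := r
    a := a
    b := b
    span := hs
    isLocalHomeomorph := hl
    isSeparatedMap := hsep
    isProperMap := hprop
    B := OrbitSpace x₀
    q := OrbitSpace.orbit hx₀
    continuous_q := OrbitSpace.continuous_orbit hX hx₀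
    q_map := OrbitSpace.orbit_natural hX hx₀
    isOpenMap_q := by
      rw [funext (OrbitSpace.orbit_eq hX hx₀)]
      exact hopen
    surjective_q := by
      rw [funext (OrbitSpace.orbit_eq hX hx₀)]
      exact OrbitSpace.isQuotientMap_mk.surjective
    exists_of_q_eq := fun s t h => by
      rw [OrbitSpace.orbit_eq hX hx₀, OrbitSpace.orbit_eq hX hx₀] at h
      exact hrel s t h }, rfl⟩

end

/-- The product of an object with a space. -/
lemma IsFibered.exists_prod {X : BasedCategory.{v, w} TopCat.{u}} (hX : IsFibered X) (x₀ : X.obj)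
    (K : TopCat.{u}) : ∃ (x₁ : (Orbispace.prodSpace X K).obj) (φ : x₁.left ⟶ x₀)
      (e : X.p.obj x₁.left ≃ₜ X.p.obj x₀ × K), (∀ t, e t = (X.p.map φ t, x₁.hom t)) ∧
        ∀ (y : (Orbispace.prodSpace X K).obj) (k : y.left ⟶ x₀), ∃! χ : y ⟶ x₁, χ.left ≫ φ = k := by
  obtain ⟨z, φ, e, he⟩ := hX.lift x₀ (S := TopCat.of (X.p.obj x₀ × K))
    (TopCat.ofHom ⟨Prod.fst, continuous_fst⟩)
  let sn : TopCat.of (X.p.obj x₀ × K) ⟶ K := TopCat.ofHom ⟨Prod.snd, continuous_snd⟩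
  have hφ : ∀ t, (e.inv t).1 = X.p.map φ t := fun t => by
    have h : X.p.map φ = e.inv ≫ TopCat.ofHom ⟨Prod.fst, continuous_fst⟩ := by simp [← he]
    rw [h]
    rfl
  refine ⟨CostructuredArrow.mk (Y := z) (e.inv ≫ sn), φ, (TopCat.homeoOfIso e).symm,
    fun t => Prod.ext (hφ t) rfl, fun y k => ?_⟩
  obtain ⟨χ, ⟨h1, h2⟩, h3⟩ := hX.cart φ k
    (TopCat.ofHom ⟨fun s => (X.p.map k s, y.hom s),
      (p_continuous k).prodMk y.hom.hom.continuous⟩ ≫ e.hom) (by rw [Category.assoc, he]; rfl)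
  refine ⟨CostructuredArrow.homMk χ ?_, h2, fun χ' h => CostructuredArrow.hom_ext _ _
    (h3 _ ⟨?_, h⟩)⟩
  · change X.p.map χ ≫ e.inv ≫ sn = y.hom
    rw [h1]
    simp only [Category.assoc, Iso.hom_inv_id_assoc]
    rfl
  · rw [← Iso.comp_inv_eq]
    ext s
    · change (e.inv (X.p.map χ'.left s)).1 = X.p.map k s
      rw [hφ, ← p_comp, h]
    · exact ConcreteCategory.congr_hom (CostructuredArrow.w χ') s

/-- A class of stacks which have presentations: like paracompact orbispaces, but without descent.
The paracompact space is the quotient of an atlas by the groupoid, which lies in the right universe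
and is homeomorphic to the coarse space. -/
structure IsPresentable (X : BasedCategory.{v, w} TopCat.{u}) : Prop where
  isFibered : IsFibered X
  diagonal : HasSeparatedProperDiagonal X
  exists_atlas : ∃ x₀ : X.obj, IsEtaleAtlas X x₀ ∧ ParacompactSpace (OrbitSpace x₀)

namespace IsPresentable

variable {X : BasedCategory.{v, w} TopCat.{u}} (hX : IsPresentable X)

lemma _root_.Orbispace.IsParacompactOrbispace.isPresentable (h : IsParacompactOrbispace X) :
    IsPresentable X where
  isFibered := h.isStack.isFibered
  diagonal := h.diagonal
  exists_atlas := by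
    obtain ⟨x₀, hx₀⟩ := h.exists_etaleAtlas
    obtain ⟨e⟩ := OrbitSpace.nonempty_homeomorph_coarse h.isStack.isFibered hx₀
    exact ⟨x₀, hx₀, e.paracompactSpace_iff.2 h.paracompact⟩

include hX

lemma nonempty_presentation : Nonempty (Presentation X) := by
  obtain ⟨x₀, hx₀, h⟩ := hX.exists_atlas
  obtain ⟨P, -⟩ := Orbispace.nonempty_presentation hX.isFibered hx₀ hX.diagonal
  exact ⟨P⟩

/-- The product of a presentable stack with a compact Hausdorff space. -/
lemma prodSpace (K : TopCat.{u}) [CompactSpace K] [T2Space K] :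
    IsPresentable (prodSpace X K) := by
  obtain ⟨x₀, hx₀, hpar⟩ := hX.exists_atlas
  refine ⟨hX.isFibered.prodSpace K, fun (x y : CostructuredArrow X.p K)
    (e : X.p.obj x.left ≅ X.p.obj y.left) => ?_, ?_⟩
  · -- the span for `X`, restricted to the closed set where the coordinates in `K` agree
    obtain ⟨z, a, b, hab, hu, hsep, hprop⟩ := hX.diagonal x.left y.left e
    let D : Set (X.p.obj z) := {s | x.hom (X.p.map a s) = y.hom (X.p.map b s)}
    have hD : IsClosed D := isClosed_eq (x.hom.hom.continuous.comp (p_continuous a))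
      (y.hom.hom.continuous.comp (p_continuous b))
    obtain ⟨z', φ, hφ, hr⟩ := hX.isFibered.exists_restrict z D
    have hφc : IsClosedEmbedding (X.p.map φ) := ⟨hφ, by rw [hr]; exact hD⟩
    let z₁ : (Orbispace.prodSpace X K).obj :=
      CostructuredArrow.mk (Y := z') (X.p.map (φ ≫ a) ≫ x.hom)
    let a' : z₁ ⟶ x := CostructuredArrow.homMk (φ ≫ a) rfl
    let b' : z₁ ⟶ y := CostructuredArrow.homMk (φ ≫ b) (by
      ext s
      have h : X.p.map φ s ∈ D := hr ▸ mem_range_self s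
      change y.hom (X.p.map (φ ≫ b) s) = x.hom (X.p.map (φ ≫ a) s)
      rw [p_comp, p_comp]
      exact h.symm)
    refine ⟨z₁, a', b', ?_, fun t a₁ b₁ h => ?_, ?_, ?_⟩
    · change X.p.map (φ ≫ a) ≫ _ = X.p.map (φ ≫ b)
      rw [X.p.map_comp, X.p.map_comp, Category.assoc, hab]
    · obtain ⟨m, ⟨h1, h2⟩, h3⟩ := hu t.left a₁.left b₁.left h
      obtain ⟨χ, rfl⟩ := hX.isFibered.exists_factor φ hφ m fun s => by
        rw [hr]
        change x.hom (X.p.map a (X.p.map m s)) = y.hom (X.p.map b (X.p.map m s))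
        rw [← p_comp, ← p_comp, h1, h2]
        exact (ConcreteCategory.congr_hom (CostructuredArrow.w a₁) s).trans
          (ConcreteCategory.congr_hom (CostructuredArrow.w b₁) s).symm
      have h1' : χ ≫ φ ≫ a = a₁.left := by rw [← Category.assoc, h1]
      have h2' : χ ≫ φ ≫ b = b₁.left := by rw [← Category.assoc, h2]
      refine ⟨CostructuredArrow.homMk χ ?_, ⟨CostructuredArrow.hom_ext _ _ h1',
        CostructuredArrow.hom_ext _ _ h2'⟩, ?_⟩
      · change X.p.map χ ≫ X.p.map (φ ≫ a) ≫ x.hom = t.hom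
        rw [← Category.assoc, ← X.p.map_comp, h1']
        exact CostructuredArrow.w a₁
      · rintro m' ⟨h4, h5⟩
        refine CostructuredArrow.hom_ext _ _ ?_
        have h6 : m'.left ≫ φ = χ ≫ φ := h3 _
          ⟨(Category.assoc _ _ _).trans (congrArg CommaMorphism.left h4),
            (Category.assoc _ _ _).trans (congrArg CommaMorphism.left h5)⟩
        refine hX.isFibered.hom_ext φ ?_ h6
        ext s
        apply hφ.injective
        rw [← p_comp, ← p_comp, h6]
        rfl
    · change IsSeparatedMap (X.p.map (φ ≫ a))
      have : (X.p.map (φ ≫ a) : X.p.obj z' → X.p.obj x.left) = X.p.map a ∘ X.p.map φ :=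
        funext fun s => p_comp _ _ _
      rw [this]
      exact hsep.comp_right hφ.continuous hφ.injective
    · change IsProperMap (X.p.map (φ ≫ a))
      have : (X.p.map (φ ≫ a) : X.p.obj z' → X.p.obj x.left) = X.p.map a ∘ X.p.map φ :=
        funext fun s => p_comp _ _ _
      rw [this]
      exact hprop.comp hφc.isProperMap
  · obtain ⟨x₁, φ, e, he, key⟩ := hX.isFibered.exists_prod x₀ K
    have hat : IsEtaleAtlas (Orbispace.prodSpace X K) x₁ := fun y => by
      obtain ⟨c, a, b, hs, hl, hsurj⟩ := hx₀ y.left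
      let c' : (Orbispace.prodSpace X K).obj :=
        CostructuredArrow.mk (Y := c) (X.p.map b ≫ y.hom)
      let b' : c' ⟶ y := CostructuredArrow.homMk b rfl
      obtain ⟨a', ha', -⟩ := key c' a
      refine ⟨c', a', b', fun t a₁ b₁ => ?_, hl, hsurj⟩
      obtain ⟨m, ⟨h1, h2⟩, h3⟩ := hs t.left (a₁.left ≫ φ) b₁.left
      have hm : X.p.map m ≫ X.p.map b ≫ y.hom = t.hom := by
        rw [← Category.assoc, ← X.p.map_comp, h2]
        exact CostructuredArrow.w b₁
      refine ⟨CostructuredArrow.homMk m hm, ⟨(key t _).unique ?_ rfl,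
        CostructuredArrow.hom_ext _ _ h2⟩, ?_⟩
      · change (m ≫ a'.left) ≫ φ = _
        rw [Category.assoc, ha', h1]
      · rintro m' ⟨h4, h5⟩
        refine CostructuredArrow.hom_ext _ _ (h3 _ ⟨?_, congrArg CommaMorphism.left h5⟩)
        rw [← h4, ← ha', ← Category.assoc]
        rfl
    refine ⟨x₁, hat, ?_⟩
    have hopen := OrbitSpace.isOpenMap_mk hX.isFibered hx₀
    have hφ : ∀ t, (e t).1 = X.p.map φ t := fun t => congrArg Prod.fst (he t)
    have hsn : ∀ t, (e t).2 = x₁.hom t := fun t => congrArg Prod.snd (he t)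
    -- the quotient is a product, and hence paracompact because `K` is compact
    let Ψ : OrbitSpace x₁ → OrbitSpace x₀ × K :=
      Quot.lift (fun t => (OrbitSpace.mk (X.p.map φ t), (e t).2)) (by
        rintro _ _ ⟨w, s, k, k', rfl, rfl⟩
        refine Prod.ext ?_ ?_
        · exact (OrbitSpace.mk_eq_iff hX.isFibered).2 ⟨w.left, s, k.left ≫ φ, k'.left ≫ φ,
            p_comp _ _ _, p_comp _ _ _⟩
        · exact (hsn _).trans ((ConcreteCategory.congr_hom (CostructuredArrow.w k) s).trans
            ((ConcreteCategory.congr_hom (CostructuredArrow.w k') s).symm.trans (hsn _).symm)))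
    have hΨm : ∀ t : X.p.obj x₁.left, Ψ (OrbitSpace.mk (x₀ := x₁) t) =
        (OrbitSpace.mk (X.p.map φ t), (e t).2) := fun t => rfl
    have hΨe : Ψ ∘ OrbitSpace.mk (x₀ := x₁) =
        Prod.map OrbitSpace.mk id ∘ e := by
      exact funext fun (t : X.p.obj x₁.left) => Prod.ext (congrArg OrbitSpace.mk (hφ t).symm) rfl
    have hmksurj := (OrbitSpace.isQuotientMap_mk (x₀ := x₀)).surjective
    have hmksurj₁ := (OrbitSpace.isQuotientMap_mk (x₀ := x₁)).surjective
    have hΨ : IsHomeomorph Ψ := by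
      refine ⟨?_, ?_, ?_, ?_⟩
      · rw [(OrbitSpace.isQuotientMap_mk (x₀ := x₁)).continuous_iff, hΨe]
        exact (OrbitSpace.continuous_mk.prodMap continuous_id).comp
          e.continuous
      · intro U hU
        rw [← image_preimage_eq U hmksurj₁, ← image_comp, hΨe]
        exact ((hopen.prodMap IsOpenMap.id).comp e.isOpenMap) _
          (hU.preimage OrbitSpace.continuous_mk)
      · intro t t' h
        obtain ⟨(t : X.p.obj x₁.left), rfl⟩ := hmksurj₁ t
        obtain ⟨(t' : X.p.obj x₁.left), rfl⟩ := hmksurj₁ t'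
        rw [hΨm, hΨm] at h
        have h2 : (e t).2 = (e t').2 := (Prod.ext_iff.1 h).2
        obtain ⟨w, s, k, k', hk, hk'⟩ :=
          (OrbitSpace.mk_eq_iff hX.isFibered).1 (congrArg Prod.fst h)
        let w' : (Orbispace.prodSpace X K).obj :=
          CostructuredArrow.mk (Y := w) (TopCat.ofHom (ContinuousMap.const _ (e t).2))
        obtain ⟨χ, hχ, -⟩ := key w' k
        obtain ⟨χ', hχ', -⟩ := key w' k'
        refine (OrbitSpace.mk_eq_iff (hX.isFibered.prodSpace K)).2 ⟨w', s, χ, χ', ?_, ?_⟩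
        · refine e.injective (Prod.ext ?_ ((hsn _).trans
            (ConcreteCategory.congr_hom (CostructuredArrow.w χ) s)))
          rw [hφ, ← hk, ← hχ, p_comp]
          exact hφ _
        · refine e.injective (Prod.ext ?_ ((hsn _).trans
            ((ConcreteCategory.congr_hom (CostructuredArrow.w χ') s).trans h2)))
          rw [hφ, ← hk', ← hχ', p_comp]
          exact hφ _
      · have : Function.Surjective (Ψ ∘ OrbitSpace.mk (x₀ := x₁)) := by
          rw [hΨe]
          exact (hmksurj.prodMap Function.surjective_id).comp e.surjective
        exact this.of_comp
    exact (hΨ.homeomorph Ψ).paracompactSpace_iff.2 inferInstance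

/-- A closed substack of a presentable stack. -/
lemma closedSubstack (A : ClosedSubstack X) : IsPresentable A.toBased := by
  obtain ⟨x₀, hx₀, hpar⟩ := hX.exists_atlas
  refine ⟨hX.isFibered.closedSubstack A, fun x y e => ?_, ?_⟩
  · obtain ⟨z, a, b, hab, hu, hsep, hprop⟩ := hX.diagonal x.obj y.obj e
    refine ⟨⟨z, A.mem_of_hom a x.property⟩, ObjectProperty.homMk a, ObjectProperty.homMk b, hab,
      fun t a₁ b₁ h => ?_, hsep, hprop⟩
    obtain ⟨m, ⟨h1, h2⟩, h3⟩ := hu t.obj a₁.hom b₁.hom h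
    exact ⟨ObjectProperty.homMk m, ⟨ObjectProperty.hom_ext _ h1, ObjectProperty.hom_ext _ h2⟩,
      fun m' ⟨h4, h5⟩ => ObjectProperty.hom_ext _ (h3 _ ⟨congrArg InducedCategory.Hom.hom h4,
        congrArg InducedCategory.Hom.hom h5⟩)⟩
  · obtain ⟨C, hC, hAC⟩ := A.exists_isClosed x₀
    obtain ⟨c, φ, hφ, hr⟩ := hX.isFibered.exists_restrict x₀ C
    have hφc : IsClosedEmbedding (X.p.map φ) := ⟨hφ, by rw [hr]; exact hC⟩
    let x₁ : A.toBased.obj := ⟨c, (hAC c φ).2 fun s => hr ▸ mem_range_self s⟩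
    have hfac : ∀ (y : A.toBased.obj) (k : y.obj ⟶ x₀), ∃ χ : y ⟶ x₁, χ.hom ≫ φ = k :=
      fun y k => by
        obtain ⟨χ, h⟩ := hX.isFibered.exists_factor φ hφ k fun s =>
          hr ▸ (hAC y.obj k).1 y.property s
        exact ⟨ObjectProperty.homMk χ, h⟩
    have hmono : ∀ {y : A.toBased.obj} {χ χ' : y ⟶ x₁}, χ.hom ≫ φ = χ'.hom ≫ φ → χ = χ' :=
      fun {y χ χ'} h => by
        refine ObjectProperty.hom_ext _ (hX.isFibered.hom_ext φ ?_ h)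
        ext s
        apply hφ.injective
        rw [← p_comp, ← p_comp, h]
    have hat : IsEtaleAtlas A.toBased x₁ := fun y => by
      obtain ⟨c', a, b, hs, hl, hsurj⟩ := hx₀ y.obj
      let c₁ : A.toBased.obj := ⟨c', A.mem_of_hom b y.property⟩
      obtain ⟨a', ha'⟩ := hfac c₁ a
      refine ⟨c₁, a', ObjectProperty.homMk b, fun t a₁ b₁ => ?_, hl, hsurj⟩
      obtain ⟨m, ⟨h1, h2⟩, h3⟩ := hs t.obj (a₁.hom ≫ φ) b₁.hom
      refine ⟨ObjectProperty.homMk m, ⟨hmono ?_, ObjectProperty.hom_ext _ h2⟩, ?_⟩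
      · change (m ≫ a'.hom) ≫ φ = _
        rw [Category.assoc, ha', h1]
      · rintro m' ⟨h4, h5⟩
        refine ObjectProperty.hom_ext _ (h3 _ ⟨?_, congrArg InducedCategory.Hom.hom h5⟩)
        rw [← h4, ← ha', ← Category.assoc]
        rfl
    refine ⟨x₁, hat, ?_⟩
    -- an isomorphism between points of the atlas, the first of which is in `A`, is one within `A`
    have hpt : ∀ {t t' : X.p.obj x₀}, OrbitRel x₀ t t' → t ∈ C → ∃ (w : A.toBased.obj)
        (s : X.p.obj w.obj) (k k' : w ⟶ x₁), X.p.map φ (X.p.map k.hom s) = t ∧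
          X.p.map φ (X.p.map k'.hom s) = t' := by
      rintro _ _ ⟨z, s, k, k', rfl, rfl⟩ ht
      obtain ⟨w, ψ, r, hw, rfl⟩ := hX.isFibered.exists_point z s
      let w₁ : A.toBased.obj := ⟨w, (hAC w (ψ ≫ k)).2 fun r' => by
        rw [Subsingleton.elim r' r, p_comp]
        exact ht⟩
      obtain ⟨χ, hχ⟩ := hfac w₁ (ψ ≫ k)
      obtain ⟨χ', hχ'⟩ := hfac w₁ (ψ ≫ k')
      refine ⟨w₁, r, χ, χ', ?_, ?_⟩
      · rw [← p_comp, hχ, p_comp]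
      · rw [← p_comp, hχ', p_comp]
    -- the quotient is a closed subspace
    let Ψ : OrbitSpace x₁ → OrbitSpace x₀ :=
      Quot.lift (fun t => OrbitSpace.mk (X.p.map φ t)) (by
        rintro _ _ ⟨w, s, k, k', rfl, rfl⟩
        exact (OrbitSpace.mk_eq_iff hX.isFibered).2 ⟨w.obj, s, k.hom ≫ φ, k'.hom ≫ φ,
          p_comp _ _ _, p_comp _ _ _⟩)
    have hΨm : ∀ t : X.p.obj c, Ψ (OrbitSpace.mk (x₀ := x₁) t) =
        OrbitSpace.mk (X.p.map φ t) := fun t => rfl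
    have hmksurj₁ := (OrbitSpace.isQuotientMap_mk (x₀ := x₁)).surjective
    have hrC : ∀ t, X.p.map φ t ∈ C := fun t => hr ▸ mem_range_self t
    have hinj : Function.Injective Ψ := fun t t' h => by
      obtain ⟨(t : X.p.obj c), rfl⟩ := hmksurj₁ t
      obtain ⟨(t' : X.p.obj c), rfl⟩ := hmksurj₁ t'
      rw [hΨm, hΨm] at h
      obtain ⟨w, s, k, k', hk, hk'⟩ := hpt ((OrbitSpace.mk_eq_iff hX.isFibered).1 h) (hrC t)
      exact (OrbitSpace.mk_eq_iff (hX.isFibered.closedSubstack A)).2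
        ⟨w, s, k, k', hφ.injective hk, hφ.injective hk'⟩
    have hΨ : IsClosedEmbedding Ψ := by
      refine IsClosedEmbedding.of_continuous_injective_isClosedMap ?_ hinj fun D hD => ?_
      · rw [(OrbitSpace.isQuotientMap_mk (x₀ := x₁)).continuous_iff]
        exact OrbitSpace.continuous_mk.comp (p_continuous φ)
      · rw [← OrbitSpace.isQuotientMap_mk.isClosed_preimage]
        convert hφc.isClosedMap _ (hD.preimage (OrbitSpace.continuous_mk (x₀ := x₁))) using 1
        ext t
        constructor
        · rintro ⟨d, hd, h⟩
          obtain ⟨(d : X.p.obj c), rfl⟩ := hmksurj₁ d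
          rw [hΨm] at h
          obtain ⟨w, s, k, k', hk, rfl⟩ :=
            hpt ((OrbitSpace.mk_eq_iff hX.isFibered).1 h) (hrC d)
          refine ⟨X.p.map k'.hom s, ?_, rfl⟩
          have : OrbitSpace.mk (x₀ := x₁) (X.p.map k'.hom s) = OrbitSpace.mk (x₀ := x₁) d :=
            hinj h.symm
          exact (congrArg (· ∈ D) this).mpr hd
        · rintro ⟨d, hd, rfl⟩
          exact ⟨_, hd, rfl⟩
    exact hΨ.paracompactSpace

end IsPresentable

/-! ### Products with spaces -/

section

variable {X : BasedCategory.{v, w} TopCat.{u}}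

/-- The projection `X × K → X`. -/
def prodProj (X : BasedCategory.{v, w} TopCat.{u}) (K : TopCat.{u}) : prodSpace X K ⥤ᵇ X where
  toFunctor := CostructuredArrow.proj X.p K
  w := rfl

namespace Presentation

variable (P : Presentation X)

/-- The map `X → X × L` whose second component is given by a function on the quotient. -/
def graph {L : TopCat.{u}} (θ : C(P.B, L)) : X ⥤ᵇ prodSpace X L where
  obj x := CostructuredArrow.mk (Y := x) (TopCat.ofHom (θ.comp ⟨P.q x, P.continuous_q x⟩))
  map f := CostructuredArrow.homMk f (by ext t; exact congrArg θ (P.q_map f t))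
  w := rfl

/-- The map `X × K → X × L` over `X` whose second component is given by a function of the point in
the quotient and the coordinate in `K`. -/
def reparam {K L : TopCat.{u}} (θ : C(P.B × K, L)) : prodSpace X K ⥤ᵇ prodSpace X L where
  obj y := CostructuredArrow.mk (Y := y.left)
    (TopCat.ofHom (θ.comp (ContinuousMap.prodMk ⟨P.q y.left, P.continuous_q y.left⟩ y.hom.hom)))
  map {y y'} f := CostructuredArrow.homMk f.left (by
    ext t
    refine congrArg θ (Prod.ext (P.q_map f.left t) ?_)
    exact ConcreteCategory.congr_hom (CostructuredArrow.w f) t)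
  w := rfl

/-- The points at which a homomorphism on `X × K` is bijective are the inverse image of an open
subset of `B × K`. -/
lemma exists_isOpen_bijective {K : TopCat.{u}} {E F : VectorBundle (prodSpace X K)}
    (h : VectorBundle.Hom E F) : ∃ O : Set (P.B × K), IsOpen O ∧
      ∀ (y : (prodSpace X K).obj) (t : X.p.obj y.left),
        (P.q y.left t, y.hom t) ∈ O ↔ Function.Bijective (h.fib y t) := by
  obtain ⟨x₁, φ, e, he, key⟩ := P.isFibered.exists_prod P.x₀ K
  let W : Set (X.p.obj x₁.left) := {t | Function.Bijective (h.fib x₁ t)}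
  have hW : IsOpen W := isOpen_iff_mem_nhds.2 fun t ht =>
    (h.fib_contAt x₁ t).eventually_bijective ht
  refine ⟨Prod.map (P.q P.x₀) id ∘ e '' W,
    ((P.isOpenMap_q.prodMap IsOpenMap.id).comp e.isOpenMap) _ hW, fun y t => ?_⟩
  obtain ⟨γ, ψ, (s : X.p.obj γ.left), hγ, hst⟩ := (P.isFibered.prodSpace K).exists_point y t
  have hγ' : Subsingleton (X.p.obj γ.left) := hγ
  have hψ : X.p.map ψ.left s = t := hst
  subst hψ
  have hq : P.q y.left (X.p.map ψ.left s) = P.q γ.left s := P.q_map _ _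
  have hc : y.hom (X.p.map ψ.left s) = γ.hom s :=
    ConcreteCategory.congr_hom (CostructuredArrow.w ψ) s
  have h1 : Function.Bijective (h.fib y (X.p.map ψ.left s)) ↔ Function.Bijective (h.fib γ s) := by
    rw [← h.fib_pull ψ]
    exact (VectorBundle.FibHom.bijective_pull_iff (h.fib y) ψ s).symm
  rw [h1, hq, hc]
  have h2 : ∀ χ : γ ⟶ x₁, Function.Bijective (h.fib γ s) ↔ X.p.map χ.left s ∈ W := fun χ => by
    rw [← h.fib_pull χ]
    exact VectorBundle.FibHom.bijective_pull_iff (h.fib x₁) χ s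
  have h3 : ∀ χ : γ ⟶ x₁, e (X.p.map χ.left s) = (X.p.map (χ.left ≫ φ) s, γ.hom s) := fun χ =>
    (he _).trans (Prod.ext (p_comp χ.left φ s).symm
      (ConcreteCategory.congr_hom (CostructuredArrow.w χ) s))
  constructor
  · rintro ⟨t', ht', h4⟩
    obtain ⟨k, hk⟩ := P.exists_arrow (z := γ.left) s (X.p.map φ t') (by
      have := congrArg Prod.fst h4
      rwa [Function.comp_apply, he] at this)
    obtain ⟨χ, hχ, -⟩ := key γ k
    rw [h2 χ]
    have : X.p.map χ.left s = t' := by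
      apply e.injective
      rw [h3, hχ, hk, he]
      refine Prod.ext rfl ?_
      have := congrArg Prod.snd h4
      rw [Function.comp_apply, he] at this
      exact this.symm
    rwa [this]
  · intro h4
    obtain ⟨u, hu⟩ := P.surjective_q (P.q γ.left s)
    obtain ⟨k, hk⟩ := P.exists_arrow (z := γ.left) s u hu
    obtain ⟨χ, hχ, -⟩ := key γ k
    refine ⟨X.p.map χ.left s, (h2 χ).1 h4, ?_⟩
    rw [Function.comp_apply, h3, hχ, hk]
    exact Prod.ext hu rfl

end Presentation

end

namespace VectorBundle

variable {X : BasedCategory.{v, w} TopCat.{u}} {E F : VectorBundle X}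

/-- Isomorphisms of vector bundles given over the members of an open cover of the stack, which
agree at points, glue. -/
lemma exists_iso_of_cover (hX : IsFibered X) {ι : Type*} (S : ι → X.obj → Prop)
    (ρ : ∀ i y, S i y → FibHom E F y) (hS : ∀ i {x y : X.obj} (_ : x ⟶ y), S i y → S i x)
    (hρ : ∀ i {x y : X.obj} (f : x ⟶ y) (hx : S i x) (hy : S i y), (ρ i y hy).pull f = ρ i x hx)
    (hloc : ∀ y (t : X.p.obj y), ∃ (i : ι) (x : X.obj) (ψ : x ⟶ y), S i x ∧
      IsOpenMap (X.p.map ψ) ∧ t ∈ range (X.p.map ψ))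
    (hag : ∀ i j z, Subsingleton (X.p.obj z) → ∀ hi hj, ρ i z hi = ρ j z hj)
    (hc : ∀ i y h t, (ρ i y h).ContAt t) (hb : ∀ i y h t, Function.Bijective (ρ i y h t)) :
    Nonempty (Iso E F) := by
  classical
  let N : ∀ z : X.obj, Subsingleton (X.p.obj z) → FibHom E F z := fun z _ =>
    if h : ∃ i, S i z then ρ h.choose z h.choose_spec else 0
  have hN : ∀ i z (hz : Subsingleton (X.p.obj z)) (h : S i z), N z hz = ρ i z h := fun i z hz h => by
    have h' : ∃ i, S i z := ⟨i, h⟩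
    exact (dif_pos h').trans (hag _ _ z hz _ _)
  have hNp : ∀ {z z' : X.obj} (hz : Subsingleton (X.p.obj z)) (hz' : Subsingleton (X.p.obj z'))
      (f : z ⟶ z'), (N z' hz').pull f = N z hz := fun {z z'} hz hz' f => by
    refine FibHom.ext_point hX fun γ φ hγ => ?_
    by_cases hne : Nonempty (X.p.obj γ)
    · obtain ⟨s⟩ := hne
      obtain ⟨i, x, ψ, hx, -, ⟨r, hr⟩⟩ := hloc z' (X.p.map f (X.p.map φ s))
      obtain ⟨χ, -, -⟩ := hX.exists_factor_point ψ (𝟙 z') (X.p.map f (X.p.map φ s)) r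
        (by rw [hr, p_id])
      have hz'S := hS i χ hx
      rw [hN i z' hz' hz'S, hN i z hz (hS i f hz'S), hρ i f (hS i f hz'S)]
    · exact funext fun s => (hne ⟨s⟩).elim
  have hres : ∀ i y (h : S i y), FibHom.ofPoints hX N y = ρ i y h := fun i y h => by
    refine FibHom.ext_point hX fun z φ hz => ?_
    rw [FibHom.ofPoints_pull_point hX hNp hz, hN i z hz (hS i φ h), hρ i φ (hS i φ h)]
  have hpull := fun {x y : X.obj} (f : x ⟶ y) => FibHom.ofPoints_pull hX hNp f
  let H : Hom E F := Hom.ofFib (FibHom.ofPoints hX N) hpull fun y t => by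
    obtain ⟨i, x, ψ, hx, ho, ⟨s, rfl⟩⟩ := hloc y t
    refine FibHom.contAt_of_pull ψ ho ?_
    rw [hpull, hres i x hx]
    exact hc i x hx s
  refine ⟨Iso.ofHom H fun y t => ?_⟩
  obtain ⟨i, x, ψ, hx, ho, ⟨s, rfl⟩⟩ := hloc y t
  rw [Hom.fib_ofFib, ← FibHom.bijective_pull_iff, hpull, hres i x hx]
  exact hb i x hx s

end VectorBundle

namespace VectorBundle

variable {X : BasedCategory.{v, w} TopCat.{u}} {Y : BasedCategory.{v', w'} TopCat.{u}}
  {E F : VectorBundle X}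

/-- A family of linear maps between fibers given by a map of total spaces. -/
def FibHom.ofTot {y : X.obj} (m : E.total.obj y → F.total.obj y)
    (hp : ∀ a, F.proj.app y (m a) = E.proj.app y a)
    (ha : ∀ a b h h', m (E.vadd y a b h) = F.vadd y (m a) (m b) h')
    (hs : ∀ c a, m (E.smul y c a) = F.smul y c (m a)) : FibHom E F y := fun _ =>
  { toFun := fun a => ⟨m a.val, (hp _).trans a.proj_val⟩
    map_add' := fun _ _ => Fib.ext (ha _ _ _ _)
    map_smul' := fun _ _ => Fib.ext (hs _ _) }

lemma FibHom.bijective_ofTot {y : X.obj} {m : E.total.obj y → F.total.obj y}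
    (hp : ∀ a, F.proj.app y (m a) = E.proj.app y a)
    (ha : ∀ a b h h', m (E.vadd y a b h) = F.vadd y (m a) (m b) h')
    (hs : ∀ c a, m (E.smul y c a) = F.smul y c (m a)) (hm : Function.Bijective m)
    (t : X.p.obj y) : Function.Bijective (FibHom.ofTot m hp ha hs t) := by
  constructor
  · intro a b h
    exact Fib.ext (hm.1 (congrArg Fib.val h))
  · intro b
    obtain ⟨a, h⟩ := hm.2 b.val
    exact ⟨⟨a, by rw [← hp, h, b.proj_val]⟩, Fib.ext h⟩

lemma bijective_map (E : VectorBundle X) {x y : X.obj} (f : x ⟶ y)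
    (hf : Function.Bijective (X.p.map f)) : Function.Bijective (E.total.map f) := by
  constructor
  · intro a b h
    refine E.pullback_point_ext f h (hf.1 ?_)
    rw [← proj_map, ← proj_map, h]
  · intro b
    obtain ⟨s, hs⟩ := hf.2 (E.proj.app y b)
    obtain ⟨a, ha, -⟩ := E.exists_pullback_point f s b hs.symm
    exact ⟨a, ha⟩

lemma p_map_natTrans {F G : Y ⥤ᵇ X} (α : F ⟶ G) (y : Y.obj) :
    X.p.map (α.toNatTrans.app y) ≫ (eqToHom G.w : G.toFunctor ⋙ X.p ⟶ Y.p).app y =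
      (eqToHom F.w : F.toFunctor ⋙ X.p ⟶ Y.p).app y := by
  have := α.isHomLift' y
  rw [IsHomLift.fac' X.p (𝟙 (Y.p.obj y)) (α.toNatTrans.app y)]
  simp [eqToHom_app]

/-- Isomorphic maps of stacks have isomorphic pullbacks: the homomorphism given by the action of
morphisms on the total spaces. -/
def Hom.ofNatTrans (E : VectorBundle X) {F G : Y ⥤ᵇ X} (α : F ⟶ G) :
    Hom (E.pullback F) (E.pullback G) where
  toFun y := E.total.map (α.toNatTrans.app y)
  continuous y := E.continuous_map _
  naturality {x y} f a := by
    refine (E.map_comp_apply (F.map f) (α.toNatTrans.app y) a).symm.trans ?_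
    rw [α.toNatTrans.naturality]
    exact E.map_comp_apply _ _ a
  proj_eq y a := by
    refine (congrArg ((eqToHom G.w : G.toFunctor ⋙ X.p ⟶ Y.p).app y)
      (E.proj_map (α.toNatTrans.app y) a)).trans ?_
    exact ConcreteCategory.congr_hom (p_map_natTrans α y) (E.proj.app _ a)
  map_vadd y a b h h' := E.map_vadd _ _ _ _ _
  map_smul y c a := E.map_smul _ _ _

end VectorBundle

/-! ### Bundles on the product with an interval -/

instance : CompactSpace interval.{u} := inferInstanceAs (CompactSpace (ULift.{u} unitInterval))

instance : T2Space interval.{u} := inferInstanceAs (T2Space (ULift.{u} unitInterval))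

/-- The square `[0,1] × [0,1]`. -/
def square : TopCat.{u} := TopCat.of (interval.{u} × interval.{u})

instance : CompactSpace square.{u} :=
  inferInstanceAs (CompactSpace (interval.{u} × interval.{u}))

instance : T2Space square.{u} := inferInstanceAs (T2Space (interval.{u} × interval.{u}))

variable {X : BasedCategory.{v, w} TopCat.{u}}

/-- A morphism of `X` which is compatible with the coordinates in `K`, as a morphism of `X × K`. -/
def prodHomMk {K : TopCat.{u}} {y y' : (prodSpace X K).obj} (f : y.left ⟶ y'.left)
    (h : ∀ t, y'.hom (X.p.map f t) = y.hom t) : y ⟶ y' :=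
  CostructuredArrow.homMk f (by ext t; exact h t)

/-- Objects of `X × K` over the same object of `X` with equal coordinates. -/
def prodHomOfEq {K : TopCat.{u}} (x : X.obj) (c c' : X.p.obj x ⟶ K) (h : ∀ t, c t = c' t) :
    (CostructuredArrow.mk c : (prodSpace X K).obj) ⟶
      (CostructuredArrow.mk c' : (prodSpace X K).obj) :=
  prodHomMk (𝟙 x) fun t => by
    refine Eq.trans ?_ (h t).symm
    exact congrArg c' (p_id x t)

lemma isHomLift_prodHomOfEq {K : TopCat.{u}} (x : X.obj) (c c' : X.p.obj x ⟶ K)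
    (h : ∀ t, c t = c' t) : (prodSpace X K).p.IsHomLift (𝟙 (X.p.obj x)) (prodHomOfEq x c c' h) :=
  (congrArg (fun g => (prodSpace X K).p.IsHomLift g (prodHomOfEq x c c' h)) (X.p.map_id x)).mp
    (IsHomLift.map (prodSpace X K).p (prodHomOfEq x c c' h))

/-- The closed substack of `X × [0,1] × [0,1]` where the two coordinates agree. -/
def diagonalSubstack (X : BasedCategory.{v, w} TopCat.{u}) :
    ClosedSubstack (prodSpace X square) where
  mem y := ∀ t, (y.hom t).1 = (y.hom t).2
  exists_isClosed y := by
    refine ⟨{t | (y.hom t).1 = (y.hom t).2},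
      isClosed_eq (continuous_fst.comp y.hom.hom.continuous)
        (continuous_snd.comp y.hom.hom.continuous), fun z f => forall_congr' fun t => ?_⟩
    have : z.hom t = y.hom (X.p.map f.left t) :=
      (ConcreteCategory.congr_hom (CostructuredArrow.w f) t).symm
    rw [this]
    rfl

namespace Presentation

variable (P : Presentation X)

/-- The projection `X × [0,1] × [0,1] → X × [0,1]` to the first coordinate. -/
abbrev fstCoord : prodSpace X square ⥤ᵇ prodSpace X interval :=
  P.reparam ⟨fun q => q.2.1, continuous_fst.comp continuous_snd⟩

/-- The projection `X × [0,1] × [0,1] → X × [0,1]` to the second coordinate. -/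
abbrev sndCoord : prodSpace X square ⥤ᵇ prodSpace X interval :=
  P.reparam ⟨fun q => q.2.2, continuous_snd.comp continuous_snd⟩

/-- The projections to the two coordinates agree on the diagonal. -/
def diagonalTrans :
    (diagonalSubstack X).incl.comp P.fstCoord ⟶ (diagonalSubstack X).incl.comp P.sndCoord where
  app y := prodHomOfEq y.obj.left _ _ y.property
  naturality _ _ _ := CostructuredArrow.hom_ext _ _
    ((Category.comp_id _).trans (Category.id_comp _).symm)
  isHomLift' _ := isHomLift_prodHomOfEq _ _ _ _

end Presentation

/-- The tautological isomorphism over the diagonal between the two pullbacks of a bundle `E` on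
`X × [0,1]` to `X × [0,1] × [0,1]` extends to a homomorphism: a parallel transport between the
fibers of `E` over `(x, s)` and `(x, t)`, which need not be invertible or compatible with composition. -/
lemma exists_extension_diagonal (hX : IsPresentable X) (P : Presentation X)
    (E : VectorBundle (prodSpace X interval)) :
    ∃ Φ : VectorBundle.Hom (E.pullback P.fstCoord) (E.pullback P.sndCoord),
      ∀ (y : (diagonalSubstack X).toBased.obj) (a : E.total.obj (P.fstCoord.obj y.obj)),
        Φ.toFun y.obj a = E.total.map (P.diagonalTrans.toNatTrans.app y) a := by
  obtain ⟨Q⟩ := (hX.prodSpace square).nonempty_presentation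
  exact VectorBundle.Hom.exists_extension Q
    (E := E.pullback P.fstCoord) (F := E.pullback P.sndCoord) (A := diagonalSubstack X)
    (VectorBundle.Hom.ofNatTrans E P.diagonalTrans)

namespace Presentation

variable (P : Presentation X)

/-- If a homomorphism on `X × [0,1] × [0,1]` is bijective on the diagonal, then it is bijective near
the diagonal, with a distance that varies continuously on the quotient. -/
lemma exists_distance {E F : VectorBundle (prodSpace X square)} (h : VectorBundle.Hom E F)
    (hd : ∀ (y : (prodSpace X square).obj) (t : X.p.obj y.left), (y.hom t).1 = (y.hom t).2 →
      Function.Bijective (h.fib y t)) :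
    ∃ ε : C(P.B, ℝ), (∀ ξ, 0 < ε ξ) ∧ ∀ (y : (prodSpace X square).obj) (t : X.p.obj y.left),
      dist (y.hom t).1.down (y.hom t).2.down ≤ ε (P.q y.left t) →
        Function.Bijective (h.fib y t) := by
  obtain ⟨O, hO, hOh⟩ := P.exists_isOpen_bijective h
  let T : P.B → Set ℝ := fun ξ =>
    {δ | 0 < δ ∧ ∀ d : square, dist d.1.down d.2.down ≤ δ → (ξ, d) ∈ O}
  have hT : ∀ ξ, Convex ℝ (T ξ) := fun ξ => by
    refine Set.OrdConnected.convex ⟨fun a ha b hb c hc => ⟨ha.1.trans_le hc.1, fun d hd => ?_⟩⟩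
    exact hb.2 d (hd.trans hc.2)
  have hdiag : ∀ ξ, ({ξ} : Set P.B) ×ˢ ({d : square | d.1 = d.2} : Set square) ⊆ O := by
    rintro ξ ⟨ξ', d⟩ ⟨rfl, hdd⟩
    obtain ⟨t, rfl⟩ := P.surjective_q ξ'
    exact (hOh (CostructuredArrow.mk (Y := P.x₀)
      (TopCat.ofHom (ContinuousMap.const (X.p.obj P.x₀) d))) t).2 (hd _ _ hdd)
  obtain ⟨ε, hε⟩ := exists_continuous_forall_mem_convex_of_local_const hT fun ξ => by
    obtain ⟨U, V, hU, hV, hξU, hVd, hUV⟩ := generalized_tube_lemma isCompact_singleton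
      ((isClosed_eq continuous_fst continuous_snd :
        IsClosed ({d : square | d.1 = d.2} : Set square)).isCompact) hO (hdiag ξ)
    have hV' : V ∈ uniformity (ULift.{u} unitInterval) := by
      rw [← nhdsSet_diagonal_eq_uniformity]
      exact (IsOpen.mem_nhdsSet (X := ULift.{u} unitInterval × ULift.{u} unitInterval) hV).2
        fun d hd => hVd hd
    obtain ⟨δ, hδ, hδV⟩ := Metric.mem_uniformity_dist.1 hV'
    refine ⟨δ / 2, ?_⟩
    filter_upwards [hU.mem_nhds (hξU rfl)] with ξ' hξ'
    refine ⟨half_pos hδ, fun d hd => hUV (mk_mem_prod hξ' ?_)⟩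
    exact hδV (a := d.1) (b := d.2) (lt_of_le_of_lt hd (half_lt_self hδ))
  exact ⟨ε, fun ξ => (hε ξ).1, fun y t h => (hOh y t).1 ((hε _).2 _ h)⟩

variable (ε : C(P.B, ℝ))

/-- The functions `min c (k ε)`, which for large `k` agree with the coordinate `c`. -/
def truncation : ℕ → C(P.B × interval.{u}, interval.{u})
  | 0 => ContinuousMap.const _ (ULift.up 0)
  | k + 1 => ⟨fun q => ULift.up (min q.2.down (Set.projIcc 0 1 zero_le_one ((k + 1) * ε q.1))), by
      have : Continuous fun q : P.B × interval.{u} =>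
        min q.2.down (Set.projIcc (0 : ℝ) 1 zero_le_one ((k + 1) * ε q.1)) :=
        (continuous_uliftDown.comp continuous_snd).min
          (continuous_projIcc.comp (continuous_const.mul (ε.continuous.comp continuous_fst)))
      exact continuous_uliftUp.comp this⟩

variable {P}

lemma truncation_apply (k : ℕ) (q : P.B × interval.{u}) :
    P.truncation ε k q = ULift.up (min q.2.down (Set.projIcc 0 1 zero_le_one (k * ε q.1))) := by
  cases k with
  | zero =>
    refine congrArg ULift.up ?_
    rw [Nat.cast_zero, zero_mul, Set.projIcc_left]
    exact (min_eq_right bot_le).symm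
  | succ k =>
    rw [Nat.cast_succ]
    rfl

lemma dist_truncation_le (k : ℕ) (q : P.B × interval.{u}) (h : 0 ≤ ε q.1) :
    dist (P.truncation ε k q).down (P.truncation ε (k + 1) q).down ≤ ε q.1 := by
  rw [truncation_apply, truncation_apply, Subtype.dist_eq, Real.dist_eq]
  have h1 := abs_min_sub_min_le_max (q.2.down : ℝ)
    (Set.projIcc (0 : ℝ) 1 zero_le_one (k * ε q.1) : ℝ) q.2.down
    (Set.projIcc (0 : ℝ) 1 zero_le_one ((k + 1 : ℕ) * ε q.1) : ℝ)
  have h2 := abs_projIcc_sub_projIcc (a := (0 : ℝ)) (b := 1) zero_le_one (c := k * ε q.1)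
    (d := (k + 1 : ℕ) * ε q.1)
  have h3 : |(k * ε q.1) - (k + 1 : ℕ) * ε q.1| = ε q.1 := by
    rw [Nat.cast_succ, ← sub_mul, sub_add_cancel_left, neg_one_mul, abs_neg, abs_of_nonneg h]
  rw [sub_self, abs_zero, max_eq_right (abs_nonneg _)] at h1
  exact h1.trans (h2.trans h3.le)

lemma truncation_eq_of_le {k : ℕ} {q : P.B × interval.{u}} (h : (q.2.down : ℝ) ≤ k * ε q.1) :
    P.truncation ε k q = q.2 := by
  rw [truncation_apply]
  refine congrArg ULift.up (min_eq_left ?_)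
  rw [← Set.projIcc_val zero_le_one q.2.down]
  exact Set.monotone_projIcc _ h

end Presentation

/-! ### Homotopy invariance of bundles -/

variable {X : BasedCategory.{v, w} TopCat.{u}}

/-- The restriction of a bundle to `X × {0}`, pulled back to `X × [0,1]`. -/
abbrev VectorBundle.atZero (E : VectorBundle (prodSpace X interval.{u})) :
    VectorBundle (prodSpace X interval.{u}) :=
  (E.pullback (prodIncl X interval (ULift.up 0))).pullback (prodProj X interval)

namespace Presentation

variable (P : Presentation X) (ε : C(P.B, ℝ))

/-- The map from `X × [0,1]` to `X × [0,1] × [0,1]` given by two consecutive truncations. -/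
def truncationPair (k : ℕ) : prodSpace X interval ⥤ᵇ prodSpace X square :=
  P.reparam (K := interval.{u}) (L := square.{u})
    ((P.truncation ε k).prodMk (P.truncation ε (k + 1)))

variable {P} {E : VectorBundle (prodSpace X interval.{u})}
  (Φ : VectorBundle.Hom (E.pullback P.fstCoord) (E.pullback P.sndCoord))

/-- The homomorphism between the pullbacks of `E` along consecutive truncations. -/
def stepHom (k : ℕ) : VectorBundle.Hom (E.pullback (P.reparam (P.truncation ε k)))
    (E.pullback (P.reparam (P.truncation ε (k + 1)))) :=
  Φ.pullback (P.truncationPair ε k)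

/-- The composition of the homomorphisms between the pullbacks of `E` along truncations. -/
def compHom : ∀ k : ℕ, VectorBundle.Hom E.atZero (E.pullback (P.reparam (P.truncation ε k)))
  | 0 => (VectorBundle.Iso.refl E.atZero).toHom
  | k + 1 => (compHom k).comp (stepHom ε Φ k)

lemma bijective_compHom (hε : ∀ ξ, 0 ≤ ε ξ)
    (hΦ : ∀ (y : (prodSpace X square.{u}).obj) (t : X.p.obj y.left),
      dist (y.hom t).1.down (y.hom t).2.down ≤ ε (P.q y.left t) → Function.Bijective (Φ.fib y t))
    (k : ℕ) (y : (prodSpace X interval.{u}).obj) :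
    Function.Bijective ((compHom ε Φ k).toFun y) := by
  induction k with
  | zero => exact Function.bijective_id
  | succ k ih =>
    have h := (Φ.bijective_fib_iff ((P.truncationPair ε k).obj y)).1 fun t =>
      hΦ _ t (dist_truncation_le ε k (P.q y.left t, y.hom t) (hε _))
    exact h.comp ih

/-- The objects of `X × [0,1]` on which the `k`-th truncation agrees with the coordinate. -/
def IsStable (k : ℕ) (y : (prodSpace X interval.{u}).obj) : Prop :=
  ∀ t : X.p.obj y.left, ((y.hom t).down : ℝ) ≤ k * ε (P.q y.left t)

variable {ε}

lemma IsStable.truncation_eq {k : ℕ} {y : (prodSpace X interval.{u}).obj} (h : IsStable ε k y)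
    (t : X.p.obj y.left) : P.truncation ε k (P.q y.left t, y.hom t) = y.hom t :=
  truncation_eq_of_le ε (h t)

lemma IsStable.of_hom {k : ℕ} {x y : (prodSpace X interval.{u}).obj} (f : x ⟶ y)
    (h : IsStable ε k y) : IsStable ε k x := fun t => by
  have h1 : y.hom (X.p.map f.left t) = x.hom t :=
    ConcreteCategory.congr_hom (CostructuredArrow.w f) t
  have h2 := h (X.p.map f.left t)
  rwa [h1, P.q_map f.left t] at h2

/-- On stable objects, the truncation is the identity. -/
def IsStable.hom {k : ℕ} {y : (prodSpace X interval.{u}).obj} (h : IsStable ε k y) :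
    (P.reparam (P.truncation ε k)).obj y ⟶ y :=
  prodHomOfEq y.left _ y.hom h.truncation_eq

lemma IsStable.hom_natural {k : ℕ} {x y : (prodSpace X interval.{u}).obj} (hx : IsStable ε k x)
    (hy : IsStable ε k y) (f : x ⟶ y) :
    (P.reparam (P.truncation ε k)).map f ≫ hy.hom = hx.hom ≫ f :=
  CostructuredArrow.hom_ext _ _ ((Category.comp_id _).trans (Category.id_comp _).symm)

/-- The homomorphism to `E`, on stable objects. -/
def stableFun {k : ℕ} {y : (prodSpace X interval.{u}).obj} (h : IsStable ε k y) :
    E.atZero.total.obj y → E.total.obj y :=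
  fun a => E.total.map h.hom ((compHom ε Φ k).toFun y a)

lemma proj_stableFun {k : ℕ} {y : (prodSpace X interval.{u}).obj} (h : IsStable ε k y)
    (a : E.atZero.total.obj y) : E.proj.app y (stableFun Φ h a) = E.atZero.proj.app y a := by
  refine (E.proj_map h.hom _).trans ?_
  refine (p_id y.left _).trans ?_
  exact (compHom ε Φ k).proj_eq y a

lemma stableFun_natural {k : ℕ} {x y : (prodSpace X interval.{u}).obj} (hx : IsStable ε k x)
    (hy : IsStable ε k y) (f : x ⟶ y) (a : E.atZero.total.obj x) :
    stableFun Φ hy (E.atZero.total.map f a) = E.total.map f (stableFun Φ hx a) := by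
  have h1 := congrArg (E.total.map hy.hom) ((compHom ε Φ k).naturality f a)
  refine h1.trans ?_
  refine (E.map_comp_apply ((P.reparam (P.truncation ε k)).map f) hy.hom _).symm.trans ?_
  rw [IsStable.hom_natural hx hy f]
  exact E.map_comp_apply _ _ _

lemma bijective_stableFun {k : ℕ} {y : (prodSpace X interval.{u}).obj} (h : IsStable ε k y)
    (hb : Function.Bijective ((compHom ε Φ k).toFun y)) : Function.Bijective (stableFun Φ h) := by
  refine (E.bijective_map h.hom ?_).comp hb
  have : (X.p.map (𝟙 y.left) : X.p.obj y.left → X.p.obj y.left) = id := funext (p_id y.left)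
  exact this ▸ Function.bijective_id

lemma stableFun_succ (hΦ : ∀ (y : (diagonalSubstack X).toBased.obj)
      (a : E.total.obj (P.fstCoord.obj y.obj)),
        Φ.toFun y.obj a = E.total.map (P.diagonalTrans.toNatTrans.app y) a)
    {k : ℕ} {y : (prodSpace X interval.{u}).obj} (h : IsStable ε k y) (h' : IsStable ε (k + 1) y) :
    stableFun Φ h' = stableFun Φ h := by
  funext a
  let y' : (diagonalSubstack X).toBased.obj := ⟨(P.truncationPair ε k).obj y, fun t =>
    (h.truncation_eq t).trans (h'.truncation_eq t).symm⟩
  have h1 := congrArg (E.total.map h'.hom) (hΦ y' ((compHom ε Φ k).toFun y a))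
  refine h1.trans ?_
  refine (E.map_comp_apply (P.diagonalTrans.toNatTrans.app y') h'.hom _).symm.trans ?_
  have h2 : P.diagonalTrans.toNatTrans.app y' ≫ h'.hom = h.hom :=
    CostructuredArrow.hom_ext _ _ (Category.comp_id _)
  rw [h2]
  rfl

end Presentation

/-- **Homotopy invariance**: a bundle on `X × [0,1]` is pulled back from its restriction to
`X × {0}`.  Parallel transport is invertible over distances less than some `ε`, which varies
continuously on the quotient.  The isomorphism at `(x, c)` is the composition of the transports
between the consecutive points `min c (k ε)`; for `k ε ≥ c` it does not depend on `k`. -/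
theorem VectorBundle.exists_iso_atZero (hX : IsPresentable X)
    (E : VectorBundle (prodSpace X interval.{u})) : Nonempty (VectorBundle.Iso E.atZero E) := by
  obtain ⟨P⟩ := hX.nonempty_presentation
  obtain ⟨Φ, hΦ⟩ := exists_extension_diagonal hX P E
  obtain ⟨ε, hε, hεΦ⟩ := P.exists_distance Φ fun y t hyt => by
    obtain ⟨γ, ψ, (s : X.p.obj γ.left), hγ, hst⟩ :=
      (hX.isFibered.prodSpace square).exists_point y t
    have hγ' : Subsingleton (X.p.obj γ.left) := hγ
    let γ' : (diagonalSubstack X).toBased.obj := ⟨γ, fun s' => by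
      have h1 : y.hom (X.p.map ψ.left s) = γ.hom s :=
        ConcreteCategory.congr_hom (CostructuredArrow.w ψ) s
      have h2 : X.p.map ψ.left s = t := hst
      rw [h2] at h1
      rw [Subsingleton.elim s' s, ← h1]
      exact hyt⟩
    have h3 : Function.Bijective (Φ.toFun γ) := by
      rw [funext (hΦ γ')]
      refine E.bijective_map _ ?_
      have : (X.p.map (𝟙 γ.left) : X.p.obj γ.left → X.p.obj γ.left) = id :=
        funext (p_id γ.left)
      exact this ▸ Function.bijective_id
    have h4 := (Φ.bijective_fib_iff γ).2 h3 s
    rw [← Φ.fib_pull ψ] at h4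
    have h5 := ((Φ.fib y).bijective_pull_iff ψ s).1 h4
    rwa [hst] at h5
  have hε' : ∀ ξ, 0 ≤ ε ξ := fun ξ => (hε ξ).le
  have hmono : ∀ {y : (prodSpace X interval.{u}).obj} (i j : ℕ), i ≤ j →
      ∀ (hi : Presentation.IsStable ε i y) (hj : Presentation.IsStable ε j y),
      Presentation.stableFun Φ hj = Presentation.stableFun Φ hi := fun {y} i j hij => by
    induction j, hij using Nat.le_induction with
    | base => exact fun _ _ => rfl
    | succ j hij ih =>
      intro hi hj
      have hj' : Presentation.IsStable ε j y := fun t => (hi t).trans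
        (mul_le_mul_of_nonneg_right (by exact_mod_cast hij) (hε' _))
      exact (Presentation.stableFun_succ Φ hΦ hj' hj).trans (ih hi hj')
  refine exists_iso_of_cover (hX.isFibered.prodSpace interval) (Presentation.IsStable ε)
    (fun k y h => FibHom.ofTot (Presentation.stableFun Φ h) (Presentation.proj_stableFun Φ h)
      (fun a b e e' => ?_) (fun c a => ?_)) (fun k {x y} f h => h.of_hom f)
    (fun k {x y} f hx hy => ?_) (fun y t => ?_) (fun i j z hz hi hj => ?_) (fun k y h t => ?_)
    (fun k y h t => ?_)
  · refine (congrArg (E.total.map h.hom) ((Presentation.compHom ε Φ k).map_vadd y a b e ?_)).trans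
      (E.map_vadd h.hom _ _ _ _)
    exact ((Presentation.compHom ε Φ k).proj_eq y a).trans
      (e.trans ((Presentation.compHom ε Φ k).proj_eq y b).symm)
  · exact (congrArg (E.total.map h.hom) ((Presentation.compHom ε Φ k).map_smul y c a)).trans
      (E.map_smul h.hom _ _)
  · exact (FibHom.pull_eq_iff _ f _).2 fun a => (Presentation.stableFun_natural Φ hx hy f a).symm
  · obtain ⟨k, hk⟩ := exists_nat_gt (((y.hom t).down : ℝ) / ε (P.q y.left t))
    let U : Set (X.p.obj y.left) := {t | ((y.hom t).down : ℝ) < k * ε (P.q y.left t)}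
    have hU : IsOpen U := isOpen_lt
      (continuous_subtype_val.comp (continuous_uliftDown.comp y.hom.hom.continuous))
      (continuous_const.mul (ε.continuous.comp (P.continuous_q y.left)))
    obtain ⟨x, ψ, hψ, hr⟩ := (hX.isFibered.prodSpace interval).exists_restrict y U
    refine ⟨k, x, ψ, fun t' => ?_, (IsOpenEmbedding.mk hψ (hr ▸ hU)).isOpenMap, ?_⟩
    · have h1 : y.hom (X.p.map ψ.left t') = x.hom t' :=
        ConcreteCategory.congr_hom (CostructuredArrow.w ψ) t'
      have h2 : X.p.map ψ.left t' ∈ U := hr ▸ mem_range_self t'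
      have h3 : P.q y.left (X.p.map ψ.left t') = P.q x.left t' := P.q_map _ _
      rw [← h1, ← h3]
      exact h2.le
    · rw [hr]
      exact (div_lt_iff₀ (hε _)).1 hk
  · rcases le_total i j with hij | hij
    · exact FibHom.ext_tot fun a => (congrFun (hmono i j hij hi hj) a).symm
    · exact FibHom.ext_tot fun a => congrFun (hmono j i hij hj hi) a
  · intro a _
    exact ((E.continuous_map h.hom).comp ((Presentation.compHom ε Φ k).continuous y)).continuousAt
  · exact FibHom.bijective_ofTot _ _ _ (Presentation.bijective_stableFun Φ h
      (Presentation.bijective_compHom ε Φ hε' hεΦ k y)) t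

/-! ### Extension of automorphisms which are homotopic to the identity -/

variable {X : BasedCategory.{v, w} TopCat.{u}}

/-- The closed substack `A × [0,1]` of `X × [0,1]`. -/
def ClosedSubstack.cylinder (A : ClosedSubstack X) :
    ClosedSubstack (prodSpace X interval.{u}) where
  mem y := A.mem y.left
  exists_isClosed y := by
    obtain ⟨C, hC, h⟩ := A.exists_isClosed y.left
    exact ⟨C, hC, fun z f => h z.left f.left⟩

/-- The closed substack `A × [0,1]`, as the product of `A` with the interval. -/
def ClosedSubstack.cylinderToProd (A : ClosedSubstack X) :
    A.cylinder.toBased ⥤ᵇ prodSpace A.toBased interval.{u} where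
  obj y := CostructuredArrow.mk (Y := (⟨y.obj.left, y.property⟩ : A.toBased.obj)) y.obj.hom
  map f := CostructuredArrow.homMk (ObjectProperty.homMk f.hom.left) (CostructuredArrow.w f.hom)
  w := rfl

/-- The points of the quotient in a closed substack form a closed set. -/
lemma Presentation.isClosed_image (P : Presentation X) (A : ClosedSubstack X) :
    IsClosed {ξ : P.B | ∃ (y : X.obj) (t : X.p.obj y), A.mem y ∧ P.q y t = ξ} := by
  obtain ⟨C, hC, hAC⟩ := A.exists_isClosed P.x₀
  have hq := P.isOpenMap_q.isQuotientMap (P.continuous_q _) P.surjective_q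
  rw [← hq.isClosed_preimage]
  convert hC using 1
  ext t
  constructor
  · rintro ⟨y, s, hy, h⟩
    obtain ⟨z, φ, r, hz, rfl⟩ := P.isFibered.exists_point y s
    rw [P.q_map] at h
    obtain ⟨k, rfl⟩ := P.exists_arrow r t h.symm
    exact (hAC z k).1 (A.mem_of_hom φ hy) r
  · intro ht
    obtain ⟨z, φ, s, hz, rfl⟩ := P.isFibered.exists_point P.x₀ t
    refine ⟨z, s, (hAC z φ).2 fun s' => ?_, (P.q_map _ _).symm⟩
    rwa [Subsingleton.elim s' s]

namespace VectorBundle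

variable {E F : VectorBundle X}

/-- The pullback of a bundle to the product with an interval. -/
abbrev cyl (E : VectorBundle X) : VectorBundle (prodSpace X interval.{u}) :=
  E.pullback (prodProj X interval.{u})

lemma Hom.toFun_eq_of_coord (h : Hom E.cyl F.cyl) (x : X.obj) (c c' : X.p.obj x ⟶ interval.{u})
    (hc : ∀ t, c t = c' t) (a : E.total.obj x) :
    h.toFun (CostructuredArrow.mk c) a = h.toFun (CostructuredArrow.mk c') a := by
  have h1 := h.naturality (prodHomOfEq x c c' hc) a
  have h2 : E.cyl.total.map (prodHomOfEq x c c' hc) a = a := E.map_id_apply (x := x) a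
  have h3 := F.map_id_apply (x := x) (h.toFun (CostructuredArrow.mk c) a)
  rw [h2] at h1
  exact h3.symm.trans h1.symm

/-- The restriction to `X × {0}` of a homomorphism on `X × [0,1]`. -/
def Hom.zero (h : Hom E.cyl F.cyl) : Hom E F := h.pullback (prodIncl X interval.{u} (ULift.up 0))

/-- An automorphism on a closed substack which is homotopic to the identity extends to the whole
stack.  The homotopy extends to a homomorphism `d` over `X × [0,1]` which is the identity over
`X × {0}`, and is invertible over a neighborhood of `A`.  The automorphism is the restriction of `d`
to the graph of a function which is `1` on `A` and vanishes outside of that neighborhood. -/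
theorem exists_extension_of_homotopy (hX : IsPresentable X) (A : ClosedSubstack X)
    (ψ : Iso (E.pullback A.incl).cyl (E.pullback A.incl).cyl)
    (hψ : ∀ (y : A.toBased.obj) (a : E.total.obj y.obj),
      ψ.homeo ((prodIncl A.toBased interval.{u} (ULift.up 0)).obj y) a = a) :
    ∃ α : Iso E E, ∀ (y : A.toBased.obj) (a : E.total.obj y.obj),
      α.homeo y.obj a = ψ.homeo ((prodIncl A.toBased interval.{u} (ULift.up 1)).obj y) a := by
  obtain ⟨P⟩ := hX.nonempty_presentation
  obtain ⟨Q⟩ := (hX.prodSpace interval).nonempty_presentation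
  obtain ⟨b, hb⟩ := Hom.exists_extension Q (E := E.cyl) (F := E.cyl) (A := A.cylinder)
    (ψ.toHom.pullback A.cylinderToProd)
  let r : Hom E.cyl E.cyl := (Iso.refl E.cyl).toHom
  let c : Hom E.cyl E.cyl := b.zero.pullback (prodProj X interval)
  -- changed by a constant homotopy, the extension starts with the identity
  let d : Hom E.cyl E.cyl := b - c + r
  have hd : ∀ y, d.fib y = b.fib y - c.fib y + r.fib y := fun y => by
    rw [Hom.fib_add, Hom.fib_sub]
  have hr : ∀ y t, Function.Bijective (r.fib y t) := fun y =>
    (r.bijective_fib_iff y).2 Function.bijective_id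
  have hd₀ : ∀ x : X.obj, d.fib ((prodIncl X interval.{u} (ULift.up 0)).obj x) =
      r.fib ((prodIncl X interval.{u} (ULift.up 0)).obj x) := fun x => by
    have : b.fib ((prodIncl X interval.{u} (ULift.up 0)).obj x) =
        c.fib ((prodIncl X interval.{u} (ULift.up 0)).obj x) := FibHom.ext_tot fun a => rfl
    rw [hd, this, sub_self, zero_add]
  have hdA : ∀ y : A.cylinder.toBased.obj, d.fib y.obj = b.fib y.obj := fun y => by
    have : c.fib y.obj = r.fib y.obj := FibHom.ext_tot fun a =>
      (hb ⟨(prodIncl X interval.{u} (ULift.up 0)).obj y.obj.left, y.property⟩ a).trans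
        (hψ ⟨y.obj.left, y.property⟩ a)
    rw [hd, this, sub_add_cancel]
  obtain ⟨O, hO, hOd⟩ := P.exists_isOpen_bijective d
  -- `d` is invertible over `V × [0,1]`, and `A` lies over `V`
  let V : Set P.B := {ξ | ∀ s : interval.{u}, (ξ, s) ∈ O}
  have hV : IsOpen V := by
    rw [isOpen_iff_mem_nhds]
    intro ξ hξ
    obtain ⟨U, W, hU, -, hξU, hW, hUW⟩ := generalized_tube_lemma (isCompact_singleton (x := ξ))
      (isCompact_univ (X := interval.{u})) hO (by rintro ⟨_, s⟩ ⟨rfl, -⟩; exact hξ s)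
    filter_upwards [hU.mem_nhds (hξU rfl)] with ξ' hξ' s
    exact hUW (mk_mem_prod hξ' (hW trivial))
  let D : Set P.B := {ξ : P.B | ∃ (y : X.obj) (t : X.p.obj y), A.mem y ∧ P.q y t = ξ}
  have hDV : Disjoint Vᶜ D := by
    rw [disjoint_compl_left_iff_subset]
    rintro _ ⟨y, t, hy, rfl⟩ s
    let y' : A.cylinder.toBased.obj := ⟨CostructuredArrow.mk (Y := y)
      (TopCat.ofHom (ContinuousMap.const (X.p.obj y) s)), hy⟩
    refine (hOd y'.obj t).2 ?_
    rw [hdA y']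
    refine (b.bijective_fib_iff y'.obj).2 ?_ t
    rw [funext (hb y')]
    exact (ψ.homeo (A.cylinderToProd.obj y')).bijective
  obtain ⟨f, hf₀, hf₁, hf⟩ := exists_continuous_zero_one_of_isClosed hV.isClosed_compl
    (P.isClosed_image A) hDV
  let l : C(P.B, interval.{u}) := ⟨fun ξ => ULift.up ⟨f ξ, hf ξ⟩, by fun_prop⟩
  refine ⟨Iso.ofHom (d.pullback (P.graph l) : Hom E E) fun y => ?_, fun y a => ?_⟩
  · refine ((d.pullback (P.graph l)).bijective_fib_iff y).2
      ((d.bijective_fib_iff ((P.graph l).obj y)).1 fun (t : X.p.obj y) => ?_)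
    have h1 : (P.q y t, l (P.q y t)) ∈ O := by
      by_cases h : P.q y t ∈ V
      · exact h _
      · have h2 : l (P.q y t) = ULift.up 0 := congrArg ULift.up (Subtype.ext (hf₀ h))
        rw [h2]
        refine (hOd ((prodIncl X interval.{u} (ULift.up 0)).obj y) t).2 ?_
        rw [hd₀]
        exact hr ((prodIncl X interval.{u} (ULift.up 0)).obj y) t
    exact (hOd ((P.graph l).obj y) t).1 h1
  · let y₁ : A.cylinder.toBased.obj :=
      ⟨(prodIncl X interval.{u} (ULift.up 1)).obj y.obj, y.property⟩
    have h1 : ∀ t : X.p.obj y.obj, l (P.q y.obj t) = ULift.up 1 := fun t =>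
      congrArg ULift.up (Subtype.ext (hf₁ ⟨y.obj, t, y.property, rfl⟩))
    refine (d.toFun_eq_of_coord y.obj ((P.graph l).obj y.obj).hom
      (TopCat.ofHom (ContinuousMap.const (X.p.obj y.obj) (ULift.up 1))) h1 a).trans ?_
    refine Eq.trans ?_ (hb y₁ a)
    exact congrArg (fun M : FibHom E.cyl E.cyl y₁.obj => M.tot a) (hdA y₁)

end VectorBundle

/-! ### The category of bundles and isotopy classes of isomorphisms -/

section Pullback

variable {X : BasedCategory.{v, w} TopCat.{u}} {Y : BasedCategory.{v', w'} TopCat.{u}}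
  {Z : BasedCategory.{v'', w''} TopCat.{u}}

/-- The map `Y × K → X × K` given by a map `Y → X`. -/
def prodMap (G : Y ⥤ᵇ X) (K : TopCat.{u}) : prodSpace Y K ⥤ᵇ prodSpace X K where
  obj y := CostructuredArrow.mk (Y := G.obj y.left)
    ((eqToHom G.w : G.toFunctor ⋙ X.p ⟶ Y.p).app y.left ≫ y.hom)
  map {y y'} f := CostructuredArrow.homMk (G.map f.left) (by
    have h1 := (eqToHom G.w : G.toFunctor ⋙ X.p ⟶ Y.p).naturality f.left
    have h2 := CostructuredArrow.w f
    change X.p.map (G.map f.left) ≫ (eqToHom G.w : G.toFunctor ⋙ X.p ⟶ Y.p).app y'.left ≫ y'.hom =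
      (eqToHom G.w : G.toFunctor ⋙ X.p ⟶ Y.p).app y.left ≫ y.hom
    rw [← h2, ← Category.assoc, ← Category.assoc]
    exact congrArg (· ≫ y'.hom) h1)
  map_id y := CostructuredArrow.hom_ext _ _ (G.map_id y.left)
  map_comp f g := CostructuredArrow.hom_ext _ _ (G.map_comp f.left g.left)
  w := by
    change (CostructuredArrow.proj Y.p K ⋙ G.toFunctor) ⋙ X.p = CostructuredArrow.proj Y.p K ⋙ Y.p
    rw [Functor.assoc, G.w]

namespace VectorBundle

@[ext]
lemma Iso.ext {E F : VectorBundle X} {α β : Iso E F} (h : ∀ x a, α.homeo x a = β.homeo x a) :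
    α = β := by
  have : α.homeo = β.homeo := funext fun x => Homeomorph.ext (h x)
  cases α
  cases β
  cases this
  rfl

/-- Isomorphic maps of stacks have isomorphic pullbacks. -/
def Iso.ofNatIso (E : VectorBundle X) {F G : Y ⥤ᵇ X} (e : F ≅ G) :
    Iso (E.pullback F) (E.pullback G) where
  homeo y := TopCat.homeoOfIso (E.total.mapIso
    { hom := e.hom.toNatTrans.app y
      inv := e.inv.toNatTrans.app y
      hom_inv_id := congrArg (fun α : F ⟶ F => α.toNatTrans.app y) e.hom_inv_id
      inv_hom_id := congrArg (fun α : G ⟶ G => α.toNatTrans.app y) e.inv_hom_id })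
  naturality := (Hom.ofNatTrans E e.hom).naturality
  proj_eq := (Hom.ofNatTrans E e.hom).proj_eq
  map_vadd := (Hom.ofNatTrans E e.hom).map_vadd
  map_smul := (Hom.ofNatTrans E e.hom).map_smul

/-- Pullback along a composition. -/
def Iso.pullbackComp (E : VectorBundle X) (F : Y ⥤ᵇ X) (G : Z ⥤ᵇ Y) :
    Iso ((E.pullback F).pullback G) (E.pullback (G.comp F)) where
  homeo _ := Homeomorph.refl _
  naturality _ _ := rfl
  proj_eq z a := by
    have h : (eqToHom F.w : F.toFunctor ⋙ X.p ⟶ Y.p).app (G.obj z) ≫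
        (eqToHom G.w : G.toFunctor ⋙ Y.p ⟶ Z.p).app z =
          (eqToHom (G.comp F).w : (G.comp F).toFunctor ⋙ X.p ⟶ Z.p).app z := by
      rw [eqToHom_app, eqToHom_app, eqToHom_app]
      exact eqToHom_trans _ _
    exact (ConcreteCategory.congr_hom h (E.proj.app (F.obj (G.obj z)) a)).symm
  map_vadd _ _ _ _ _ := rfl
  map_smul _ _ _ := rfl

/-- An isomorphism over `X × [0,1]` takes the same values at objects whose coordinate functions
agree pointwise. -/
lemma Iso.homeo_eq_of_coord {E F : VectorBundle X} (φ : Iso E.cyl F.cyl) (x : X.obj)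
    (c c' : X.p.obj x ⟶ interval.{u}) (hc : ∀ t, c t = c' t) (a : E.total.obj x) :
    φ.homeo (CostructuredArrow.mk c) a = φ.homeo (CostructuredArrow.mk c') a :=
  φ.toHom.toFun_eq_of_coord x c c' hc a

/-- Two isomorphisms are isotopic if they are the ends of an isomorphism on the product with an
interval. -/
def Isotopic {E F : VectorBundle X} (α β : Iso E F) : Prop :=
  ∃ φ : Iso E.cyl F.cyl,
    (∀ (x : X.obj) (a : E.total.obj x),
      φ.homeo ((prodIncl X interval.{u} (ULift.up 0)).obj x) a = α.homeo x a) ∧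
    ∀ (x : X.obj) (a : E.total.obj x),
      φ.homeo ((prodIncl X interval.{u} (ULift.up 1)).obj x) a = β.homeo x a

lemma Isotopic.trans_left {E F G : VectorBundle X} (α : Iso E F) {β γ : Iso F G}
    (h : Isotopic β γ) : Isotopic (α.trans β) (α.trans γ) := by
  obtain ⟨φ, h0, h1⟩ := h
  exact ⟨(α.pullback (prodProj X interval)).trans φ, fun x a => h0 x (α.homeo x a),
    fun x a => h1 x (α.homeo x a)⟩

lemma Isotopic.trans_right {E F G : VectorBundle X} {α β : Iso E F} (h : Isotopic α β)
    (γ : Iso F G) : Isotopic (α.trans γ) (β.trans γ) := by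
  obtain ⟨φ, h0, h1⟩ := h
  exact ⟨φ.trans (γ.pullback (prodProj X interval)), fun x a => congrArg (γ.homeo x) (h0 x a),
    fun x a => congrArg (γ.homeo x) (h1 x a)⟩

/-- The pullback to `Y × [0,1]` of a bundle on `X`, along the two sides of a square. -/
def Iso.cylPullback (E : VectorBundle X) (G : Y ⥤ᵇ X) :
    Iso (E.pullback G).cyl (E.cyl.pullback (prodMap G interval.{u})) :=
  (Iso.pullbackComp E G (prodProj Y interval)).trans
    (Iso.pullbackComp E (prodProj X interval) (prodMap G interval)).symm

lemma Isotopic.pullback {E F : VectorBundle X} {α β : Iso E F} (h : Isotopic α β) (G : Y ⥤ᵇ X) :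
    Isotopic (α.pullback G) (β.pullback G) := by
  obtain ⟨φ, h0, h1⟩ := h
  refine ⟨(Iso.cylPullback E G).trans
    ((φ.pullback (prodMap G interval)).trans (Iso.cylPullback F G).symm), fun y a => ?_,
    fun y a => ?_⟩
  · refine Eq.trans ?_ (h0 (G.obj y) a)
    exact φ.homeo_eq_of_coord (G.obj y) ((prodMap G interval).obj
      ((prodIncl Y interval.{u} (ULift.up 0)).obj y)).hom _ (fun t => rfl) a
  · refine Eq.trans ?_ (h1 (G.obj y) a)
    exact φ.homeo_eq_of_coord (G.obj y) ((prodMap G interval).obj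
      ((prodIncl Y interval.{u} (ULift.up 1)).obj y)).hom _ (fun t => rfl) a

end VectorBundle

variable (X) in
/-- Vector bundles on `X`, as the objects of a category whose morphisms are the isotopy classes of
isomorphisms. -/
structure IsotopyCat where
  bundle : VectorBundle X

namespace IsotopyCat

instance : Category (IsotopyCat X) where
  Hom E F := Quot (VectorBundle.Isotopic (E := E.bundle) (F := F.bundle))
  id E := Quot.mk _ (VectorBundle.Iso.refl E.bundle)
  comp := Quot.map₂ VectorBundle.Iso.trans (fun α _ _ h => h.trans_left α)
    (fun _ _ γ h => h.trans_right γ)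
  id_comp := by
    rintro E F ⟨α⟩
    rfl
  comp_id := by
    rintro E F ⟨α⟩
    rfl
  assoc := by
    rintro E F G H ⟨α⟩ ⟨β⟩ ⟨γ⟩
    rfl

/-- The isotopy class of an isomorphism. -/
def homMk {E F : VectorBundle X} (α : VectorBundle.Iso E F) :
    (⟨E⟩ : IsotopyCat X) ⟶ ⟨F⟩ := Quot.mk _ α

lemma exists_homMk {E F : VectorBundle X} (x : (⟨E⟩ : IsotopyCat X) ⟶ ⟨F⟩) :
    ∃ α : VectorBundle.Iso E F, homMk α = x := Quot.exists_rep x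

/-- An isomorphism of vector bundles gives an isomorphism in the category. -/
def isoMk {E F : VectorBundle X} (α : VectorBundle.Iso E F) :
    (⟨E⟩ : IsotopyCat X) ≅ ⟨F⟩ where
  hom := homMk α
  inv := homMk α.symm
  hom_inv_id := congrArg homMk (VectorBundle.Iso.ext fun x a => (α.homeo x).symm_apply_apply a)
  inv_hom_id := congrArg homMk (VectorBundle.Iso.ext fun x a => (α.homeo x).apply_symm_apply a)

/-- Pullback along a map of stacks. -/
def pull (G : Y ⥤ᵇ X) : IsotopyCat X ⥤ IsotopyCat Y where
  obj E := ⟨E.bundle.pullback G⟩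
  map := Quot.map (fun α => α.pullback G) fun _ _ h => h.pullback G
  map_id _ := rfl
  map_comp := by
    rintro E F G ⟨α⟩ ⟨β⟩
    rfl

/-- Pullback along a composition of maps of stacks. -/
def pullComp (F : Y ⥤ᵇ X) (G : Z ⥤ᵇ Y) : pull F ⋙ pull G ≅ pull (G.comp F) :=
  NatIso.ofComponents (fun E => isoMk (VectorBundle.Iso.pullbackComp E.bundle F G)) (by
    rintro E E' ⟨α⟩
    exact congrArg homMk (VectorBundle.Iso.ext fun x a => rfl))

/-- Pullback along the identity. -/
def pullId : pull (BasedFunctor.id X) ≅ 𝟭 (IsotopyCat X) :=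
  NatIso.ofComponents (fun E => isoMk (VectorBundle.Iso.refl E.bundle)) (by
    rintro E E' ⟨α⟩
    rfl)

/-- Pullback along isomorphic maps of stacks. -/
def pullIso {F G : Y ⥤ᵇ X} (e : F ≅ G) : pull F ≅ pull G :=
  NatIso.ofComponents (fun E => isoMk (VectorBundle.Iso.ofNatIso E.bundle e)) (by
    rintro E E' ⟨α⟩
    exact congrArg homMk (VectorBundle.Iso.ext
      fun y a => (α.naturality (e.hom.toNatTrans.app y) a).symm))

end IsotopyCat

end Pullback

/-! ### Homotopy invariance of the category of bundles -/

section HomotopyInvariance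

variable {X : BasedCategory.{v, w} TopCat.{u}} {Y : BasedCategory.{v', w'} TopCat.{u}}

namespace VectorBundle

/-- The restriction of `E × [0,1]` to `X × {t}` is `E`. -/
def Iso.cylRestrict (E : VectorBundle X) (t : interval.{u}) :
    Iso E (E.cyl.pullback (prodIncl X interval.{u} t)) where
  homeo _ := Homeomorph.refl _
  naturality _ _ := rfl
  proj_eq _ _ := rfl
  map_vadd _ _ _ _ _ := rfl
  map_smul _ _ _ := rfl

end VectorBundle

namespace IsotopyCat

/-- An isomorphism of `E₀ × [0,1]` with `E` restricts at time `t` to an isomorphism of `E₀` with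
the restriction of `E` to `X × {t}`. -/
def restrictIso {E₀ : VectorBundle X} {E : VectorBundle (prodSpace X interval.{u})}
    (κ : VectorBundle.Iso E₀.cyl E) (t : interval.{u}) :
    (⟨E₀⟩ : IsotopyCat X) ≅ (pull (prodIncl X interval.{u} t)).obj ⟨E⟩ :=
  isoMk ((VectorBundle.Iso.cylRestrict E₀ t).trans (κ.pullback (prodIncl X interval.{u} t)))

lemma restrictIso_naturality {E₀ F₀ : VectorBundle X}
    {E F : VectorBundle (prodSpace X interval.{u})} (κ : VectorBundle.Iso E₀.cyl E)
    (l : VectorBundle.Iso F₀.cyl F) (x : (⟨E⟩ : IsotopyCat (prodSpace X interval.{u})) ⟶ ⟨F⟩) :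
    (restrictIso κ (ULift.up 0)).hom ≫ (pull (prodIncl X interval.{u} (ULift.up 0))).map x ≫
        (restrictIso l (ULift.up 0)).inv =
      (restrictIso κ (ULift.up 1)).hom ≫ (pull (prodIncl X interval.{u} (ULift.up 1))).map x ≫
        (restrictIso l (ULift.up 1)).inv := by
  obtain ⟨i, rfl⟩ := exists_homMk x
  exact Quot.sound ⟨κ.trans (i.trans l.symm), fun _ _ => rfl, fun _ _ => rfl⟩

/-- The two ends of `X × [0,1]` give isomorphic restriction functors, because every bundle on
`X × [0,1]` is pulled back from `X`. -/
lemma nonempty_pull_prodIncl_iso (hX : IsPresentable X) :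
    Nonempty (pull (prodIncl X interval.{u} (ULift.up 0)) ≅
      pull (prodIncl X interval.{u} (ULift.up 1))) := by
  have κ := fun E : VectorBundle (prodSpace X interval.{u}) =>
    VectorBundle.exists_iso_atZero hX E
  refine ⟨NatIso.ofComponents (fun E => (restrictIso (κ E.bundle).some (ULift.up 0)).symm ≪≫
    restrictIso (κ E.bundle).some (ULift.up 1)) (fun {E F} x => ?_)⟩
  have h := restrictIso_naturality (κ E.bundle).some (κ F.bundle).some x
  change _ ≫ (restrictIso (κ F.bundle).some _).inv ≫ (restrictIso (κ F.bundle).some _).hom =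
    ((restrictIso (κ E.bundle).some _).inv ≫ (restrictIso (κ E.bundle).some _).hom) ≫ _
  rw [Category.assoc, Iso.eq_inv_comp]
  have h' := congrArg (· ≫ (restrictIso (κ F.bundle).some (ULift.up 1)).hom) h
  simpa only [Category.assoc, Iso.inv_hom_id, Category.comp_id] using h'

/-- Homotopic maps of stacks induce isomorphic pullback functors. -/
lemma nonempty_pull_iso (hY : IsPresentable Y) {F G : Y ⥤ᵇ X} (h : Homotopic F G) :
    Nonempty (pull F ≅ pull G) := by
  obtain ⟨H, ⟨e₀⟩, ⟨e₁⟩⟩ := h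
  obtain ⟨e⟩ := nonempty_pull_prodIncl_iso hY
  exact ⟨(pullIso e₀).symm ≪≫ (pullComp H _).symm ≪≫ Functor.isoWhiskerLeft (pull H) e ≪≫
    pullComp H _ ≪≫ pullIso e₁⟩

lemma isEquivalence_pull (hX : IsPresentable X) (hY : IsPresentable Y) {F : Y ⥤ᵇ X}
    (h : IsHomotopyEquiv F) : (pull F).IsEquivalence := by
  obtain ⟨G, hFG, hGF⟩ := h
  obtain ⟨e⟩ := nonempty_pull_iso hY hFG
  obtain ⟨e'⟩ := nonempty_pull_iso hX hGF
  exact (CategoryTheory.Equivalence.mk (pull F) (pull G)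
    (pullId.symm ≪≫ e'.symm ≪≫ (pullComp F G).symm)
    (pullComp G F ≪≫ e ≪≫ pullId)).isEquivalence_functor

end IsotopyCat

end HomotopyInvariance

/-! ### Invariance of relative K-theory -/

section Invariance

variable {X : BasedCategory.{v, w} TopCat.{u}} {X' : BasedCategory.{v', w'} TopCat.{u}}
  {A : ClosedSubstack X} {A' : ClosedSubstack X'}

namespace Triple

/-- Isotopic identifications over `A` define isomorphic triples: `i⁻¹ ∘ i'` is homotopic to the
identity and hence extends to an automorphism of `E` over `X`. -/
lemma isIso_of_isotopic (hX : IsPresentable X) {E F : VectorBundle X}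
    {i i' : VectorBundle.Iso (E.pullback A.incl) (F.pullback A.incl)}
    (h : VectorBundle.Isotopic i i') :
    IsIso (⟨E, F, i⟩ : Triple A.incl) ⟨E, F, i'⟩ := by
  obtain ⟨φ, h0, h1⟩ := h
  obtain ⟨α, hα⟩ := VectorBundle.exists_extension_of_homotopy hX A
    (φ.trans (i.symm.pullback (prodProj A.toBased interval)))
    (fun y a => (congrArg (i.homeo y).symm (h0 y a)).trans ((i.homeo y).symm_apply_apply a))
  refine IsIso.symm ⟨α, .refl _, fun y a => ?_⟩
  exact ((congrArg (i.homeo y) ((hα y a).trans (congrArg (i.homeo y).symm (h1 y a)))).trans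
    ((i.homeo y).apply_symm_apply _)).symm

/-- A triple depends only on the isotopy class of its identification, and a commutative square of
isotopy classes gives an isomorphism of triples. -/
lemma isIso_of_isotopyCat (hX : IsPresentable X) {S T : Triple A.incl}
    (x₀ : (⟨S.E₀⟩ : IsotopyCat X) ⟶ ⟨T.E₀⟩) (x₁ : (⟨S.E₁⟩ : IsotopyCat X) ⟶ ⟨T.E₁⟩)
    (h : IsotopyCat.homMk S.i ≫ (IsotopyCat.pull A.incl).map x₁ =
      (IsotopyCat.pull A.incl).map x₀ ≫ IsotopyCat.homMk T.i) : IsIso S T := by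
  obtain ⟨α₀, rfl⟩ := IsotopyCat.exists_homMk x₀
  obtain ⟨α₁, rfl⟩ := IsotopyCat.exists_homMk x₁
  have h' : Relation.EqvGen VectorBundle.Isotopic (S.i.trans (α₁.pullback A.incl))
      ((α₀.pullback A.incl).trans T.i) := Quot.eqvGen_exact h
  have key : ∀ {i i' : VectorBundle.Iso (S.E₀.pullback A.incl) (T.E₁.pullback A.incl)},
      Relation.EqvGen VectorBundle.Isotopic i i' →
        IsIso (⟨S.E₀, T.E₁, i⟩ : Triple A.incl) ⟨S.E₀, T.E₁, i'⟩ := by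
    intro i i' hi
    induction hi with
    | rel i i' hi => exact isIso_of_isotopic hX hi
    | refl i => exact .refl _
    | symm i i' _ ih => exact ih.symm
    | trans i i' i'' _ _ ih ih' => exact ih.trans ih'
  refine IsIso.trans (T := ⟨S.E₀, T.E₁, S.i.trans (α₁.pullback A.incl)⟩)
    ⟨.refl _, α₁, fun _ _ => rfl⟩ ((key h').trans ⟨α₀, .refl _, fun _ _ => rfl⟩)

end Triple

namespace PairMap

/-- The two ways of pulling back a bundle on `X'` to `A` agree. -/
def comparison (f : PairMap A A') (E : VectorBundle X') :
    VectorBundle.Iso ((E.pullback f.total).pullback A.incl)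
      ((E.pullback A'.incl).pullback f.sub) :=
  (VectorBundle.Iso.pullbackComp E f.total A.incl).trans
    (VectorBundle.Iso.pullbackComp E A'.incl f.sub).symm

lemma pull_sub_map (f : PairMap A A') {E F : VectorBundle X'}
    {x : (⟨E⟩ : IsotopyCat X') ⟶ ⟨F⟩}
    {α : VectorBundle.Iso (E.pullback f.total) (F.pullback f.total)}
    (h : (IsotopyCat.pull f.total).map x = IsotopyCat.homMk α) :
    (IsotopyCat.pull f.sub).map ((IsotopyCat.pull A'.incl).map x) =
      IsotopyCat.homMk ((f.comparison E).symm.trans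
        ((α.pullback A.incl).trans (f.comparison F))) := by
  obtain ⟨β, rfl⟩ := IsotopyCat.exists_homMk x
  have h' := congrArg (fun y => IsotopyCat.homMk (f.comparison E).symm ≫
    (IsotopyCat.pull A.incl).map y ≫ IsotopyCat.homMk (f.comparison F)) h
  exact Eq.trans (congrArg IsotopyCat.homMk (VectorBundle.Iso.ext fun _ _ => rfl)) h'

/-- Triples with isomorphic pullbacks are isomorphic: the isomorphisms of the pullbacks come from
isotopy classes over `X'`, and these are compatible with the identifications over `A'` because they
are so over `A`. -/
lemma pullbackClass_injective (f : PairMap A A') (hX' : IsPresentable X')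
    [(IsotopyCat.pull f.total).Full] [(IsotopyCat.pull f.sub).Faithful] :
    Function.Injective f.pullbackClass := by
  rintro ⟨S⟩ ⟨T⟩ h
  obtain ⟨α₀, α₁, h⟩ : Triple.IsIso (f.pullbackTriple S) (f.pullbackTriple T) := Quotient.exact h
  obtain ⟨x₀, h₀⟩ := (IsotopyCat.pull f.total).map_surjective
    (X := (⟨S.E₀⟩ : IsotopyCat X')) (Y := (⟨T.E₀⟩ : IsotopyCat X')) (Quot.mk _ α₀)
  obtain ⟨x₁, h₁⟩ := (IsotopyCat.pull f.total).map_surjective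
    (X := (⟨S.E₁⟩ : IsotopyCat X')) (Y := (⟨T.E₁⟩ : IsotopyCat X')) (Quot.mk _ α₁)
  refine Quotient.sound (Triple.isIso_of_isotopyCat hX' x₀ x₁ ?_)
  apply (IsotopyCat.pull f.sub).map_injective
  have h' : IsotopyCat.homMk ((S.i.pullback f.sub).trans ((f.comparison S.E₁).symm.trans
      (VectorBundle.Iso.trans (VectorBundle.Iso.pullback α₁ A.incl) (f.comparison T.E₁)))) =
      IsotopyCat.homMk (((f.comparison S.E₀).symm.trans
        (VectorBundle.Iso.trans (VectorBundle.Iso.pullback α₀ A.incl) (f.comparison T.E₀))).trans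
          (T.i.pullback f.sub)) :=
    congrArg IsotopyCat.homMk (VectorBundle.Iso.ext fun y a => h y a)
  have l := congrArg (fun y => IsotopyCat.homMk (S.i.pullback f.sub) ≫ y) (f.pull_sub_map h₁)
  have r := congrArg (fun y => y ≫ IsotopyCat.homMk (T.i.pullback f.sub)) (f.pull_sub_map h₀)
  exact (Functor.map_comp _ _ _).trans (l.trans (h'.trans (r.symm.trans
    ((IsotopyCat.pull f.sub).map_comp ((IsotopyCat.pull A'.incl).map x₀)
      (IsotopyCat.homMk T.i)).symm)))

/-- Every triple is the pullback of a triple: the bundles descend along `X → X'`, and the isotopy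
class of the identification descends along `A → A'`. -/
lemma pullbackClass_surjective (f : PairMap A A') (hX : IsPresentable X)
    [(IsotopyCat.pull f.total).EssSurj] [(IsotopyCat.pull f.sub).Full] :
    Function.Surjective f.pullbackClass := by
  rintro ⟨S⟩
  obtain ⟨⟨E⟩, ⟨e⟩⟩ := Functor.EssSurj.mem_essImage (F := IsotopyCat.pull f.total) ⟨S.E₀⟩
  obtain ⟨⟨F⟩, ⟨e'⟩⟩ := Functor.EssSurj.mem_essImage (F := IsotopyCat.pull f.total) ⟨S.E₁⟩
  obtain ⟨α, -⟩ := IsotopyCat.exists_homMk (E := E.pullback f.total) e.hom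
  obtain ⟨β, -⟩ := IsotopyCat.exists_homMk (E := F.pullback f.total) e'.hom
  obtain ⟨x, hx⟩ := (IsotopyCat.pull f.sub).map_surjective
    (X := ⟨E.pullback A'.incl⟩) (Y := ⟨F.pullback A'.incl⟩)
    (IsotopyCat.homMk ((f.comparison E).symm.trans ((α.pullback A.incl).trans
      (S.i.trans ((β.symm.pullback A.incl).trans (f.comparison F))))))
  obtain ⟨i, rfl⟩ := IsotopyCat.exists_homMk x
  refine ⟨Quotient.mk _ ⟨E, F, i⟩, Quotient.sound (Triple.isIso_of_isotopyCat hX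
    (IsotopyCat.homMk α) (IsotopyCat.homMk β) ?_)⟩
  have h := congrArg (fun y => IsotopyCat.homMk (f.comparison E) ≫ y ≫
    IsotopyCat.homMk ((f.comparison F).symm.trans (β.pullback A.incl))) hx
  refine Eq.trans (congrArg IsotopyCat.homMk (VectorBundle.Iso.ext fun _ _ => rfl))
    (h.trans (congrArg IsotopyCat.homMk (VectorBundle.Iso.ext fun y a => ?_)))
  exact (β.homeo y.obj).apply_symm_apply _

lemma exists_trivialTriples_of_mem (f : PairMap A A') [(IsotopyCat.pull f.total).EssSurj]
    {s : TripleClass A.incl} (hs : s ∈ trivialTriples A.incl) :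
    ∃ s' ∈ trivialTriples A'.incl, f.pullbackClass s' = s := by
  obtain ⟨E, rfl⟩ := hs
  obtain ⟨⟨E'⟩, ⟨e⟩⟩ := Functor.EssSurj.mem_essImage (F := IsotopyCat.pull f.total) ⟨E⟩
  obtain ⟨α, -⟩ := IsotopyCat.exists_homMk (E := E'.pullback f.total) e.hom
  exact ⟨_, ⟨E', rfl⟩, Quotient.sound ⟨α, α, fun _ _ => rfl⟩⟩

lemma mapK_bijective (f : PairMap A A') (hX : IsPresentable X) (hX' : IsPresentable X')
    [(IsotopyCat.pull f.total).IsEquivalence] [(IsotopyCat.pull f.sub).IsEquivalence] :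
    Function.Bijective f.mapK := by
  constructor
  · rintro ⟨x⟩ ⟨y⟩ h
    obtain ⟨a, ha, b, hb, h⟩ := (AddCon.eq (quotientCon (trivialTriples A.incl))).1 h
    obtain ⟨a', ha', rfl⟩ := f.exists_trivialTriples_of_mem ha
    obtain ⟨b', hb', rfl⟩ := f.exists_trivialTriples_of_mem hb
    refine (AddCon.eq (quotientCon (trivialTriples A'.incl))).2 ⟨a', ha', b', hb', ?_⟩
    apply f.pullbackClass_injective hX'
    exact (f.pullbackClass.map_add _ _).trans (h.trans (f.pullbackClass.map_add _ _).symm)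
  · rintro ⟨x⟩
    obtain ⟨x', rfl⟩ := f.pullbackClass_surjective hX x
    exact ⟨Quotient.mk _ x', rfl⟩

theorem mapK_bijective_of_isHomotopyEquiv (hX : IsPresentable X) (hX' : IsPresentable X')
    (f : PairMap A A') (hf : IsHomotopyEquiv f.total) (hfA : IsHomotopyEquiv f.sub) :
    Function.Bijective f.mapK := by
  have := IsotopyCat.isEquivalence_pull hX' hX hf
  have := IsotopyCat.isEquivalence_pull (hX'.closedSubstack A') (hX.closedSubstack A) hfA
  exact f.mapK_bijective hX hX'

end PairMap

end Invariance

end Orbispace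

theorem proposition5 {X : CategoryTheory.BasedCategory.{v, w} TopCat.{u}}
    {X' : CategoryTheory.BasedCategory.{v', w'} TopCat.{u}}
    (hX : Orbispace.IsParacompactOrbispace X) (hX' : Orbispace.IsParacompactOrbispace X')
    (A : Orbispace.ClosedSubstack X) (A' : Orbispace.ClosedSubstack X')
    (f : Orbispace.PairMap A A')
    (hf : Orbispace.IsHomotopyEquiv f.total) (hfA : Orbispace.IsHomotopyEquiv f.sub) :
    Function.Bijective (f.mapK : A'.K →+ A.K) :=
  f.mapK_bijective_of_isHomotopyEquiv hX.isPresentable hX'.isPresentable hf hfA
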